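/- Fix $\gamma\ge 1$. For $0<v_+<1$ put $a=v_+^{\gamma}\frac{1-v_+}{1-v_+^{\gamma}}$ and let $\hat v>0$ be a shock profile, i.e. a solution on $\mathbb{R}$ of $\hat v'=\hat v\,(\hat v-1+a(\hat v^{-\gamma}-1))$ with $\hat v(-\infty)=1$, $\hat v(+\infty)=v_+$ (unique up to translation). Consider the system $W'=A(x,\lambda)W$ with $$A(x,\lambda)=\begin{pmatrix}0&\lambda&1\\0&0&1\\ \lambda\hat v&\lambda\hat v&f(\hat v)-\lambda\end{pmatrix},\qquad f(\hat v)=2\hat v-a(\gamma-1)\hat v^{-\gamma}-(a+1),$$ which expresses the integrated eigenvalue equations of the isentropic Navier--Stokes shock. An Evans function is $D(\lambda)=\widetilde W_1^+(0,\lambda)^{*}\,W_1^-(0,\lambda)$, $\operatorname{Re}\lambda\ge 0$, where $W_1^-$ is a nontrivial solution of $W'=AW$ decaying as $x\to-\infty$, depending analytically on $\lambda$ in $\{\operatorname{Re}\lambda\ge0\}$, and $\widetilde W_1^+$ is a nontrivial solution of the adjoint system $\widetilde W'=-A^{*}\widetilde W$ which decays as $x\to+\infty$ for $\lambda\neq0$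 and whose complex conjugate depends analytically on $\lambda$ in $\{\operatorname{Re}\lambda\ge0\}$, with a nontrivial value at $\lambda=0$ (where it is defined by analytic extension). (Analytic on $\{\operatorname{Re}\lambda\ge 0\}$ means analytic in a neighbourhood of each of its points.) Thus $D$ is determined up to a nonvanishing analytic factor. The limiting system is $W'=A^0(x,\lambda)W$, where $A^0$ is obtained from $A$ by replacing $\hat v$ by $\hat v_0(x)=\frac{1-\tanh(x/2)}{2}$ and $f(\hat v)$ by $2\hat v_0-1$. A limiting Evans function is $D^0(\lambda)=\widetilde W_1^{0+}(0,\lambda)^{*}\,W_1^{0-}(0,\lambda)$, $\operatorname{Re}\lambda\ge 0$, where $W_1^{0-}$ is a nontrivial solution of the limiting system decaying as $x\to-\infty$, depending analytically on $\lambda$, and $\widetilde W_1^{0+}$ is the solution of $\widetilde W'=-(A^0)^{*}\widetilde W$ that tends to $(0,1,(1+\bar\lambda)^{-1})^T$ as $x\to+\infty$. Let $\Lambda$ be a compact subset of $\{\operatorname{Re}\lambda\ge 0\}$ and let $D^0$ be a limiting Evans function. (i) If $D^0$ is nonvanishing on $\Lambda$, then there is $\delta>0$ such that for every $0<v_+<\delta$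 every Evans function $D$ with parameters $\gamma,v_+$ is nonvanishing on $\Lambda$. (ii) Conversely, if there are arbitrarily small $v_+>0$ for which some Evans function $D$ with parameters $\gamma,v_+$ is nonvanishing on the interior of $\Lambda$ (in particular, if this holds for all sufficiently small $v_+$), then $D^0$ is nonvanishing on the interior of $\Lambda$. -/

import Mathlib

open Filter Topology

namespace IsentropicShock

/-- The constant `a` determined from the adiabatic index `γ` and the endstate `vp = v₊`
by the Rankine-Hugoniot condition, for the normalization `v₋ = 1`. -/
noncomputable def rhConst (γ vp : ℝ) : ℝ :=
  vp ^ γ * (1 - vp) / (1 - vp ^ γ)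

/-- `vhat` is a viscous shock profile joining `v₋ = 1` at `-∞` to `v₊ = vp` at `+∞`:
a positive solution on the whole line of `v' = v (v - 1 + a (v ^ (-γ) - 1))` with these limits.
Profiles are unique only up to translation, and no translate is singled out here. -/
structure IsProfile (γ vp : ℝ) (vhat : ℝ → ℝ) : Prop where
  pos : ∀ x, 0 < vhat x
  ode : ∀ x, HasDerivAt vhat
    (vhat x * (vhat x - 1 + rhConst γ vp * (vhat x ^ (-γ) - 1))) x
  tendsto_atBot : Tendsto vhat atBot (𝓝 1)
  tendsto_atTop : Tendsto vhat atTop (𝓝 vp)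

/-- The function `f` in the lower right entry of the coefficient matrix. -/
noncomputable def fCoeff (γ vp w : ℝ) : ℝ :=
  2 * w - rhConst γ vp * (γ - 1) * w ^ (-γ) - (rhConst γ vp + 1)

/-- The coefficient matrix of the first-order eigenvalue system in the variables `(u, v, v')`;
`w` is the value of the profile, `φ` the value of `f`, and `z` the spectral parameter. -/
def coeffMatrix (w φ : ℝ) (z : ℂ) : Matrix (Fin 3) (Fin 3) ℂ :=
  !![0, z, 1;
     0, 0, 1;
     z * (w : ℂ), z * (w : ℂ), (φ : ℂ) - z]

/-- The matrix `A(x, z)` of the integrated eigenvalue system about the profile `vhat`. -/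
noncomputable def matA (γ vp : ℝ) (vhat : ℝ → ℝ) (x : ℝ) (z : ℂ) : Matrix (Fin 3) (Fin 3) ℂ :=
  coeffMatrix (vhat x) (fCoeff γ vp (vhat x)) z

/-- The explicit limiting profile, a solution of `v' = v (v - 1)`. -/
noncomputable def limProfile (x : ℝ) : ℝ := (1 - Real.tanh (x / 2)) / 2

/-- The matrix `A⁰(x, z)` of the limiting eigenvalue system. -/
noncomputable def matA0 (x : ℝ) (z : ℂ) : Matrix (Fin 3) (Fin 3) ℂ :=
  coeffMatrix (limProfile x) (2 * limProfile x - 1) z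

/-- `W` solves `W' = A(x) W` on the whole line. -/
def Solves (A : ℝ → Matrix (Fin 3) (Fin 3) ℂ) (W : ℝ → Fin 3 → ℂ) : Prop :=
  ∀ x, HasDerivAt W ((A x).mulVec (W x)) x

/-- `W` solves the adjoint system `W' = - A(x)^* W` on the whole line. -/
def SolvesAdjoint (A : ℝ → Matrix (Fin 3) (Fin 3) ℂ) (W : ℝ → Fin 3 → ℂ) : Prop :=
  ∀ x, HasDerivAt W (-((A x).conjTranspose.mulVec (W x))) x

/-- The closed right half-plane. -/
def closedRHP : Set ℂ := {z : ℂ | 0 ≤ z.re}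

/-- `W z` is, for each `z` in the closed right half-plane, a nontrivial solution of
`W' = A(x, z) W` decaying at `x = -∞`, and it is chosen analytically in `z`. -/
structure IsUnstableMode (A : ℝ → ℂ → Matrix (Fin 3) (Fin 3) ℂ) (W : ℂ → ℝ → Fin 3 → ℂ) :
    Prop where
  solves : ∀ z ∈ closedRHP, Solves (fun x => A x z) (W z)
  ne_zero : ∀ z ∈ closedRHP, W z 0 ≠ 0
  decays : ∀ z ∈ closedRHP, Tendsto (W z) atBot (𝓝 0)
  analytic : ∀ x, AnalyticOnNhd ℂ (fun z => W z x) closedRHP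

/-- `Wt z` is, for each `z ≠ 0` in the closed right half-plane, a nontrivial solution of the
adjoint system `W' = - A(x, z)^* W` decaying at `x = +∞`. Its complex conjugate is analytic in
`z`, and at `z = 0`, where decay no longer determines the solution, `Wt` is the (nontrivial)
analytic extension. -/
structure IsDualMode (A : ℝ → ℂ → Matrix (Fin 3) (Fin 3) ℂ) (Wt : ℂ → ℝ → Fin 3 → ℂ) :
    Prop where
  solves : ∀ z ∈ closedRHP, SolvesAdjoint (fun x => A x z) (Wt z)
  ne_zero : ∀ z ∈ closedRHP, Wt z 0 ≠ 0
  decays : ∀ z ∈ closedRHP, z ≠ 0 → Tendsto (Wt z) atTop (𝓝 0)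
  analytic : ∀ x, AnalyticOnNhd ℂ (fun z => star (Wt z x)) closedRHP

/-- `D` is an Evans function of the eigenvalue system with parameters `γ`, `vp`: on the closed
right half-plane `D` is the Hermitian product at `x = 0` of a dual mode from `+∞` with an unstable
mode from `-∞`. As usual it is determined only up to a nonvanishing analytic factor; all
choices of modes and of the translate of the profile are admitted. -/
def IsEvansFunction (γ vp : ℝ) (D : ℂ → ℂ) : Prop :=
  ∃ (vhat : ℝ → ℝ) (W Wt : ℂ → ℝ → Fin 3 → ℂ),
    IsProfile γ vp vhat ∧
    IsUnstableMode (matA γ vp vhat) W ∧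
    IsDualMode (matA γ vp vhat) Wt ∧
    ∀ z ∈ closedRHP, D z = dotProduct (star (Wt z 0)) (W z 0)

/-- The vector `(0, 1, (1 + z̄)⁻¹)`, orthogonal to the limiting directions of the slow and fast
decaying modes at `x = +∞`. -/
noncomputable def limDualVector (z : ℂ) : Fin 3 → ℂ :=
  ![0, 1, (1 + star z)⁻¹]

/-- `D₀` is a limiting (reduced) Evans function: on the closed right half-plane `D₀` is the
Hermitian product at `x = 0` of the solution `Wt` of the limiting adjoint system which is
asymptotic to `limDualVector` at `x = +∞` with an unstable mode `W` of the limiting system. -/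
def IsLimitingEvansFunction (D₀ : ℂ → ℂ) : Prop :=
  ∃ W Wt : ℂ → ℝ → Fin 3 → ℂ,
    IsUnstableMode matA0 W ∧
    (∀ z ∈ closedRHP, SolvesAdjoint (fun x => matA0 x z) (Wt z) ∧
      Tendsto (Wt z) atTop (𝓝 (limDualVector z))) ∧
    ∀ z ∈ closedRHP, D₀ z = dotProduct (star (Wt z 0)) (W z 0)

end IsentropicShock

/-! ### Differential inequalities. -/

namespace IsentropicShock

/-! Both claims follow from one uniform approximation, `exists_uniform_approximation`: on bounded
parts of the closed right half-plane, every Evans function, divided by nonvanishing normalizing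
factors, converges uniformly as `v₊ → 0` to `D⁰(z) / u⁰(x₀)`, where `u⁰(x₀)` is the nonvanishing
first component of the limiting unstable mode at a fixed point `x₀`. Part (i) is then a minimum over
a compact set. Part (ii) is Hurwitz' theorem (`ne_zero_of_approximation`) in an open half-disc. The
limit is not identically zero there, because the limiting mode at `z = 0` is explicit and gives
`D⁰(0) ≠ 0`.

Left end. Put `k = u' = z v + v'`. When the profile equals 1 and `g = V - f` equals 0, the
derivative of `|u|²/2 - Re(k ū)` is `-Re z |u|² - |k|²`. This dissipation survives small
perturbations of the coefficients, uniformly in bounded `z` with `Re z ≥ 0`. It yields a cone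
containing all unstable modes, where they decay at a definite rate and `u` does not vanish. Mere
decay to 0 is first upgraded to fast decay for `Re z > 0` (`ForcedMode.fastDecay`), and the
imaginary axis is reached by continuity in `z`. The difference of two modes normalized by `u(x₀) =
1` solves a forced system with zero first component at `x₀`, so the same cone form shows that it is
small. Gronwall's inequality carries this to any fixed point.

Right end. The limit is singular here: two rates of the adjoint system at `+∞` tend to 0 with `v₊`,
so no spectral gap is uniform. With `(y₁, y₂, m)` the conjugated adjoint coordinates, `m` is slaved
to `y₁ + y₂`. Two combinations close to `y₁ ± ν y₂`, with `ν² (z + c) = v₊` and `c` the value of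
`-f` at `v₊`, diagonalize the frozen system with rates `-z k`. Only the signs of `Re(z k)` are used,
never their size, and the integral of `(V - v₊)/v₊` is bounded once the profile is below `2 v₊`.
Hence beyond the point `X` with `V(X) = 2 v₊` the decaying dual solution has `y₁ = O(v₊^(1/2)
|y₂(X)|)` (`DualCoords.far_bound`). The interval from a fixed large `x₁` to `X` has length
`O(v₊^(-1/4))`, short enough that `y₁` stays small and `y₂` nearly constant on it
(`DualCoords.near_bound`). So after division by `y₂(X)` the dual vector at `x₁` is close to `(0, 1,
bounded)`.

Matching. In the limiting system the third component decays and the second converges to `D⁰`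
(`tendsto_limEvans`). Pairing the normalized modes at `x₁` therefore reads off nearly the second
component of the limiting mode. The point `x₁` is fixed first, according to the tolerance, and `v₊`
is made small afterwards. -/

theorem le_of_hasDerivAt_nonpos {f f' : ℝ → ℝ} {a b : ℝ} (hab : a ≤ b)
    (hf : ∀ x, HasDerivAt f (f' x) x) (hf' : ∀ x ∈ Set.Icc a b, f' x ≤ 0) : f b ≤ f a := by
  have h : AntitoneOn f (Set.Icc a b) :=
    antitoneOn_of_hasDerivWithinAt_nonpos (convex_Icc a b)
      (fun x _ => (hf x).continuousAt.continuousWithinAt)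
      (fun x _ => (hf x).hasDerivWithinAt) (fun x hx => hf' x (interior_subset hx))
  exact h (Set.left_mem_Icc.2 hab) (Set.right_mem_Icc.2 hab) hab

theorem norm_sub_le_of_hasDerivAt {f f' : ℝ → ℂ} {φ φ' : ℝ → ℝ} {a b : ℝ} (hab : a ≤ b)
    (hf : ∀ x, HasDerivAt f (f' x) x) (hφ : ∀ x, HasDerivAt φ (φ' x) x)
    (h : ∀ x ∈ Set.Icc a b, ‖f' x‖ ≤ -φ' x) : ‖f b - f a‖ ≤ φ a - φ b := by
  have := image_norm_le_of_norm_deriv_right_le_deriv_boundary (f := fun x => f x - f a)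
    (f' := f') (a := a) (b := b) (B := fun x => φ a - φ x) (B' := fun x => -φ' x)
    (fun x _ => ((hf x).continuousAt.sub continuousAt_const).continuousWithinAt)
    (fun x _ => ((hf x).sub_const _).hasDerivWithinAt) (by simp)
    (fun x => by simpa using (hφ x).const_sub (φ a))
    (fun x hx => h x (Set.Ico_subset_Icc_self hx))
  exact this (Set.right_mem_Icc.2 hab)

theorem hasDerivAt_exp_mul (c x : ℝ) :
    HasDerivAt (fun y => Real.exp (c * y)) (c * Real.exp (c * x)) x := by
  have h := ((hasDerivAt_id x).const_mul c).exp
  simp only [id, mul_one] at h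
  rwa [mul_comm] at h

/-- The integrating factor `exp (-θ x)`, together with subtraction of the particular solution
produced by the forcing, gives a nonincreasing quantity. The absence of resonance `ω = θ` makes that
particular solution an exponential. -/
theorem exp_weight_le {p p' : ℝ → ℝ} {θ ω r a b : ℝ} (hω : ω ≠ θ) (hab : a ≤ b)
    (hp : ∀ x, HasDerivAt p (p' x) x)
    (h : ∀ x ∈ Set.Icc a b, p' x ≤ θ * p x + r * Real.exp (ω * x)) :
    Real.exp (-θ * b) * p b - r / (ω - θ) * Real.exp ((ω - θ) * b)
      ≤ Real.exp (-θ * a) * p a - r / (ω - θ) * Real.exp ((ω - θ) * a) := by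
  have hd : ω - θ ≠ 0 := sub_ne_zero.2 hω
  refine le_of_hasDerivAt_nonpos
    (f := fun x => Real.exp (-θ * x) * p x - r / (ω - θ) * Real.exp ((ω - θ) * x)) hab
    (fun x => ((hasDerivAt_exp_mul (-θ) x).mul (hp x)).sub
      ((hasDerivAt_exp_mul (ω - θ) x).const_mul _)) ?_
  intro x hx
  have h1 := h x hx
  have h2 : Real.exp ((ω - θ) * x) = Real.exp (-θ * x) * Real.exp (ω * x) := by
    rw [← Real.exp_add]; ring_nf
  have h3 : r / (ω - θ) * ((ω - θ) * Real.exp ((ω - θ) * x))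
      = Real.exp (-θ * x) * (r * Real.exp (ω * x)) := by
    rw [h2]; field_simp
  rw [h3]
  have h4 := mul_le_mul_of_nonneg_left h1 (Real.exp_pos (-θ * x)).le
  linarith

theorem exp_weight_le_of_le {p p' : ℝ → ℝ} {θ a b : ℝ} (hab : a ≤ b)
    (hp : ∀ x, HasDerivAt p (p' x) x) (h : ∀ x ∈ Set.Icc a b, p' x ≤ θ * p x) :
    Real.exp (-θ * b) * p b ≤ Real.exp (-θ * a) * p a := by
  have := exp_weight_le (θ := θ) (r := 0) (ω := θ + 1) (by simp) hab hp (by simpa using h)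
  simpa using this

theorem hasDerivAt_re_mul_conj {a b : ℝ → ℂ} {a' b' : ℂ} {x : ℝ} (ha : HasDerivAt a a' x)
    (hb : HasDerivAt b b' x) :
    HasDerivAt (fun t => (a t * star (b t)).re) ((a' * star (b x) + a x * star b').re) x :=
  Complex.reCLM.hasFDerivAt.comp_hasDerivAt x (ha.mul hb.star)

theorem re_mul_star_self (a : ℂ) : (a * star a).re = ‖a‖ ^ 2 := by
  rw [← Complex.normSq_eq_norm_sq]; simp [Complex.normSq_apply]

theorem abs_re_mul_star_le (a b : ℂ) : |(a * star b).re| ≤ ‖a‖ * ‖b‖ := by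
  calc |(a * star b).re| ≤ ‖a * star b‖ := Complex.abs_re_le_norm _
    _ = ‖a‖ * ‖b‖ := by rw [norm_mul, norm_star]

theorem hasDerivAt_norm_sq {a : ℝ → ℂ} {a' : ℂ} {x : ℝ} (ha : HasDerivAt a a' x) :
    HasDerivAt (fun t => ‖a t‖ ^ 2) (2 * (a' * star (a x)).re) x := by
  have h := hasDerivAt_re_mul_conj ha ha
  simp only [re_mul_star_self] at h
  convert h using 1
  simp [Complex.mul_re]; ring

theorem norm_le_of_norm_deriv_le {E : Type*} [NormedAddCommGroup E] [NormedSpace ℝ E]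
    {f f' : ℝ → E} {K ε a b : ℝ} (hab : a ≤ b) (hf : ∀ x, HasDerivAt f (f' x) x)
    (h : ∀ x ∈ Set.Icc a b, ‖f' x‖ ≤ K * ‖f x‖ + ε) :
    ‖f b‖ ≤ gronwallBound ‖f a‖ K ε (b - a) :=
  norm_le_gronwallBound_of_norm_deriv_right_le
    (fun x _ => (hf x).continuousAt.continuousWithinAt) (fun x _ => (hf x).hasDerivWithinAt)
    le_rfl (fun x hx => h x (Set.Ico_subset_Icc_self hx)) b (Set.right_mem_Icc.2 hab)

theorem norm_le_exp_of_norm_deriv_le {E : Type*} [NormedAddCommGroup E] [NormedSpace ℝ E]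
    {f f' : ℝ → E} {K : ℝ} (hf : ∀ x, HasDerivAt f (f' x) x)
    (h : ∀ x, ‖f' x‖ ≤ K * ‖f x‖) (a b : ℝ) :
    ‖f b‖ ≤ ‖f a‖ * Real.exp (K * |b - a|) := by
  rcases le_total a b with hab | hab
  · have := norm_le_of_norm_deriv_le (K := K) (ε := 0) hab hf (fun x _ => by simpa using h x)
    rwa [gronwallBound_ε0, ← abs_of_nonneg (sub_nonneg.2 hab)] at this
  · have := norm_le_of_norm_deriv_le (f := fun x => f (-x)) (f' := fun x => -f' (-x))
      (K := K) (ε := 0) (neg_le_neg hab)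
      (fun x => by simpa [Function.comp_def] using (hf (-x)).scomp x (hasDerivAt_neg x))
      (fun x _ => by simpa using h (-x))
    rw [gronwallBound_ε0] at this
    rw [abs_of_nonpos (sub_nonpos.2 hab), neg_sub]
    simpa [add_comm, sub_eq_add_neg] using this

theorem eq_zero_of_norm_deriv_le {E : Type*} [NormedAddCommGroup E] [NormedSpace ℝ E]
    {f f' : ℝ → E} {K : ℝ} (hf : ∀ x, HasDerivAt f (f' x) x)
    (h : ∀ x, ‖f' x‖ ≤ K * ‖f x‖) {a : ℝ} (ha : f a = 0) (b : ℝ) : f b = 0 := by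
  have := norm_le_exp_of_norm_deriv_le hf h a b
  rw [ha, norm_zero, zero_mul] at this
  exact norm_le_zero_iff.1 this

/-! ### The coefficient matrix and its adjoint in coordinates. -/

theorem norm_coeffMatrix_mulVec_le {w φ M G : ℝ} {z : ℂ} (hw : |w| ≤ 1) (hφ : |φ| ≤ G)
    (hz : ‖z‖ ≤ M) (y : Fin 3 → ℂ) :
    ‖(coeffMatrix w φ z).mulVec y‖ ≤ (3 * M + G + 1) * ‖y‖ := by
  have hM : 0 ≤ M := (norm_nonneg z).trans hz
  have hG : 0 ≤ G := (abs_nonneg φ).trans hφ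
  have h0 := norm_le_pi_norm y 0
  have h1 := norm_le_pi_norm y 1
  have h2 := norm_le_pi_norm y 2
  have hn := norm_nonneg y
  have hw' : ‖(w : ℂ)‖ ≤ 1 := by simpa using hw
  have hφ' : ‖(φ : ℂ)‖ ≤ G := by simpa using hφ
  have hb : ∀ {p q : ℂ} {P : ℝ}, ‖p‖ ≤ P → ‖q‖ ≤ ‖y‖ → ‖p * q‖ ≤ P * ‖y‖ := by
    intro p q P hp hq
    rw [norm_mul]
    exact mul_le_mul hp hq (norm_nonneg _) ((norm_nonneg _).trans hp)
  have hzw : ‖z * (w : ℂ)‖ ≤ M := by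
    rw [norm_mul]; nlinarith [norm_nonneg z, norm_nonneg (w : ℂ)]
  have hφz : ‖(φ : ℂ) - z‖ ≤ G + M := (norm_sub_le _ _).trans (add_le_add hφ' hz)
  refine (pi_norm_le_iff_of_nonneg (by positivity)).2 fun i => ?_
  have hMn : 0 ≤ M * ‖y‖ := by positivity
  have hGn : 0 ≤ G * ‖y‖ := by positivity
  fin_cases i
  · have : (coeffMatrix w φ z).mulVec y 0 = z * y 1 + y 2 := by
      simp [coeffMatrix, Matrix.mulVec, dotProduct, Fin.sum_univ_three]
    simp only [Fin.zero_eta, this]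
    refine (norm_add_le _ _).trans ?_
    nlinarith [hb hz h1]
  · have : (coeffMatrix w φ z).mulVec y 1 = y 2 := by
      simp [coeffMatrix, Matrix.mulVec, dotProduct, Fin.sum_univ_three]
    simp only [Fin.mk_one, this]
    nlinarith
  · have : (coeffMatrix w φ z).mulVec y 2
        = z * (w : ℂ) * y 0 + z * (w : ℂ) * y 1 + ((φ : ℂ) - z) * y 2 := by
      simp [coeffMatrix, Matrix.mulVec, dotProduct, Fin.sum_univ_three]
    simp only [Fin.reduceFinMk, this]
    refine (norm_add₃_le).trans ?_
    nlinarith [hb hzw h0, hb hzw h1, hb hφz h2]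

theorem Solves.hasDerivAt_coord {V φ : ℝ → ℝ} {z : ℂ} {W : ℝ → Fin 3 → ℂ}
    (h : Solves (fun x => coeffMatrix (V x) (φ x) z) W) (x : ℝ) :
    HasDerivAt (fun t => W t 0) (z * W x 1 + W x 2) x ∧
    HasDerivAt (fun t => W t 1) (W x 2) x ∧
    HasDerivAt (fun t => W t 2)
      (z * V x * W x 0 + z * V x * W x 1 + (φ x - z) * W x 2) x := by
  have h' := hasDerivAt_pi.1 (h x)
  refine ⟨?_, ?_, ?_⟩
  · refine (h' 0).congr_deriv ?_
    simp [coeffMatrix, Matrix.mulVec, dotProduct, Fin.sum_univ_three]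
  · refine (h' 1).congr_deriv ?_
    simp [coeffMatrix, Matrix.mulVec, dotProduct, Fin.sum_univ_three]
  · refine (h' 2).congr_deriv ?_
    simp [coeffMatrix, Matrix.mulVec, dotProduct, Fin.sum_univ_three]

theorem SolvesAdjoint.hasDerivAt_coord {V φ : ℝ → ℝ} {z : ℂ} {W : ℝ → Fin 3 → ℂ}
    (h : SolvesAdjoint (fun x => coeffMatrix (V x) (φ x) z) W) (x : ℝ) :
    HasDerivAt (fun t => star (W t 0)) (-(z * V x * star (W x 2))) x ∧
    HasDerivAt (fun t => star (W t 1)) (-(z * star (W x 0)) - z * V x * star (W x 2)) x ∧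
    HasDerivAt (fun t => star (W t 2))
      (-(star (W x 0) + star (W x 1)) + (z - φ x) * star (W x 2)) x := by
  have h' := hasDerivAt_pi.1 (h x)
  refine ⟨?_, ?_, ?_⟩
  · refine (h' 0).star.congr_deriv ?_
    simp [coeffMatrix, Matrix.mulVec, dotProduct, Fin.sum_univ_three, Matrix.conjTranspose]
  · refine (h' 1).star.congr_deriv ?_
    simp [coeffMatrix, Matrix.mulVec, dotProduct, Fin.sum_univ_three, Matrix.conjTranspose]
    ring
  · refine (h' 2).star.congr_deriv ?_
    simp [coeffMatrix, Matrix.mulVec, dotProduct, Fin.sum_univ_three, Matrix.conjTranspose]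
    ring

/-- The pairing of an adjoint solution with a solution does not depend on `x`. -/
theorem dotProduct_star_const {V φ : ℝ → ℝ} {z : ℂ} {W Y : ℝ → Fin 3 → ℂ}
    (hW : Solves (fun x => coeffMatrix (V x) (φ x) z) W)
    (hY : SolvesAdjoint (fun x => coeffMatrix (V x) (φ x) z) Y) (a b : ℝ) :
    dotProduct (star (Y a)) (W a) = dotProduct (star (Y b)) (W b) := by
  refine is_const_of_deriv_eq_zero (f := fun x => dotProduct (star (Y x)) (W x)) ?_ ?_ a b
  all_goals
    have key : ∀ x, HasDerivAt (fun x => dotProduct (star (Y x)) (W x)) 0 x := by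
      intro x
      obtain ⟨w0, w1, w2⟩ := hW.hasDerivAt_coord x
      obtain ⟨y0, y1, y2⟩ := hY.hasDerivAt_coord x
      have h := ((y0.mul w0).add (y1.mul w1)).add (y2.mul w2)
      simp only [dotProduct, Fin.sum_univ_three, Pi.star_apply]
      refine h.congr_deriv ?_
      ring
  · exact fun x => (key x).differentiableAt
  · exact fun x => (key x).deriv

/-! ### Bernoulli-type inequalities, the constant `a`, and the rate in the profile equation. -/

theorem one_sub_mul_le_rpow {t γ : ℝ} (ht : 0 ≤ t) (hγ : 1 ≤ γ) : 1 - γ * (1 - t) ≤ t ^ γ := by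
  have := one_add_mul_self_le_rpow_one_add (s := t - 1) (by linarith) hγ
  simp only [add_sub_cancel] at this
  linarith

theorem rpow_neg_sub_one_le {t γ : ℝ} (ht : 0 < t) (hγ : 1 ≤ γ) :
    t ^ (-γ) - 1 ≤ γ * t ^ (-γ) * (1 - t) := by
  have h := one_sub_mul_le_rpow ht.le hγ
  have h1 : t ^ (-γ) * t ^ γ = 1 := by rw [← Real.rpow_add ht]; simp
  nlinarith [Real.rpow_pos_of_pos ht (-γ)]

theorem neg_mul_le_rpow_neg_sub_one {t γ : ℝ} (ht : 1 ≤ t) (hγ : 1 ≤ γ) :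
    -(γ * (t - 1)) ≤ t ^ (-γ) - 1 := by
  have h := one_sub_mul_le_rpow (t := t⁻¹) (by positivity) hγ
  rw [Real.rpow_neg (by linarith), ← Real.inv_rpow (by linarith)]
  have h2 : 1 - t⁻¹ ≤ t - 1 := by
    have h3 : t * t⁻¹ = 1 := mul_inv_cancel₀ (by linarith)
    have h4 : t⁻¹ ≤ 1 := inv_le_one_of_one_le₀ ht
    nlinarith
  nlinarith

section rhConst
variable {γ vp : ℝ}

theorem rpow_lt_one_of (hγ : 1 ≤ γ) (h0 : 0 < vp) (h1 : vp < 1) : vp ^ γ < 1 :=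
  Real.rpow_lt_one h0.le h1 (by linarith)

theorem rpow_le_self_of (hγ : 1 ≤ γ) (h0 : 0 < vp) (h1 : vp < 1) : vp ^ γ ≤ vp := by
  simpa using Real.rpow_le_rpow_of_exponent_ge h0 h1.le hγ

theorem rhConst_pos (hγ : 1 ≤ γ) (h0 : 0 < vp) (h1 : vp < 1) : 0 < rhConst γ vp := by
  have := rpow_lt_one_of hγ h0 h1
  have := Real.rpow_pos_of_pos h0 γ
  unfold rhConst
  apply div_pos
  · apply mul_pos <;> linarith
  · linarith

theorem rhConst_le (hγ : 1 ≤ γ) (h0 : 0 < vp) (h1 : vp < 1) : rhConst γ vp ≤ vp := by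
  have h2 := rpow_lt_one_of hγ h0 h1
  have h3 := rpow_le_self_of hγ h0 h1
  have h4 := Real.rpow_pos_of_pos h0 γ
  unfold rhConst
  rw [div_le_iff₀ (by linarith)]
  nlinarith

/-- This is the condition that `v₊` be an equilibrium of the profile equation. -/
theorem rhConst_mul_rpow_neg (hγ : 1 ≤ γ) (h0 : 0 < vp) (h1 : vp < 1) :
    rhConst γ vp * vp ^ (-γ) = 1 - vp + rhConst γ vp := by
  have h2 := rpow_lt_one_of hγ h0 h1
  have h4 := Real.rpow_pos_of_pos h0 γ
  have h5 : 1 - vp ^ γ ≠ 0 := by linarith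
  unfold rhConst
  rw [Real.rpow_neg h0.le]
  field_simp
  ring

/-- `a v^(-γ) ≤ (1 - v₊ + a) v₊ / v` above `v₊`. -/
theorem rhConst_mul_rpow_neg_le (hγ : 1 ≤ γ) (h0 : 0 < vp) (h1 : vp < 1) {v : ℝ} (hv : vp ≤ v) :
    rhConst γ vp * v ^ (-γ) ≤ (1 - vp + rhConst γ vp) * (vp / v) := by
  have hv0 : 0 < v := h0.trans_le hv
  have h2 : v ^ (-γ) = vp ^ (-γ) * (vp / v) ^ γ := by
    rw [Real.div_rpow h0.le hv0.le, Real.rpow_neg h0.le, Real.rpow_neg hv0.le]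
    have := (Real.rpow_pos_of_pos h0 γ).ne'
    field_simp
  -- Since the ratio is at most 1 and `γ ≥ 1`, the power may be replaced by the first power; this
  -- reduces the profile equation to a quadratic one.
  have h3 : (vp / v) ^ γ ≤ vp / v := by
    simpa using Real.rpow_le_rpow_of_exponent_ge (x := vp / v) (by positivity)
      ((div_le_one hv0).2 hv) hγ
  rw [h2, ← mul_assoc, rhConst_mul_rpow_neg hγ h0 h1]
  exact mul_le_mul_of_nonneg_left h3 (by linarith [rhConst_pos hγ h0 h1])

theorem le_rhConst_mul_rpow_neg (hγ : 1 ≤ γ) (h0 : 0 < vp) (h1 : vp < 1) {v : ℝ} (hv0 : 0 < v)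
    (hv : v ≤ vp) :
    (1 - vp + rhConst γ vp) * (vp / v) ≤ rhConst γ vp * v ^ (-γ) := by
  have h2 : v ^ (-γ) = vp ^ (-γ) * (vp / v) ^ γ := by
    rw [Real.div_rpow h0.le hv0.le, Real.rpow_neg h0.le, Real.rpow_neg hv0.le]
    have := (Real.rpow_pos_of_pos h0 γ).ne'
    field_simp
  have h3 : vp / v ≤ (vp / v) ^ γ := by
    simpa using Real.rpow_le_rpow_of_exponent_le (x := vp / v) ((one_le_div hv0).2 hv) hγ
  rw [h2, ← mul_assoc, rhConst_mul_rpow_neg hγ h0 h1]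
  exact mul_le_mul_of_nonneg_left h3 (by linarith [rhConst_pos hγ h0 h1])

end rhConst

/-- The smallness assumption on `v₊` used for the profile estimates. -/
structure SmallEnd (γ vp : ℝ) : Prop where
  one_le : 1 ≤ γ
  pos : 0 < vp
  -- The factor `2 ^ γ` bounds `v ^ (-γ)` for `v ≥ 1/2`, the range of the normalized profile on the
  -- left half-line.
  small : vp * (γ * 2 ^ γ) ≤ 1 / 16

namespace SmallEnd
variable {γ vp : ℝ} (h : SmallEnd γ vp)
include h

theorem le_sixteenth : vp ≤ 1 / 16 := by
  have h1 : (1 : ℝ) ≤ 2 ^ γ := Real.one_le_rpow (by norm_num) (by linarith [h.one_le])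
  have h2 : 1 ≤ γ * 2 ^ γ := by nlinarith [h.one_le]
  nlinarith [h.small, h.pos]

theorem lt_one : vp < 1 := by linarith [h.le_sixteenth]

theorem rhConst_pos : 0 < rhConst γ vp := IsentropicShock.rhConst_pos h.one_le h.pos h.lt_one

theorem rhConst_le : rhConst γ vp ≤ vp := IsentropicShock.rhConst_le h.one_le h.pos h.lt_one

theorem rhConst_mul_le : rhConst γ vp * (γ * 2 ^ γ) ≤ 1 / 16 := by
  have : 0 ≤ γ * 2 ^ γ := mul_nonneg (by linarith [h.one_le]) (by positivity)
  nlinarith [h.small, h.rhConst_le]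

theorem rhConst_mul_gamma_le : rhConst γ vp * γ ≤ 1 / 16 := by
  have h1 : (1 : ℝ) ≤ 2 ^ γ := Real.one_le_rpow (by norm_num) (by linarith [h.one_le])
  have h2 : γ ≤ γ * 2 ^ γ := by nlinarith [h.one_le]
  nlinarith [h.rhConst_mul_le, h.rhConst_pos]

end SmallEnd

/-- The right hand side of the logarithmic profile equation. -/
noncomputable def profileRate (γ vp v : ℝ) : ℝ := v - 1 + rhConst γ vp * (v ^ (-γ) - 1)

section rate
variable {γ vp v : ℝ} (h : SmallEnd γ vp)
include h

theorem profileRate_pos_of_one_lt (hv : 1 < v) : 0 < profileRate γ vp v := by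
  have h1 := neg_mul_le_rpow_neg_sub_one hv.le h.one_le
  have h2 := h.rhConst_mul_gamma_le
  have h3 := h.rhConst_pos
  unfold profileRate
  nlinarith

theorem profileRate_pos_of_lt (hv0 : 0 < v) (hv : v < vp) : 0 < profileRate γ vp v := by
  have h1 := le_rhConst_mul_rpow_neg h.one_le h.pos h.lt_one hv0 hv.le
  have h2 := h.le_sixteenth
  have h3 := h.rhConst_pos
  have h4 : vp / v * v = vp := by field_simp
  have h5 : 1 ≤ vp / v := (one_le_div hv0).2 hv.le
  unfold profileRate
  nlinarith

/-- The comparison of `a v^(-γ)` with a multiple of `1 / v` turns the right-hand side into a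
quadratic vanishing at `v₊` and `1 - v₊`. -/
theorem profileRate_le (hv : vp ≤ v) :
    v * profileRate γ vp v ≤ -((v - vp) * (1 - vp - v)) := by
  have hv0 := h.pos.trans_le hv
  have h1 := rhConst_mul_rpow_neg_le h.one_le h.pos h.lt_one hv
  have h3 := h.rhConst_pos
  have h4 : vp / v * v = vp := by field_simp
  have h5 : v * (rhConst γ vp * v ^ (-γ)) ≤ (1 - vp + rhConst γ vp) * vp := by
    calc v * (rhConst γ vp * v ^ (-γ)) ≤ v * ((1 - vp + rhConst γ vp) * (vp / v)) :=
          mul_le_mul_of_nonneg_left h1 hv0.le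
      _ = (1 - vp + rhConst γ vp) * vp := by field_simp
  unfold profileRate
  nlinarith

theorem rpow_neg_le_two_rpow (hv : 1 / 2 ≤ v) : v ^ (-γ) ≤ 2 ^ γ := by
  have h1 := Real.rpow_le_rpow_of_nonpos (x := 1 / 2) (y := v) (z := -γ) (by norm_num) hv
    (by linarith [h.one_le])
  refine h1.trans (le_of_eq ?_)
  rw [Real.rpow_neg (by norm_num), one_div, Real.inv_rpow (by norm_num), inv_inv]

/-- The pressure term is at most `a γ 2^γ (1 - v)`, a small multiple of `1 - v`, so at least half of
the linear rate at `v = 1` remains. -/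
theorem profileRate_le_of_half_le (hv : 1 / 2 ≤ v) (hv1 : v ≤ 1) :
    profileRate γ vp v ≤ -(1 - v) / 2 := by
  have h1 := rpow_neg_sub_one_le (t := v) (by linarith) h.one_le
  have h2 := rpow_neg_le_two_rpow h hv
  have h3 := h.rhConst_mul_le
  have h4 := h.rhConst_pos
  have h5 := h.one_le
  have h6 : γ * v ^ (-γ) * (1 - v) ≤ γ * 2 ^ γ * (1 - v) := by
    apply mul_le_mul_of_nonneg_right _ (by linarith)
    exact mul_le_mul_of_nonneg_left h2 (by linarith)
  have h7 : rhConst γ vp * (v ^ (-γ) - 1) ≤ rhConst γ vp * (γ * 2 ^ γ * (1 - v)) :=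
    mul_le_mul_of_nonneg_left (h1.trans h6) h4.le
  unfold profileRate
  nlinarith

theorem sub_one_le_profileRate (hv0 : 0 < v) (hv1 : v ≤ 1) : v - 1 ≤ profileRate γ vp v := by
  have h1 : 1 ≤ v ^ (-γ) := Real.one_le_rpow_of_pos_of_le_one_of_nonpos hv0 hv1
    (by linarith [h.one_le])
  have h4 := h.rhConst_pos
  unfold profileRate
  nlinarith

end rate

/-! ### Monotonicity and decay of the shock profile. -/

namespace IsProfile
variable {γ vp : ℝ} {vhat : ℝ → ℝ}

theorem shift (hp : IsProfile γ vp vhat) (ξ : ℝ) : IsProfile γ vp (fun x => vhat (x + ξ)) where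
  pos x := hp.pos _
  ode x := (hp.ode (x + ξ)).comp_add_const x ξ
  tendsto_atBot := hp.tendsto_atBot.comp (tendsto_atBot_add_const_right _ _ tendsto_id)
  tendsto_atTop := hp.tendsto_atTop.comp (tendsto_atTop_add_const_right _ _ tendsto_id)

theorem continuous (hp : IsProfile γ vp vhat) : Continuous vhat :=
  continuous_iff_continuousAt.2 fun x => (hp.ode x).continuousAt

theorem hasDerivAt (hp : IsProfile γ vp vhat) (x : ℝ) :
    HasDerivAt vhat (vhat x * profileRate γ vp (vhat x)) x := hp.ode x

variable (h : SmallEnd γ vp) (hp : IsProfile γ vp vhat)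
include h hp

/-- Above 1 the profile has positive derivative, so it could never come back down to `v₊`. -/
theorem le_one (x : ℝ) : vhat x ≤ 1 := by
  by_contra! hx
  have key : ∀ y ≥ x, vhat x ≤ vhat y := by
    intro y hy
    have := image_le_of_deriv_right_lt_deriv_boundary (f := fun t => -vhat t)
      (f' := fun t => -(vhat t * profileRate γ vp (vhat t))) (a := x) (b := y)
      (hp.continuous.neg.continuousOn) (fun t _ => (hp.hasDerivAt t).neg.hasDerivWithinAt)
      (B := fun _ => -vhat x) (B' := fun _ => 0) le_rfl (fun t => hasDerivAt_const t _)
      (fun t _ ht => by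
        have ht' : vhat t = vhat x := neg_injective ht
        rw [ht']
        have := profileRate_pos_of_one_lt h hx
        have := mul_pos (hp.pos x) this
        linarith)
    exact neg_le_neg_iff.1 (this (Set.right_mem_Icc.2 hy))
  have h1 : vhat x ≤ vp :=
    ge_of_tendsto hp.tendsto_atTop (eventually_atTop.2 ⟨x, key⟩)
  linarith [h.lt_one]

/-- Below `v₊` the derivative is positive, so going left the profile would stay there and could not
tend to 1. -/
theorem vp_le (x : ℝ) : vp ≤ vhat x := by
  by_contra! hx
  have key : ∀ y ≤ x, vhat y ≤ vhat x := by
    intro y hy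
    have := image_le_of_deriv_right_lt_deriv_boundary (f := fun t => vhat (-t))
      (f' := fun t => -(vhat (-t) * profileRate γ vp (vhat (-t)))) (a := -x) (b := -y)
      ((hp.continuous.comp continuous_neg).continuousOn)
      (fun t _ => by
        have := (hp.hasDerivAt (-t)).scomp t (hasDerivAt_neg t)
        simpa [Function.comp_def] using this.hasDerivWithinAt)
      (B := fun _ => vhat x) (B' := fun _ => 0) (by simp) (fun t => hasDerivAt_const t _)
      (fun t _ ht => by
        rw [ht]
        have := profileRate_pos_of_lt h (hp.pos x) hx
        have := mul_pos (hp.pos x) this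
        linarith)
    simpa using this (Set.right_mem_Icc.2 (neg_le_neg hy))
  have h1 : 1 ≤ vhat x :=
    le_of_tendsto hp.tendsto_atBot (eventually_atBot.2 ⟨x, key⟩)
  linarith [h.lt_one]

theorem rate_nonpos (x : ℝ) : profileRate γ vp (vhat x) ≤ 0 := by
  rcases le_total (1 / 2) (vhat x) with h1 | h1
  · have := profileRate_le_of_half_le h h1 (hp.le_one h x)
    linarith [hp.le_one h x]
  · have h2 := profileRate_le h (hp.vp_le h x)
    have h3 := hp.pos x
    have h4 := h.le_sixteenth
    have h5 : 0 ≤ (vhat x - vp) * (1 - vp - vhat x) :=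
      mul_nonneg (by linarith [hp.vp_le h x]) (by linarith)
    nlinarith

theorem antitone : Antitone vhat := fun a b hab =>
  le_of_hasDerivAt_nonpos hab hp.hasDerivAt
    fun x _ => mul_nonpos_of_nonneg_of_nonpos (hp.pos x).le (hp.rate_nonpos h x)

theorem deriv_le {x : ℝ} (hx : vhat x ≤ 1 / 4) :
    vhat x * profileRate γ vp (vhat x) ≤ -(vhat x - vp) / 2 := by
  have h2 := profileRate_le h (hp.vp_le h x)
  have h3 := hp.vp_le h x
  have h4 := h.le_sixteenth
  nlinarith

theorem exists_eq {w : ℝ} (h1 : vp < w) (h2 : w < 1) : ∃ x, vhat x = w := by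
  obtain ⟨x, hx⟩ := (hp.tendsto_atBot.eventually (lt_mem_nhds h2)).exists
  obtain ⟨y, hy⟩ := (hp.tendsto_atTop.eventually (gt_mem_nhds h1)).exists
  have := intermediate_value_univ y x hp.continuous
  exact this ⟨hy.le, hx.le⟩

/-- Length of the region between `x` and the place where the profile is twice its end state. -/
theorem exists_eq_two_mul {x : ℝ} (hx : vhat x ≤ 1 / 4) (hx2 : 2 * vp ≤ vhat x) :
    ∃ X, x ≤ X ∧ vhat X = 2 * vp ∧ X - x ≤ 8 * vp ^ (-(1 / 4) : ℝ) := by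
  have h4 := h.le_sixteenth
  have h0 := h.pos
  obtain ⟨X₀, hX₀⟩ := hp.exists_eq h (w := 2 * vp) (by linarith) (by linarith)
  rcases eq_or_lt_of_le hx2 with heq | hlt
  · exact ⟨x, le_rfl, heq.symm, by rw [sub_self]; positivity⟩
  have hX : x ≤ X₀ := by
    by_contra! hc
    have := hp.antitone h hc.le
    linarith
  refine ⟨X₀, hX, hX₀, ?_⟩
  have h5 := exp_weight_le_of_le (p := fun t => vhat t - vp) (θ := -(1 / 2)) hX
    (fun t => (hp.hasDerivAt t).sub_const vp) (fun t ht => by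
      have := hp.deriv_le h ((hp.antitone h ht.1).trans hx)
      linarith)
  simp only [hX₀] at h5
  have h6 : Real.exp (1 / 2 * (X₀ - x)) * vp ≤ 1 := by
    have : Real.exp (1 / 2 * (X₀ - x)) = Real.exp (- -(1 / 2) * X₀) / Real.exp (- -(1 / 2) * x) := by
      rw [← Real.exp_sub]; ring_nf
    rw [this, div_mul_eq_mul_div, div_le_one (Real.exp_pos _)]
    have := Real.exp_pos (- -(1 / 2) * x)
    nlinarith
  -- The true length is logarithmic in `1 / v₊`. A fourth root trades the logarithm for the cruder
  -- `v₊^(-1/4)`, which suffices because it is still `o(v₊^(-1/2))`.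
  have h7 : Real.exp (1 / 8 * (X₀ - x)) ≤ vp ^ (-(1 / 4) : ℝ) := by
    have h8 : Real.exp (1 / 2 * (X₀ - x)) ≤ vp⁻¹ := by
      rw [← one_div, le_div_iff₀ h0]; exact h6
    have h9 := Real.rpow_le_rpow (Real.exp_pos _).le h8 (show (0 : ℝ) ≤ 1 / 4 by norm_num)
    rw [← Real.exp_mul, Real.inv_rpow h0.le, ← Real.rpow_neg h0.le] at h9
    convert h9 using 2
    ring
  have h10 := Real.add_one_le_exp (1 / 8 * (X₀ - x))
  linarith

/-- Going left, `1 - v` decays at most exponentially. Strictness makes the log-odds of the profile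
well defined. -/
theorem one_sub_pos (h0 : vhat 0 = 1 / 2) (x : ℝ) : 0 < 1 - vhat x := by
  rcases le_total 0 x with hx | hx
  · linarith [hp.antitone h hx]
  have h5 := exp_weight_le_of_le (p := fun t => 1 - vhat t) (θ := 1) hx
    (fun t => (hp.hasDerivAt t).const_sub 1) (fun t _ => by
      have h1 := sub_one_le_profileRate h (hp.pos t) (hp.le_one h t)
      have h2 := hp.pos t
      have h3 := hp.le_one h t
      nlinarith)
  simp only [h0] at h5
  norm_num at h5
  have := Real.exp_pos (-x)
  nlinarith

theorem half_le (h0 : vhat 0 = 1 / 2) {x : ℝ} (hx : x ≤ 0) : 1 / 2 ≤ vhat x :=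
  h0 ▸ hp.antitone h hx

theorem one_sub_le (h0 : vhat 0 = 1 / 2) {x : ℝ} (hx : x ≤ 0) :
    1 - vhat x ≤ 1 / 2 * Real.exp (x / 4) := by
  have h5 := exp_weight_le_of_le (p := fun t => -(1 - vhat t)) (θ := 1 / 4) hx
    (fun t => ((hp.hasDerivAt t).const_sub 1).neg) (fun t ht => by
      have h1 := profileRate_le_of_half_le h (hp.half_le h h0 ht.2) (hp.le_one h t)
      have h2 := hp.half_le h h0 ht.2
      have h3 := hp.le_one h t
      nlinarith)
  simp only [h0] at h5
  have h6 : Real.exp (-(1 / 4 * x)) * Real.exp (x / 4) = 1 := by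
    rw [← Real.exp_add]; ring_nf; simp
  have h7 := Real.exp_pos (x / 4)
  norm_num at h5
  nlinarith

theorem half_exp_neg_le (h0 : vhat 0 = 1 / 2) {x : ℝ} (hx : 0 ≤ x) :
    1 / 2 * Real.exp (-x) ≤ vhat x := by
  have h5 := exp_weight_le_of_le (p := fun t => -vhat t) (θ := -1) hx
    (fun t => (hp.hasDerivAt t).neg) (fun t _ => by
      have h1 := sub_one_le_profileRate h (hp.pos t) (hp.le_one h t)
      have h2 := hp.pos t
      nlinarith)
  simp only [h0] at h5
  norm_num at h5
  have h6 : Real.exp (-x) * Real.exp x = 1 := by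
    rw [← Real.exp_add]; ring_nf; simp
  have h7 := Real.exp_pos (-x)
  nlinarith

theorem half_exp_neg_le_of_le (h0 : vhat 0 = 1 / 2) {x R : ℝ} (hR : 0 ≤ R) (hx : x ≤ R) :
    1 / 2 * Real.exp (-R) ≤ vhat x :=
  (hp.half_exp_neg_le h h0 hR).trans (hp.antitone h hx)

theorem rpow_neg_le (h0 : vhat 0 = 1 / 2) {x R : ℝ} (hR : 0 ≤ R) (hx : x ≤ R) :
    vhat x ^ (-γ) ≤ (2 * Real.exp R) ^ γ := by
  have h1 := Real.rpow_le_rpow_of_nonpos (z := -γ) (by positivity)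
    (hp.half_exp_neg_le_of_le h h0 hR hx) (by linarith [h.one_le])
  refine h1.trans (le_of_eq ?_)
  rw [Real.rpow_neg (by positivity), ← Real.inv_rpow (by positivity)]
  congr 1
  rw [Real.exp_neg]
  field_simp

end IsProfile

/-! ### Convergence to the logistic limiting profile. -/

theorem limProfile_eq (x : ℝ) : limProfile x = 1 / (1 + Real.exp x) := by
  unfold limProfile
  rw [Real.tanh_eq_sinh_div_cosh, Real.sinh_eq, Real.cosh_eq]
  have h1 : Real.exp x = Real.exp (x / 2) * Real.exp (x / 2) := by
    rw [← Real.exp_add]; ring_nf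
  have h2 : Real.exp (x / 2) * Real.exp (-(x / 2)) = 1 := by
    rw [← Real.exp_add]; ring_nf; simp
  have h3 := Real.exp_pos (x / 2)
  have h4 := Real.exp_pos (-(x / 2))
  rw [h1]
  field_simp
  nlinarith

theorem logistic_lipschitz (x y : ℝ) :
    |1 / (1 + Real.exp x) - 1 / (1 + Real.exp y)| ≤ |x - y| := by
  have key : ∀ a b : ℝ, a ≤ b →
      |1 / (1 + Real.exp a) - 1 / (1 + Real.exp b)| ≤ |a - b| := by
    intro a b hab
    have ha := Real.exp_pos a
    have hb := Real.exp_pos b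
    have he : Real.exp a ≤ Real.exp b := Real.exp_le_exp.2 hab
    have h1 : 1 / (1 + Real.exp b) ≤ 1 / (1 + Real.exp a) :=
      one_div_le_one_div_of_le (by positivity) (by linarith)
    rw [abs_of_nonneg (by linarith), abs_of_nonpos (by linarith)]
    have h2 : 1 / (1 + Real.exp a) - 1 / (1 + Real.exp b)
        = (Real.exp b - Real.exp a) / ((1 + Real.exp a) * (1 + Real.exp b)) := by
      field_simp; ring
    rw [h2, div_le_iff₀ (by positivity)]
    have h3 := Real.add_one_le_exp (a - b)
    have h4 : Real.exp (a - b) * Real.exp b = Real.exp a := by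
      rw [← Real.exp_add]; ring_nf
    have h5 : 0 ≤ (b - a) := by linarith
    nlinarith [mul_nonneg h5 ha.le, mul_nonneg h5 hb.le, mul_nonneg h5 (mul_nonneg ha.le hb.le)]
  rcases le_total x y with h | h
  · exact key x y h
  · rw [abs_sub_comm, abs_sub_comm x y]; exact key y x h

/-- Closeness of a normalized profile to the limiting one. -/
theorem IsProfile.abs_sub_limProfile_le {γ vp : ℝ} {vhat : ℝ → ℝ} (h : SmallEnd γ vp)
    (hp : IsProfile γ vp vhat) (h0 : vhat 0 = 1 / 2) {x R : ℝ} (hR : 0 ≤ R) (hx : x ≤ R) :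
    |vhat x - limProfile x| ≤ vp * (γ * (2 * Real.exp R) ^ γ) * |x| := by
  -- Log-odds straighten the limiting profile to the identity: `ψ' - 1` is exactly the pressure term
  -- divided by `1 - v`, with sign reversed. That quotient is `O(v₊)` on `(-∞, R]` by Bernoulli,
  -- even where `1 - v` tends to 0.
  set ψ : ℝ → ℝ := fun t => Real.log ((1 - vhat t) / vhat t) with hψ
  have hv : ∀ t, vhat t = 1 / (1 + Real.exp (ψ t)) := by
    intro t
    have h1 := hp.pos t
    have h2 := hp.one_sub_pos h h0 t
    rw [hψ]; simp only
    rw [Real.exp_log (by positivity)]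
    field_simp
    ring
  have hd : ∀ t, HasDerivAt ψ (-profileRate γ vp (vhat t) / (1 - vhat t)) t := by
    intro t
    have h1 := hp.pos t
    have h2 := hp.one_sub_pos h h0 t
    have h3 := (((hp.hasDerivAt t).const_sub 1).div (hp.hasDerivAt t) h1.ne').log
      (div_pos h2 h1).ne'
    refine h3.congr_deriv ?_
    simp only [Pi.div_apply]
    field_simp
    ring
  set C := vp * (γ * (2 * Real.exp R) ^ γ) with hC
  have hbound : ∀ t ≤ R, |-profileRate γ vp (vhat t) / (1 - vhat t) - 1| ≤ C := by
    intro t ht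
    have h1 := hp.pos t
    have h2 := hp.one_sub_pos h h0 t
    have h3 := rpow_neg_sub_one_le h1 h.one_le
    have h4 := hp.rpow_neg_le h h0 hR ht
    have h5 : 1 ≤ vhat t ^ (-γ) := Real.one_le_rpow_of_pos_of_le_one_of_nonpos h1
      (hp.le_one h t) (by linarith [h.one_le])
    have h6 : -profileRate γ vp (vhat t) / (1 - vhat t) - 1
        = -(rhConst γ vp * (vhat t ^ (-γ) - 1) / (1 - vhat t)) := by
      unfold profileRate; field_simp; ring
    have h7 := h.rhConst_pos
    have h8 := h.rhConst_le
    have h9 := h.one_le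
    have h10 : 0 ≤ vhat t ^ (-γ) - 1 := by linarith
    rw [h6, abs_neg, abs_of_nonneg (by positivity), div_le_iff₀ h2]
    have h11 : γ * vhat t ^ (-γ) * (1 - vhat t) ≤ γ * (2 * Real.exp R) ^ γ * (1 - vhat t) := by
      apply mul_le_mul_of_nonneg_right _ h2.le
      exact mul_le_mul_of_nonneg_left h4 (by linarith)
    calc rhConst γ vp * (vhat t ^ (-γ) - 1) ≤ vp * (vhat t ^ (-γ) - 1) :=
          mul_le_mul_of_nonneg_right h8 h10
      _ ≤ vp * (γ * (2 * Real.exp R) ^ γ * (1 - vhat t)) :=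
          mul_le_mul_of_nonneg_left (h3.trans h11) h.pos.le
      _ = C * (1 - vhat t) := by rw [hC]; ring
  have hψ0 : ψ 0 = 0 := by simp only [hψ, h0]; norm_num
  have hmain : |ψ x - x| ≤ C * |x| := by
    have := Convex.norm_image_sub_le_of_norm_hasDerivWithin_le (f := fun t => ψ t - t)
      (f' := fun t => -profileRate γ vp (vhat t) / (1 - vhat t) - 1) (s := Set.Iic R) (C := C)
      (x := 0) (y := x)
      (fun t _ => ((hd t).sub (hasDerivAt_id t)).hasDerivWithinAt)
      (fun t ht => hbound t ht) (convex_Iic R) hR hx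
    simpa [hψ0] using this
  rw [hv x, limProfile_eq]
  exact (logistic_lipschitz _ _).trans hmain

/-! ### The coefficient `g = V - f` and elementary facts on the limiting profile. -/

/-- The difference between the profile value and the coefficient `f`. -/
noncomputable def gCoeff (γ vp w : ℝ) : ℝ := w - fCoeff γ vp w

theorem gCoeff_eq (γ vp w : ℝ) :
    gCoeff γ vp w = 1 - w + rhConst γ vp + rhConst γ vp * (γ - 1) * w ^ (-γ) := by
  unfold gCoeff fCoeff; ring

section gCoeff
variable {γ vp w : ℝ} (h : SmallEnd γ vp)
include h

theorem rhConst_mul_rpow_neg_le_one (hw : vp ≤ w) : rhConst γ vp * w ^ (-γ) ≤ 1 := by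
  have h1 := rhConst_mul_rpow_neg_le h.one_le h.pos h.lt_one hw
  have h2 : vp / w ≤ 1 := (div_le_one (h.pos.trans_le hw)).2 hw
  have h3 : 0 ≤ vp / w := div_nonneg h.pos.le (h.pos.le.trans hw)
  have h4 := h.rhConst_le
  have h5 := h.rhConst_pos
  have h6 := h.le_sixteenth
  nlinarith

theorem gCoeff_sub_mem (hw : vp ≤ w) :
    0 ≤ gCoeff γ vp w - (1 - w) ∧ gCoeff γ vp w - (1 - w) ≤ γ := by
  have h1 := rhConst_mul_rpow_neg_le_one h hw
  have h2 := h.rhConst_pos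
  have h3 := h.one_le
  have h4 := h.rhConst_le
  have h5 := h.lt_one
  have h6 : 0 ≤ rhConst γ vp * w ^ (-γ) :=
    mul_nonneg h2.le (Real.rpow_nonneg (h.pos.le.trans hw) _)
  rw [gCoeff_eq]
  constructor <;> nlinarith

theorem gCoeff_sub_le_of_rpow_le {B : ℝ} (hB1 : 1 ≤ B) (hB : w ^ (-γ) ≤ B) :
    gCoeff γ vp w - (1 - w) ≤ vp * (γ * B) := by
  have h2 := h.rhConst_pos
  have h3 := h.one_le
  have h4 := h.rhConst_le
  have h7 : rhConst γ vp * (γ - 1) * w ^ (-γ) ≤ rhConst γ vp * (γ - 1) * B :=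
    mul_le_mul_of_nonneg_left hB (mul_nonneg h2.le (by linarith))
  have h8 : rhConst γ vp * (γ * B) ≤ vp * (γ * B) :=
    mul_le_mul_of_nonneg_right h4 (by nlinarith)
  rw [gCoeff_eq]
  nlinarith

/-- The power `w^(-γ)` varies on the scale `v₊`, so `(w - v₊) / v₊` is the natural unit. Along the
profile this unit has bounded integral beyond the point where the profile equals `2 v₊`. -/
theorem abs_gCoeff_sub_sub_le (hw : vp ≤ w) :
    |(gCoeff γ vp w - w) - (gCoeff γ vp vp - vp)| ≤ (γ ^ 2 + 2) * ((w - vp) / vp) := by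
  have h0 := h.pos
  have hw0 : 0 < w := h0.trans_le hw
  have h1 := rhConst_mul_rpow_neg_le_one h (le_refl vp)
  have h2 := h.rhConst_pos
  have h3 := h.one_le
  have h5 : w ^ (-γ) = vp ^ (-γ) * (vp / w) ^ γ := by
    rw [Real.div_rpow h0.le hw0.le, Real.rpow_neg h0.le, Real.rpow_neg hw0.le]
    have := (Real.rpow_pos_of_pos h0 γ).ne'
    field_simp
  have h6 : vp / w ≤ 1 := (div_le_one hw0).2 hw
  have h7 := one_sub_mul_le_rpow (t := vp / w) (by positivity) h3
  have h8 : (vp / w) ^ γ ≤ 1 := Real.rpow_le_one (by positivity) h6 (by linarith)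
  have h9 : 1 - vp / w ≤ (w - vp) / vp := by
    rw [le_div_iff₀ h0, one_sub_div hw0.ne', div_mul_eq_mul_div, div_le_iff₀ hw0]
    nlinarith
  have h10 : w - vp ≤ (w - vp) / vp := by
    rw [le_div_iff₀ h0]; nlinarith [h.lt_one]
  have hA : 0 ≤ rhConst γ vp * vp ^ (-γ) := by positivity
  have e : (gCoeff γ vp w - w) - (gCoeff γ vp vp - vp)
      = -(2 * (w - vp) + (γ - 1) * (rhConst γ vp * vp ^ (-γ)) * (1 - (vp / w) ^ γ)) := by
    rw [gCoeff_eq, gCoeff_eq, h5]; ring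
  have h11 : 0 ≤ (w - vp) / vp := div_nonneg (by linarith) h0.le
  have h12 : (rhConst γ vp * vp ^ (-γ)) * (1 - (vp / w) ^ γ) ≤ γ * ((w - vp) / vp) := by
    calc (rhConst γ vp * vp ^ (-γ)) * (1 - (vp / w) ^ γ) ≤ 1 * (1 - (vp / w) ^ γ) :=
          mul_le_mul_of_nonneg_right h1 (by linarith)
      _ ≤ γ * ((w - vp) / vp) := by nlinarith
  have h13 : 0 ≤ (rhConst γ vp * vp ^ (-γ)) * (1 - (vp / w) ^ γ) :=
    mul_nonneg hA (by linarith)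
  rw [e, abs_neg, abs_of_nonneg (by nlinarith)]
  nlinarith [mul_nonneg (by linarith : (0 : ℝ) ≤ γ) h11]

end gCoeff

theorem matA_eq (γ vp : ℝ) (vhat : ℝ → ℝ) (x : ℝ) (z : ℂ) :
    matA γ vp vhat x z = coeffMatrix (vhat x) (vhat x - gCoeff γ vp (vhat x)) z := by
  simp [matA, gCoeff]

theorem matA0_eq (x : ℝ) (z : ℂ) :
    matA0 x z = coeffMatrix (limProfile x) (limProfile x - (1 - limProfile x)) z := by
  unfold matA0; ring_nf

theorem tendsto_gCoeff_one {γ vp : ℝ} :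
    Tendsto (gCoeff γ vp) (𝓝 1) (𝓝 (rhConst γ vp * γ)) := by
  have h : ContinuousAt (fun w : ℝ =>
      1 - w + rhConst γ vp + rhConst γ vp * (γ - 1) * w ^ (-γ)) 1 := by
    have : ContinuousAt (fun w : ℝ => w ^ (-γ)) 1 :=
      Real.continuousAt_rpow_const _ _ (Or.inl one_ne_zero)
    fun_prop
  have h2 := h.tendsto
  simp only [Real.one_rpow] at h2
  have e : gCoeff γ vp = fun w : ℝ =>
      1 - w + rhConst γ vp + rhConst γ vp * (γ - 1) * w ^ (-γ) := funext (gCoeff_eq γ vp)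
  rw [e]
  convert h2 using 2
  ring

theorem limProfile_pos (x : ℝ) : 0 < limProfile x := by
  rw [limProfile_eq]; positivity

theorem limProfile_lt_one (x : ℝ) : limProfile x < 1 := by
  rw [limProfile_eq, div_lt_one (by positivity)]; linarith [Real.exp_pos x]

theorem limProfile_le_exp (x : ℝ) : limProfile x ≤ Real.exp (-x) := by
  rw [limProfile_eq, Real.exp_neg, ← one_div]
  exact one_div_le_one_div_of_le (Real.exp_pos x) (by linarith)

theorem one_sub_limProfile_le_exp (x : ℝ) : 1 - limProfile x ≤ Real.exp x := by
  rw [limProfile_eq]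
  have h := Real.exp_pos x
  have : 1 - 1 / (1 + Real.exp x) = Real.exp x / (1 + Real.exp x) := by field_simp; ring
  rw [this]
  exact div_le_self h.le (by linarith)

theorem hasDerivAt_limProfile (x : ℝ) :
    HasDerivAt limProfile (limProfile x * (limProfile x - 1)) x := by
  have e : limProfile = fun x => (1 + Real.exp x)⁻¹ := by
    funext y; rw [limProfile_eq, one_div]
  have hx : (1 + Real.exp x) ≠ 0 := by positivity
  rw [e]
  refine (((Real.hasDerivAt_exp x).const_add 1).inv hx).congr_deriv ?_
  field_simp
  ring

theorem tendsto_limProfile_atBot : Tendsto limProfile atBot (𝓝 1) := by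
  have h : Tendsto (fun x => 1 - Real.exp x) atBot (𝓝 1) := by
    simpa using Real.tendsto_exp_atBot.const_sub 1
  exact tendsto_of_tendsto_of_tendsto_of_le_of_le h tendsto_const_nhds
    (fun x => by linarith [one_sub_limProfile_le_exp x]) (fun x => (limProfile_lt_one x).le)

/-! ### An invariant cone at `-∞`. -/

/-- The eigenvalue system in the variables `u`, `v`, `k = u'`, with a forcing term `E`. -/
structure ForcedMode (V g : ℝ → ℝ) (z : ℂ) (E u v k : ℝ → ℂ) : Prop where
  u_deriv : ∀ x, HasDerivAt u (k x) x
  v_deriv : ∀ x, HasDerivAt v (k x - z * v x) x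
  k_deriv : ∀ x, HasDerivAt k
    (V x * (z * u x + k x) - g x * (k x - z * v x) + E x) x

theorem Solves.forcedMode {V g : ℝ → ℝ} {z : ℂ} {W : ℝ → Fin 3 → ℂ}
    (h : Solves (fun x => coeffMatrix (V x) (V x - g x) z) W) :
    ForcedMode V g z (fun _ => 0) (fun x => W x 0) (fun x => W x 1)
      (fun x => z * W x 1 + W x 2) where
  u_deriv x := (h.hasDerivAt_coord (φ := fun x => V x - g x) x).1
  v_deriv x := (h.hasDerivAt_coord (φ := fun x => V x - g x) x).2.1.congr_deriv (by ring)
  k_deriv x := by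
    obtain ⟨_, h1, h2⟩ := h.hasDerivAt_coord (φ := fun x => V x - g x) x
    refine ((h1.const_mul z).add h2).congr_deriv ?_
    push_cast
    ring

/-- The quadratic form whose nonpositivity set is an invariant cone around the unstable
direction at `-∞`. -/
noncomputable def coneForm (κ : ℝ) (u v k : ℂ) : ℝ :=
  (1 / 2 + κ) * ‖u‖ ^ 2 - (k * star u).re + κ * ‖k‖ ^ 2 + ‖v‖ ^ 2 / 32

/-- The derivative of `coneForm` in terms of the derivatives of its arguments. -/
noncomputable def coneFormDeriv (κ : ℝ) (u v k u' v' k' : ℂ) : ℝ :=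
  (1 / 2 + κ) * (2 * (u' * star u).re) - (k' * star u + k * star u').re
    + κ * (2 * (k' * star k).re) + 2 * (v' * star v).re / 32

theorem hasDerivAt_coneForm {κ : ℝ} {u v k : ℝ → ℂ} {u' v' k' : ℂ} {x : ℝ}
    (hu : HasDerivAt u u' x) (hv : HasDerivAt v v' x) (hk : HasDerivAt k k' x) :
    HasDerivAt (fun t => coneForm κ (u t) (v t) (k t))
      (coneFormDeriv κ (u x) (v x) (k x) u' v' k') x :=
  ((((hasDerivAt_norm_sq hu).const_mul _).sub (hasDerivAt_re_mul_conj hk hu)).add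
    ((hasDerivAt_norm_sq hk).const_mul _)).add ((hasDerivAt_norm_sq hv).div_const _)

/-- The core `θ a b - b² - θ a² / 2` is negative definite because `θ² < 2 θ`; the remaining terms
fit into the slack. The two values of `θ` serve invariance of the cone and decay inside it. -/
theorem cone_quadratic_bound {a b d e θ : ℝ} (ha : 0 ≤ a) (hb : 0 ≤ b) (hd : 0 ≤ d) (he : 0 ≤ e)
    (hθ : θ = 1 ∨ θ = 5 / 4) :
    θ * (a * b) - b ^ 2 - θ / 2 * a ^ 2 - θ * d ^ 2 / 32 + b * d / 16
      + 1 / 200 * (6 * (a * b) + a * d + 4 * b ^ 2 + 2 * (b * d)) + e * (a + 2 * b)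
      ≤ -(1 / 400) * (a ^ 2 + b ^ 2 + d ^ 2) + 200 * e ^ 2 := by
  have h1 : e * (a + 2 * b) ≤ 1 / 200 * (a ^ 2 + 4 * b ^ 2) + 200 * e ^ 2 := by
    nlinarith [sq_nonneg (e * 10 - a / 20), sq_nonneg (e * 10 - b / 10)]
  rcases hθ with rfl | rfl
  · nlinarith [sq_nonneg (b - 5 / 8 * a), sq_nonneg (d - 2 * b), sq_nonneg (a - d),
      sq_nonneg (b - d), sq_nonneg (a - b)]
  · nlinarith [sq_nonneg (b - 3 / 4 * a), sq_nonneg (d - 2 * b), sq_nonneg (a - d),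
      sq_nonneg (b - d), sq_nonneg (a - b)]

theorem norm_forced_deriv_le {V g M τ : ℝ} {z u v k E : ℂ} (hM : ‖z‖ ≤ M)
    (hV1 : V ≤ 1) (hV0 : 0 ≤ V) (hg : |g| ≤ τ) :
    ‖V * (z * u + k) - g * (k - z * v) + E‖
      ≤ (M * ‖u‖ + ‖k‖) + τ * (‖k‖ + M * ‖v‖) + ‖E‖ := by
  have hM0 : 0 ≤ M := (norm_nonneg z).trans hM
  have hτ0 : 0 ≤ τ := (abs_nonneg g).trans hg
  have h1 : ‖(V : ℂ) * (z * u + k)‖ ≤ M * ‖u‖ + ‖k‖ := by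
    rw [norm_mul, Complex.norm_real, Real.norm_of_nonneg hV0]
    have h2 : ‖z * u + k‖ ≤ M * ‖u‖ + ‖k‖ := by
      refine (norm_add_le _ _).trans ?_
      rw [norm_mul]; gcongr
    exact (mul_le_of_le_one_left (norm_nonneg _) hV1).trans h2
  have h2 : ‖(g : ℂ) * (k - z * v)‖ ≤ τ * (‖k‖ + M * ‖v‖) := by
    rw [norm_mul, Complex.norm_real, Real.norm_eq_abs]
    have : ‖k - z * v‖ ≤ ‖k‖ + M * ‖v‖ := by
      refine (norm_sub_le _ _).trans ?_
      rw [norm_mul]; gcongr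
    gcongr
  refine (norm_add_le _ _).trans ?_
  exact add_le_add ((norm_sub_le _ _).trans (add_le_add h1 h2)) le_rfl

/-- At `V = 1`, `g = 0`, `E = 0` the part `|u|²/2 - Re(k ū)` has derivative `-Re z |u|² - |k|²`.
Everything else is a perturbation controlled by `κ`, `τ` and the weight `1/32`. No lower bound on
`Re z` beyond 0 enters, which makes the estimate uniform up to the imaginary axis. -/
theorem coneFormDeriv_le {V g κ M τ θ : ℝ} {z u v k E : ℂ} (hz : 0 ≤ z.re) (hM : ‖z‖ ≤ M)
    (hκ : 0 ≤ κ) (hκM : κ * (1 + M) ≤ 1 / 200) (hV1 : V ≤ 1) (hV0 : 0 ≤ V) (hV : 1 - V ≤ τ)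
    (hg : |g| ≤ τ) (hτM : τ * (1 + M) ≤ 1 / 200) (hθ : θ = 1 ∨ θ = 5 / 4) :
    coneFormDeriv κ u v k k (k - z * v) (V * (z * u + k) - g * (k - z * v) + E)
      ≤ θ * coneForm κ u v k - 1 / 400 * (‖u‖ ^ 2 + ‖k‖ ^ 2 + ‖v‖ ^ 2) + 200 * ‖E‖ ^ 2 := by
  have hM0 : 0 ≤ M := (norm_nonneg z).trans hM
  have hτ0 : 0 ≤ τ := (abs_nonneg g).trans hg
  set k' : ℂ := V * (z * u + k) - g * (k - z * v) + E with hk'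
  set a := ‖u‖ with ha
  set b := ‖k‖ with hb
  set d := ‖v‖ with hd
  set e := ‖E‖ with he
  have ha0 : 0 ≤ a := norm_nonneg _
  have hb0 : 0 ≤ b := norm_nonneg _
  have hd0 : 0 ≤ d := norm_nonneg _
  have he0 : 0 ≤ e := norm_nonneg _
  set R := (k * star u).re with hR
  have hRab : |R| ≤ b * a := abs_re_mul_star_le k u
  set S := (z * v * star u).re with hS
  have hSb : |S| ≤ M * d * a := by
    refine (abs_re_mul_star_le (z * v) u).trans ?_
    rw [norm_mul]
    gcongr
  set T := (k * star v).re with hT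
  have hTb : |T| ≤ b * d := abs_re_mul_star_le k v
  set X := (E * star u).re with hX
  have hXb : |X| ≤ e * a := abs_re_mul_star_le E u
  have e1 : (k' * star u).re = V * (z.re * a ^ 2 + R) - g * (R - S) + X := by
    rw [ha, ← re_mul_star_self, hR, hS, hX, hk']
    simp [Complex.mul_re, Complex.mul_im]
    ring
  have e2 : ((k - z * v) * star v).re = T - z.re * d ^ 2 := by
    rw [hd, ← re_mul_star_self, hT]
    simp [Complex.mul_re, Complex.mul_im]
    ring
  have e3 : (k * star k).re = b ^ 2 := re_mul_star_self k
  have hk'n : ‖k'‖ ≤ (M * a + b) + τ * (b + M * d) + e := norm_forced_deriv_le hM hV1 hV0 hg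
  have hκ' := hκM
  have hτ' := hτM
  rw [mul_add, mul_one] at hκ' hτ'
  have hκM0 : 0 ≤ κ * M := mul_nonneg hκ hM0
  have hτM0 : 0 ≤ τ * M := mul_nonneg hτ0 hM0
  have hκ1 : κ ≤ 1 / 200 := by linarith
  have hκM' : κ * M ≤ 1 / 200 := by linarith
  have hτ1 : τ ≤ 1 / 200 := by linarith
  have hτM' : τ * M ≤ 1 / 200 := by linarith
  have heb := mul_nonneg he0 hb0
  have hbd := mul_nonneg hb0 hd0
  have hbb := sq_nonneg b
  have e4 : κ * (2 * (k' * star k).re)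
      ≤ 1 / 200 * (2 * (a * b) + 4 * b ^ 2 + 2 * (b * d)) + e * b := by
    have h1 : (k' * star k).re ≤ ((M * a + b) + τ * (b + M * d) + e) * b :=
      ((le_abs_self _).trans (abs_re_mul_star_le k' k)).trans (by gcongr)
    have h2 : κ * (2 * (k' * star k).re) ≤ κ * (2 * (((M * a + b) + τ * (b + M * d) + e) * b)) := by
      gcongr
    refine h2.trans ?_
    have t1 : κ * M * (a * b) ≤ 1 / 200 * (a * b) := by gcongr
    have t2 : κ * b ^ 2 ≤ 1 / 200 * b ^ 2 := by gcongr
    have t3 : κ * (τ * b ^ 2) ≤ 1 / 200 * (1 * b ^ 2) := by gcongr; linarith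
    have t4 : κ * (τ * M * (b * d)) ≤ 1 / 200 * (1 * (b * d)) := by gcongr; linarith
    have t5 : κ * (e * b) ≤ 1 / 200 * (e * b) := by gcongr
    have : κ * (2 * (((M * a + b) + τ * (b + M * d) + e) * b))
      = 2 * (κ * M * (a * b)) + 2 * (κ * b ^ 2) + 2 * (κ * (τ * b ^ 2))
        + 2 * (κ * (τ * M * (b * d))) + 2 * (κ * (e * b)) := by ring
    rw [this]
    linarith
  have hq := cone_quadratic_bound ha0 hb0 hd0 he0 hθ
  have hθ0 : 0 ≤ θ := by rcases hθ with rfl | rfl <;> norm_num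
  unfold coneFormDeriv coneForm
  rw [Complex.add_re, e1, e2, e3]
  have f1 : (θ + 2 * κ + (1 - V) + g) * R ≤ θ * (a * b) + 4 / 200 * (a * b) := by
    have hg1 := abs_le.1 hg
    have h1 : |θ + 2 * κ + (1 - V) + g| ≤ θ + 4 / 200 := by
      have hθ1 : 1 ≤ θ := by rcases hθ with rfl | rfl <;> norm_num
      rw [abs_le]; constructor <;> linarith
    calc (θ + 2 * κ + (1 - V) + g) * R ≤ |θ + 2 * κ + (1 - V) + g| * |R| := by
          rw [← abs_mul]; exact le_abs_self _
      _ ≤ (θ + 4 / 200) * (b * a) := by gcongr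
      _ = _ := by ring
  have f2 : -(g * S) ≤ 1 / 200 * (a * d) := by
    calc -(g * S) ≤ |g| * |S| := by rw [← abs_mul]; exact neg_le_abs _
      _ ≤ τ * (M * d * a) := by gcongr
      _ = τ * M * (a * d) := by ring
      _ ≤ 1 / 200 * (a * d) := by gcongr
  have f3 : -X ≤ e * a := (neg_le_abs _).trans hXb
  have f4 : T ≤ b * d := (le_abs_self _).trans hTb
  have f5 : 0 ≤ V * (z.re * a ^ 2) := by positivity
  have f6 : 0 ≤ z.re * d ^ 2 := by positivity
  have f7 : 0 ≤ θ * κ * a ^ 2 := by positivity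
  have f8 : 0 ≤ θ * κ * b ^ 2 := by positivity
  have : (1 / 2 + κ) * (2 * R) - (V * (z.re * a ^ 2 + R) - g * (R - S) + X + b ^ 2)
        + κ * (2 * (k' * star k).re) + 2 * (T - z.re * d ^ 2) / 32
      - θ * ((1 / 2 + κ) * a ^ 2 - R + κ * b ^ 2 + d ^ 2 / 32)
      = (θ + 2 * κ + (1 - V) + g) * R - V * (z.re * a ^ 2) - g * S - X - b ^ 2
        + κ * (2 * (k' * star k).re) + (T - z.re * d ^ 2) / 16 - θ / 2 * a ^ 2 - θ * κ * a ^ 2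
        - θ * κ * b ^ 2 - θ * d ^ 2 / 32 := by ring
  linarith

/-- Squared size of the triple `(u, v, k)`. -/
noncomputable def modeSq (u v k : ℂ) : ℝ := ‖u‖ ^ 2 + ‖k‖ ^ 2 + ‖v‖ ^ 2

theorem modeSq_nonneg (u v k : ℂ) : 0 ≤ modeSq u v k := by unfold modeSq; positivity

/-- Decay at `-∞` at a rate that singles out the unstable mode. -/
def FastDecay (u v k : ℝ → ℂ) : Prop :=
  ∃ C x₁ : ℝ, ∀ x ≤ x₁, modeSq (u x) (v x) (k x) ≤ C * Real.exp (5 / 4 * x)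

theorem coneForm_le_modeSq {κ : ℝ} (hκ1 : κ ≤ 1) (u v k : ℂ) :
    coneForm κ u v k ≤ 2 * modeSq u v k := by
  have h := neg_le_of_abs_le (abs_re_mul_star_le k u)
  unfold coneForm modeSq
  nlinarith [sq_nonneg (‖u‖ - ‖k‖), sq_nonneg ‖u‖, sq_nonneg ‖k‖, sq_nonneg ‖v‖]

theorem le_zero_of_tendsto_atBot {f : ℝ → ℝ} {x : ℝ} (hf : ∀ a ≤ x, f x ≤ f a)
    (h : Tendsto f atBot (𝓝 0)) : f x ≤ 0 :=
  ge_of_tendsto h (eventually_atBot.2 ⟨x, hf⟩)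

/-- Bounds for the coefficients on the half-line `(-∞, x₀]`. -/
def NearEnd (V g : ℝ → ℝ) (τ x₀ : ℝ) : Prop :=
  ∀ x ≤ x₀, 0 ≤ V x ∧ V x ≤ 1 ∧ 1 - V x ≤ τ ∧ |g x| ≤ τ

section cone
variable {V g : ℝ → ℝ} {τ x₀ M κ : ℝ} {z : ℂ} {E u v k : ℝ → ℂ}

theorem ForcedMode.coneForm_hasDerivAt (h : ForcedMode V g z E u v k) (κ x : ℝ) :
    HasDerivAt (fun t => coneForm κ (u t) (v t) (k t))
      (coneFormDeriv κ (u x) (v x) (k x) (k x) (k x - z * v x)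
        (V x * (z * u x + k x) - g x * (k x - z * v x) + E x)) x :=
  hasDerivAt_coneForm (h.u_deriv x) (h.v_deriv x) (h.k_deriv x)

/-- Weighted by `exp (-x)`, the form is nonincreasing up to the forcing. It vanishes at `-∞` because
the decay rate `5/4` exceeds 1, and the forcing is integrable because `9/8` does. The constant is
`1600 = 200 / (9/8 - 1)`. -/
theorem ForcedMode.coneForm_le (h : ForcedMode V g z E u v k) (hVg : NearEnd V g τ x₀)
    (hz : 0 ≤ z.re) (hM : ‖z‖ ≤ M) (hτ : τ * (1 + M) ≤ 1 / 200)
    (hκ : 0 ≤ κ) (hκM : κ * (1 + M) ≤ 1 / 200) {r : ℝ}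
    (hE : ∀ x ≤ x₀, ‖E x‖ ^ 2 ≤ r * Real.exp (9 / 8 * x)) (hf : FastDecay u v k)
    {x : ℝ} (hx : x ≤ x₀) :
    coneForm κ (u x) (v x) (k x) ≤ 1600 * r * Real.exp (9 / 8 * x) := by
  have hM0 : 0 ≤ M := (norm_nonneg z).trans hM
  have hκ1 : κ ≤ 1 := by nlinarith
  set P : ℝ → ℝ := fun t => coneForm κ (u t) (v t) (k t) with hP
  have h1 : ∀ a ≤ x, Real.exp (-1 * x) * P x - 200 * r / (9 / 8 - 1) * Real.exp ((9 / 8 - 1) * x)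
      ≤ Real.exp (-1 * a) * P a - 200 * r / (9 / 8 - 1) * Real.exp ((9 / 8 - 1) * a) := by
    intro a ha
    refine exp_weight_le (θ := 1) (ω := 9 / 8) (by norm_num) ha
      (fun t => h.coneForm_hasDerivAt κ t) (fun t ht => ?_)
    obtain ⟨a1, a2, a3, a4⟩ := hVg t (ht.2.trans hx)
    refine (coneFormDeriv_le (E := E t) hz hM hκ hκM a2 a1 a3 a4 hτ (Or.inl rfl)).trans ?_
    have := modeSq_nonneg (u t) (v t) (k t)
    unfold modeSq at this
    have := hE t (ht.2.trans hx)
    simp only [hP]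
    linarith
  obtain ⟨C, x₁, hC⟩ := hf
  have hexp : ∀ c : ℝ, 0 < c → Tendsto (fun t : ℝ => Real.exp (c * t)) atBot (𝓝 0) :=
    fun c hc => Real.tendsto_exp_atBot.comp (tendsto_id.const_mul_atBot hc)
  have h2 : Real.exp (-1 * x) * P x - 200 * r / (9 / 8 - 1) * Real.exp ((9 / 8 - 1) * x)
      ≤ 0 := by
    have hlim : Tendsto (fun a => 2 * C * Real.exp (1 / 4 * a)
        - 200 * r / (9 / 8 - 1) * Real.exp ((9 / 8 - 1) * a)) atBot (𝓝 0) := by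
      simpa using ((hexp (1 / 4) (by norm_num)).const_mul (2 * C)).sub
        ((hexp (9 / 8 - 1) (by norm_num)).const_mul (200 * r / (9 / 8 - 1)))
    refine ge_of_tendsto hlim (eventually_atBot.2 ⟨min x x₁, fun a ha => ?_⟩)
    refine (h1 a (ha.trans (min_le_left _ _))).trans (sub_le_sub_right ?_ _)
    have h3 : P a ≤ 2 * (C * Real.exp (5 / 4 * a)) :=
      (coneForm_le_modeSq hκ1 _ _ _).trans
        (mul_le_mul_of_nonneg_left (hC a (ha.trans (min_le_right _ _))) (by norm_num))
    calc Real.exp (-1 * a) * P a ≤ Real.exp (-1 * a) * (2 * (C * Real.exp (5 / 4 * a))) :=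
          mul_le_mul_of_nonneg_left h3 (Real.exp_pos _).le
      _ = 2 * C * (Real.exp (-1 * a) * Real.exp (5 / 4 * a)) := by ring
      _ = 2 * C * Real.exp (1 / 4 * a) := by rw [← Real.exp_add]; ring_nf
  have h4 : Real.exp ((9 / 8 - 1) * x) = Real.exp (-1 * x) * Real.exp (9 / 8 * x) := by
    rw [← Real.exp_add]; ring_nf
  rw [h4] at h2
  have h5 : Real.exp (-1 * x) * (P x - 1600 * r * Real.exp (9 / 8 * x)) ≤ 0 := by
    norm_num at h2 ⊢
    linarith
  have h6 := Real.exp_pos (-1 * x)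
  by_contra! hc
  have := mul_pos h6 (sub_pos.2 hc)
  linarith

/-- The forms for `κ` and 0 differ by `κ (|u|² + |k|²)`, which is therefore dominated by the
negative part; `|v|² / 32` is dominated by `Re(k ū)`. -/
theorem modeSq_le_of_coneForm_nonpos (hκ : 0 < κ) {u v k : ℂ} (h : coneForm κ u v k ≤ 0) :
    modeSq u v k ≤ 17 / κ * -coneForm 0 u v k := by
  have h1 := (abs_le.1 (abs_re_mul_star_le k u)).2
  unfold coneForm at h
  have h2 : modeSq u v k ≤ 17 * (‖u‖ ^ 2 + ‖k‖ ^ 2) := by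
    unfold modeSq
    nlinarith [sq_nonneg (‖u‖ - ‖k‖), sq_nonneg ‖u‖, sq_nonneg ‖k‖]
  have h3 : ‖u‖ ^ 2 + ‖k‖ ^ 2 ≤ 1 / κ * -coneForm 0 u v k := by
    rw [div_mul_eq_mul_div, le_div_iff₀ hκ]
    unfold coneForm
    nlinarith
  calc _ ≤ _ := h2
    _ ≤ 17 * (1 / κ * -coneForm 0 u v k) := by linarith
    _ = _ := by ring

theorem neg_coneForm_zero_le (hκ : 0 < κ) {u v k : ℂ} (h : coneForm κ u v k ≤ 0) :
    -coneForm 0 u v k ≤ 1 / κ * ‖u‖ ^ 2 := by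
  have h1 := (abs_le.1 (abs_re_mul_star_le k u)).2
  unfold coneForm at h ⊢
  have hu := norm_nonneg u
  have hk := norm_nonneg k
  have h2 : κ * ‖k‖ ≤ ‖u‖ := by
    by_contra! hc
    have hk' : 0 < ‖k‖ := by
      rcases hk.eq_or_lt with h0 | h0
      · rw [← h0] at hc; simp at hc; linarith
      · exact h0
    nlinarith [mul_pos hk' (sub_pos.2 hc), sq_nonneg ‖u‖, sq_nonneg ‖v‖]
  rw [div_mul_eq_mul_div, le_div_iff₀ hκ]
  have h3 : -((1 / 2 + 0) * ‖u‖ ^ 2 - (k * star u).re + 0 * ‖k‖ ^ 2 + ‖v‖ ^ 2 / 32)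
      ≤ ‖k‖ * ‖u‖ := by nlinarith [sq_nonneg ‖u‖, sq_nonneg ‖v‖]
  nlinarith

/-- Solutions inside the cone decay uniformly. -/
theorem ForcedMode.modeSq_le (h : ForcedMode V g z (fun _ => 0) u v k) (hVg : NearEnd V g τ x₀)
    (hz : 0 ≤ z.re) (hM : ‖z‖ ≤ M) (hτ : τ * (1 + M) ≤ 1 / 200)
    (hκ : 0 < κ) (hc : ∀ x ≤ x₀, coneForm κ (u x) (v x) (k x) ≤ 0) {x : ℝ} (hx : x ≤ x₀) :
    modeSq (u x) (v x) (k x) ≤ 17 / κ ^ 2 * ‖u x₀‖ ^ 2 * Real.exp (5 / 4 * (x - x₀)) := by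
  have hM0 : 0 ≤ M := (norm_nonneg z).trans hM
  -- The form with `κ = 0` is strictly negative on nonzero vectors of the `κ`-cone, so its negative
  -- is equivalent to the squared size there; the value `θ = 5/4` makes it shrink to the left at
  -- that rate.
  have h1 := exp_weight_le_of_le (θ := 5 / 4) hx (fun t => h.coneForm_hasDerivAt 0 t)
    (fun t ht => by
      obtain ⟨a1, a2, a3, a4⟩ := hVg t ht.2
      refine (coneFormDeriv_le (E := 0) hz hM le_rfl (by norm_num) a2 a1 a3 a4 hτ
        (Or.inr rfl)).trans ?_
      have := modeSq_nonneg (u t) (v t) (k t)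
      unfold modeSq at this
      simp only [norm_zero]
      linarith)
  have h2 := modeSq_le_of_coneForm_nonpos hκ (hc x hx)
  have h3 := neg_coneForm_zero_le hκ (hc x₀ le_rfl)
  have h4 : -coneForm 0 (u x) (v x) (k x)
      ≤ -coneForm 0 (u x₀) (v x₀) (k x₀) * Real.exp (5 / 4 * (x - x₀)) := by
    have e1 : Real.exp (-(5 / 4) * x₀) = Real.exp (-(5 / 4) * x) * Real.exp (5 / 4 * (x - x₀)) := by
      rw [← Real.exp_add]; ring_nf
    rw [e1, mul_assoc] at h1
    have := le_of_mul_le_mul_left h1 (Real.exp_pos _)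
    linarith
  have h5 : -coneForm 0 (u x) (v x) (k x)
      ≤ 1 / κ * ‖u x₀‖ ^ 2 * Real.exp (5 / 4 * (x - x₀)) :=
    h4.trans (mul_le_mul_of_nonneg_right h3 (Real.exp_pos _).le)
  calc _ ≤ _ := h2
    _ ≤ 17 / κ * (1 / κ * ‖u x₀‖ ^ 2 * Real.exp (5 / 4 * (x - x₀))) :=
        mul_le_mul_of_nonneg_left h5 (by positivity)
    _ = _ := by ring

end cone

/-! ### From decay to fast decay for `Re z > 0`. -/

/-- The form used to rule out slow decay at `-∞` when `0 < Re z`. -/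
noncomputable def decayForm (β e : ℝ) (u v k : ℂ) : ℝ :=
  1 / 2 * ‖u‖ ^ 2 - (k * star u).re + β / 2 * ‖v‖ ^ 2 - e * (u * star v).re

noncomputable def decayFormDeriv (β e : ℝ) (u v k u' v' k' : ℂ) : ℝ :=
  1 / 2 * (2 * (u' * star u).re) - (k' * star u + k * star u').re
    + β / 2 * (2 * (v' * star v).re) - e * (u' * star v + u * star v').re

theorem hasDerivAt_decayForm {β e : ℝ} {u v k : ℝ → ℂ} {u' v' k' : ℂ} {x : ℝ}
    (hu : HasDerivAt u u' x) (hv : HasDerivAt v v' x) (hk : HasDerivAt k k' x) :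
    HasDerivAt (fun t => decayForm β e (u t) (v t) (k t))
      (decayFormDeriv β e (u x) (v x) (k x) u' v' k') x :=
  ((((hasDerivAt_norm_sq hu).const_mul _).sub (hasDerivAt_re_mul_conj hk hu)).add
    ((hasDerivAt_norm_sq hv).const_mul _)).sub ((hasDerivAt_re_mul_conj hu hv).const_mul _)

/-- The correction `-e Re(u v̄)` replaces `g` by `g - e`; with `e` the limit of `g` at `-∞`, the
terms containing `g - e` become negligible there. -/
theorem decayFormDeriv_eq (β e V g : ℝ) (z u v k : ℂ) :
    decayFormDeriv β e u v k k (k - z * v) (V * (z * u + k) - g * (k - z * v))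
      = -‖k‖ ^ 2 - V * (z.re * ‖u‖ ^ 2) - β * z.re * ‖v‖ ^ 2 + (1 - V + g - e) * (k * star u).re
        - (g - e) * (z * v * star u).re + (β - e) * (k * star v).re := by
  unfold decayFormDeriv
  simp only [← re_mul_star_self]
  simp [Complex.mul_re, Complex.mul_im]
  ring

section decay
variable {β e V g σ M c : ℝ} {z u v k : ℂ}

/-- The hypothesis `(β - e)² ≤ β Re z` is what Young's inequality needs to absorb the cross term in
`k` and `v` into half of the available dissipation. -/
theorem decayFormDeriv_le_neg (hz : 0 < z.re) (hM : ‖z‖ ≤ M) (he : 0 ≤ e) (heβ : e ≤ β)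
    (hβe : (β - e) ^ 2 ≤ β * z.re) (hV1 : V ≤ 1) (hV : 1 - V ≤ σ) (hg : |g - e| ≤ σ)
    (hc1 : 2 * c ≤ 1 / 2) (hc2 : 2 * c ≤ z.re) (hc3 : 2 * c ≤ β * z.re / 2)
    (hσ : σ * (1 + 2 * M) ≤ c) :
    decayFormDeriv β e u v k k (k - z * v) (V * (z * u + k) - g * (k - z * v))
      ≤ -c * modeSq u v k := by
  rw [decayFormDeriv_eq]
  unfold modeSq
  have hM0 : 0 ≤ M := (norm_nonneg z).trans hM
  have hσ0 : 0 ≤ σ := (abs_nonneg _).trans hg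
  have hρM : z.re ≤ M := (Complex.re_le_norm z).trans hM
  set a := ‖u‖
  set b := ‖k‖
  set d := ‖v‖
  have ha0 : 0 ≤ a := norm_nonneg _
  have hb0 : 0 ≤ b := norm_nonneg _
  have hd0 : 0 ≤ d := norm_nonneg _
  have f1 : (1 - V + g - e) * (k * star u).re ≤ σ * (a ^ 2 + b ^ 2) := by
    have h1 : |1 - V + g - e| ≤ 2 * σ := by
      have := abs_le.1 hg
      rw [abs_le]; constructor <;> linarith
    calc _ ≤ |1 - V + g - e| * |(k * star u).re| := by rw [← abs_mul]; exact le_abs_self _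
      _ ≤ 2 * σ * (b * a) := by gcongr; exact abs_re_mul_star_le k u
      _ ≤ _ := by nlinarith [mul_nonneg hσ0 (sq_nonneg (a - b))]
  have f2 : -((g - e) * (z * v * star u).re) ≤ σ * M * (a ^ 2 + d ^ 2) := by
    have hS : |(z * v * star u).re| ≤ M * d * a := by
      refine (abs_re_mul_star_le (z * v) u).trans ?_
      rw [norm_mul]; gcongr
    have hσM : 0 ≤ σ * M := by positivity
    calc _ ≤ |g - e| * |(z * v * star u).re| := by rw [← abs_mul]; exact neg_le_abs _
      _ ≤ σ * (M * d * a) := by gcongr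
      _ ≤ _ := by nlinarith [mul_nonneg hσM (sq_nonneg (a - d)), mul_nonneg hσM (sq_nonneg a),
        mul_nonneg hσM (sq_nonneg d)]
  have f3 : (β - e) * (k * star v).re ≤ 1 / 2 * b ^ 2 + 1 / 2 * (β * z.re) * d ^ 2 := by
    have hT : (k * star v).re ≤ b * d := (le_abs_self _).trans (abs_re_mul_star_le k v)
    calc _ ≤ (β - e) * (b * d) := mul_le_mul_of_nonneg_left hT (by linarith)
      _ ≤ 1 / 2 * b ^ 2 + 1 / 2 * (β - e) ^ 2 * d ^ 2 := by
        nlinarith [sq_nonneg (b - (β - e) * d)]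
      _ ≤ _ := by gcongr
  have f4 : (1 - V) * (z.re * a ^ 2) ≤ σ * M * a ^ 2 := by
    calc _ ≤ σ * (M * a ^ 2) := by gcongr
      _ = _ := by ring
  have g1 : σ * (1 + 2 * M) * a ^ 2 ≤ c * a ^ 2 := by gcongr
  have g2 : σ * (1 + 2 * M) * b ^ 2 ≤ c * b ^ 2 := by gcongr
  have g3 : σ * (1 + 2 * M) * d ^ 2 ≤ c * d ^ 2 := by gcongr
  have g4 : 2 * c * a ^ 2 ≤ z.re * a ^ 2 := by gcongr
  have g5 : 2 * c * b ^ 2 ≤ 1 / 2 * b ^ 2 := by gcongr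
  have g6 : 2 * c * d ^ 2 ≤ β * z.re / 2 * d ^ 2 := by gcongr
  have g7 : 0 ≤ σ * M * b ^ 2 := by positivity
  have g8 : 0 ≤ σ * M * d ^ 2 := by positivity
  have g9 : 0 ≤ σ * d ^ 2 := by positivity
  nlinarith

theorem decay_quadratic_bound {a b d β : ℝ} (ha : 0 ≤ a) (hb : 0 ≤ b) (hd : 0 ≤ d)
    (hβ : 0 ≤ β) (hβ1 : β ≤ 1 / 16) :
    5 / 4 * (a * b) - b ^ 2 - 5 / 8 * a ^ 2 + β / 100 * (a ^ 2 + b ^ 2)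
      + β / 100 * (a ^ 2 + d ^ 2) - 5 / 8 * β * d ^ 2 + 5 / 4 * (β * (a * d)) + β * (b * d)
      ≤ 0 := by
  have h1 : 5 / 4 * (β * (a * d)) ≤ β * (5 / 4 * a ^ 2 + 5 / 16 * d ^ 2) := by
    nlinarith [mul_nonneg hβ (sq_nonneg (2 * a - d))]
  have h2 : β * (b * d) ≤ β * (b ^ 2 + 1 / 4 * d ^ 2) := by
    nlinarith [mul_nonneg hβ (sq_nonneg (2 * b - d))]
  have h3 : β * a ^ 2 ≤ 1 / 16 * a ^ 2 := by gcongr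
  have h4 : β * b ^ 2 ≤ 1 / 16 * b ^ 2 := by gcongr
  have h5 : 0 ≤ β * d ^ 2 := by positivity
  nlinarith [sq_nonneg (b - 11 / 16 * a), sq_nonneg a, sq_nonneg b]

theorem decayFormDeriv_le_mul (hz : 0 < z.re) (hM : ‖z‖ ≤ M) (he : 0 ≤ e) (heβ : e ≤ β)
    (hβ1 : β ≤ 1 / 16) (hV0 : 0 ≤ V) (hV1 : V ≤ 1) (hV : 1 - V ≤ σ) (hg : |g - e| ≤ σ)
    (hσ : σ * (1 + 2 * M) ≤ β / 100) :
    decayFormDeriv β e u v k k (k - z * v) (V * (z * u + k) - g * (k - z * v))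
      ≤ 5 / 4 * decayForm β e u v k := by
  rw [decayFormDeriv_eq]
  unfold decayForm
  have hM0 : 0 ≤ M := (norm_nonneg z).trans hM
  have hσ0 : 0 ≤ σ := (abs_nonneg _).trans hg
  have hq := decay_quadratic_bound (norm_nonneg u) (norm_nonneg k) (norm_nonneg v)
    (he.trans heβ) hβ1
  set a := ‖u‖
  set b := ‖k‖
  set d := ‖v‖
  have ha0 : 0 ≤ a := norm_nonneg _
  have hb0 : 0 ≤ b := norm_nonneg _
  have hd0 : 0 ≤ d := norm_nonneg _
  have hσM : 0 ≤ σ * M := by positivity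
  have hR : |(k * star u).re| ≤ b * a := abs_re_mul_star_le k u
  have f1 : (1 - V + g - e) * (k * star u).re ≤ σ * (a ^ 2 + b ^ 2) := by
    have h1 : |1 - V + g - e| ≤ 2 * σ := by
      have := abs_le.1 hg
      rw [abs_le]; constructor <;> linarith
    calc _ ≤ |1 - V + g - e| * |(k * star u).re| := by rw [← abs_mul]; exact le_abs_self _
      _ ≤ 2 * σ * (b * a) := by gcongr
      _ ≤ _ := by nlinarith [mul_nonneg hσ0 (sq_nonneg (a - b))]
  have f2 : -((g - e) * (z * v * star u).re) ≤ σ * M * (a ^ 2 + d ^ 2) := by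
    have hS : |(z * v * star u).re| ≤ M * d * a := by
      refine (abs_re_mul_star_le (z * v) u).trans ?_
      rw [norm_mul]; gcongr
    calc _ ≤ |g - e| * |(z * v * star u).re| := by rw [← abs_mul]; exact neg_le_abs _
      _ ≤ σ * (M * d * a) := by gcongr
      _ ≤ _ := by nlinarith [mul_nonneg hσM (sq_nonneg (a - d)), mul_nonneg hσM (sq_nonneg a),
        mul_nonneg hσM (sq_nonneg d)]
  have f3 : (β - e) * (k * star v).re ≤ β * (b * d) := by
    have hT : (k * star v).re ≤ b * d := (le_abs_self _).trans (abs_re_mul_star_le k v)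
    have hbd := mul_nonneg hb0 hd0
    calc _ ≤ (β - e) * (b * d) := mul_le_mul_of_nonneg_left hT (by linarith)
      _ ≤ _ := by nlinarith
  have f4 : e * (u * star v).re ≤ β * (a * d) := by
    have hU : (u * star v).re ≤ a * d := (le_abs_self _).trans (abs_re_mul_star_le u v)
    have had := mul_nonneg ha0 hd0
    calc _ ≤ e * (a * d) := mul_le_mul_of_nonneg_left hU he
      _ ≤ _ := by gcongr
  have hσ' : σ ≤ β / 100 := by nlinarith
  have hσM' : σ * M ≤ β / 100 := by nlinarith
  have g1 : σ * (a ^ 2 + b ^ 2) ≤ β / 100 * (a ^ 2 + b ^ 2) := by gcongr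
  have g2 : σ * M * (a ^ 2 + d ^ 2) ≤ β / 100 * (a ^ 2 + d ^ 2) := by gcongr
  have g3 : 0 ≤ V * (z.re * a ^ 2) := by positivity
  have g4 : 0 ≤ β * z.re * d ^ 2 := by
    have := he.trans heβ
    positivity
  have g5 := (abs_le.1 hR).2
  linarith

end decay

theorem hasDerivAt_modeSq {u v k : ℝ → ℂ} {u' v' k' : ℂ} {x : ℝ}
    (hu : HasDerivAt u u' x) (hv : HasDerivAt v v' x) (hk : HasDerivAt k k' x) :
    HasDerivAt (fun t => modeSq (u t) (v t) (k t))
      (2 * (u' * star (u x)).re + 2 * (k' * star (k x)).re + 2 * (v' * star (v x)).re) x :=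
  ((hasDerivAt_norm_sq hu).add (hasDerivAt_norm_sq hk)).add (hasDerivAt_norm_sq hv)

theorem modeSq_deriv_le {V g M : ℝ} {z u v k : ℂ} (hM : ‖z‖ ≤ M) (hz : 0 ≤ z.re)
    (hV1 : V ≤ 1) (hV0 : 0 ≤ V) (hg : |g| ≤ 1) :
    2 * (k * star u).re + 2 * ((V * (z * u + k) - g * (k - z * v)) * star k).re
      + 2 * ((k - z * v) * star v).re ≤ 10 * (1 + M) * modeSq u v k := by
  have hM0 : 0 ≤ M := (norm_nonneg z).trans hM
  have h1 : (k * star u).re ≤ ‖k‖ * ‖u‖ := (le_abs_self _).trans (abs_re_mul_star_le k u)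
  have h2 : ((V * (z * u + k) - g * (k - z * v)) * star k).re
      ≤ ((M * ‖u‖ + ‖k‖) + (‖k‖ + M * ‖v‖)) * ‖k‖ := by
    refine ((le_abs_self _).trans (abs_re_mul_star_le _ k)).trans ?_
    have := norm_forced_deriv_le (u := u) (v := v) (k := k) (E := 0) hM hV1 hV0 hg
    simp only [add_zero, norm_zero, one_mul] at this
    gcongr
  have h3 : ((k - z * v) * star v).re ≤ ‖k‖ * ‖v‖ := by
    have : ((k - z * v) * star v).re = (k * star v).re - z.re * ‖v‖ ^ 2 := by
      rw [← re_mul_star_self]; simp [Complex.mul_re, Complex.mul_im]; ring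
    rw [this]
    have h4 : (k * star v).re ≤ ‖k‖ * ‖v‖ := (le_abs_self _).trans (abs_re_mul_star_le k v)
    have : 0 ≤ z.re * ‖v‖ ^ 2 := by positivity
    linarith
  unfold modeSq
  have a1 := sq_nonneg (‖u‖ - ‖k‖)
  have a2 := sq_nonneg (‖v‖ - ‖k‖)
  have b1 := mul_nonneg hM0 a1
  have b2 := mul_nonneg hM0 a2
  have c1 := sq_nonneg ‖u‖
  have c2 := sq_nonneg ‖v‖
  have c3 := sq_nonneg ‖k‖
  have d1 := mul_nonneg hM0 c1
  have d2 := mul_nonneg hM0 c2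
  have d3 := mul_nonneg hM0 c3
  nlinarith

/-- Strict dissipation makes `decayForm + κ modeSq` nonincreasing near `-∞`. It tends to 0 there,
hence is nonpositive, so the squared size is at most `-decayForm / κ`. The second differential
inequality makes `-decayForm` decay to the left at rate `5/4`. -/
theorem ForcedMode.fastDecay {V g : ℝ → ℝ} {z : ℂ} {u v k : ℝ → ℂ} {β e : ℝ}
    (h : ForcedMode V g z (fun _ => 0) u v k) (hz : 0 < z.re) (hV1 : ∀ x, V x ≤ 1)
    (hV : Tendsto V atBot (𝓝 1)) (hg : Tendsto g atBot (𝓝 e)) (he : 0 ≤ e) (heβ : e ≤ β)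
    (hβ : 0 < β) (hβ1 : β ≤ 1 / 16) (hβe : (β - e) ^ 2 ≤ β * z.re)
    (hu : Tendsto u atBot (𝓝 0)) (hv : Tendsto v atBot (𝓝 0)) (hk : Tendsto k atBot (𝓝 0)) :
    FastDecay u v k := by
  set M := ‖z‖ with hMdef
  have hM0 : 0 ≤ M := norm_nonneg z
  -- This choice is below both `β / 8` and `β Re z / 8`, so it meets all smallness conditions of
  -- `decayFormDeriv_le_neg`.
  set c := β * z.re / (8 * (1 + z.re)) with hc
  have hc0 : 0 < c := by positivity
  have hcmul : c * (8 * (1 + z.re)) = β * z.re := by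
    rw [hc]; field_simp
  have hcβ : 8 * c ≤ β := by
    have : c * (8 * (1 + z.re)) ≤ β * (1 + z.re) := by nlinarith
    nlinarith
  have hczz : 8 * c ≤ β * z.re := by nlinarith
  set σ := min (min c (β / 100) / (1 + 2 * M)) (1 / 2) with hσ
  have hσ0 : 0 < σ := by positivity
  have hσle : σ * (1 + 2 * M) ≤ min c (β / 100) := by
    rw [← le_div_iff₀ (by positivity)]; exact min_le_left _ _
  have hσ2 : σ ≤ 1 / 2 := min_le_right _ _
  have hev : ∀ᶠ x in atBot, 1 - V x ≤ σ ∧ |g x - e| ≤ σ := by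
    have h1 := hV.eventually (lt_mem_nhds (show 1 - σ < 1 by linarith))
    have h2 : ∀ᶠ x in atBot, |g x - e| < σ := by
      simpa [Real.dist_eq] using hg.eventually (Metric.ball_mem_nhds e hσ0)
    filter_upwards [h1, h2] with x h3 h4
    exact ⟨by linarith, h4.le⟩
  obtain ⟨x₁, hx₁⟩ := eventually_atBot.1 hev
  set κ := c / (10 * (1 + M)) with hκ
  have hκ0 : 0 < κ := by positivity
  have hd : ∀ x, HasDerivAt (fun t => decayForm β e (u t) (v t) (k t))
      (decayFormDeriv β e (u x) (v x) (k x) (k x) (k x - z * v x)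
        (V x * (z * u x + k x) - g x * (k x - z * v x))) x := fun x =>
    hasDerivAt_decayForm (h.u_deriv x) (h.v_deriv x) (by simpa using h.k_deriv x)
  have hN : ∀ x, HasDerivAt (fun t => modeSq (u t) (v t) (k t)) _ x := fun x =>
    hasDerivAt_modeSq (h.u_deriv x) (h.v_deriv x) (by simpa using h.k_deriv x)
  have hlimN : Tendsto (fun t => modeSq (u t) (v t) (k t)) atBot (𝓝 0) := by
    simpa [modeSq] using ((hu.norm.pow 2).add (hk.norm.pow 2)).add (hv.norm.pow 2)
  have hlimF : Tendsto (fun t => decayForm β e (u t) (v t) (k t)) atBot (𝓝 0) := by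
    have hcont : Continuous fun p : ℂ × ℂ × ℂ => decayForm β e p.1 p.2.1 p.2.2 := by
      unfold decayForm; fun_prop
    have := (hcont.tendsto (0, 0, 0)).comp (hu.prodMk_nhds (hv.prodMk_nhds hk))
    simpa [decayForm, Function.comp_def] using this
  have hneg : ∀ x ≤ x₁, decayForm β e (u x) (v x) (k x) + κ * modeSq (u x) (v x) (k x) ≤ 0 := by
    intro x hx
    refine le_zero_of_tendsto_atBot
      (f := fun t => decayForm β e (u t) (v t) (k t) + κ * modeSq (u t) (v t) (k t))
      (fun a ha => ?_) (by simpa using hlimF.add (hlimN.const_mul κ))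
    refine le_of_hasDerivAt_nonpos ha (fun t => (hd t).add ((hN t).const_mul κ)) fun t ht => ?_
    obtain ⟨h1, h2⟩ := hx₁ t (ht.2.trans hx)
    have h3 := decayFormDeriv_le_neg (u := u t) (v := v t) (k := k t) hz le_rfl he heβ hβe
      (hV1 t) h1 h2 (c := c) (by linarith) (by nlinarith) (by linarith)
      (hσle.trans (min_le_left _ _))
    have h4 := modeSq_deriv_le (M := M) (u := u t) (v := v t) (k := k t) le_rfl hz.le (hV1 t)
      (by linarith) (show |g t| ≤ 1 by
        have := abs_le.1 h2
        rw [abs_le]; constructor <;> linarith)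
    have h5 : κ * (10 * (1 + M) * modeSq (u t) (v t) (k t)) = c * modeSq (u t) (v t) (k t) := by
      rw [hκ]; field_simp
    have h6 := mul_le_mul_of_nonneg_left h4 hκ0.le
    rw [h5] at h6
    linarith
  refine ⟨1 / κ * (Real.exp (-(5 / 4) * x₁) * -decayForm β e (u x₁) (v x₁) (k x₁)), x₁,
    fun x hx => ?_⟩
  have h1 := exp_weight_le_of_le (θ := 5 / 4) hx hd (fun t ht => by
    obtain ⟨h1, h2⟩ := hx₁ t ht.2
    exact decayFormDeriv_le_mul hz le_rfl he heβ hβ1 (by linarith) (hV1 t) h1 h2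
      (hσle.trans (min_le_right _ _)))
  have h2 := hneg x hx
  have h3 : Real.exp (-(5 / 4) * x) * Real.exp (5 / 4 * x) = 1 := by
    rw [← Real.exp_add]; ring_nf; simp
  have h4 := mul_le_mul_of_nonneg_right h1 (Real.exp_pos (5 / 4 * x)).le
  have h5 : Real.exp (-(5 / 4) * x) * decayForm β e (u x) (v x) (k x) * Real.exp (5 / 4 * x)
      = decayForm β e (u x) (v x) (k x) := by
    calc _ = decayForm β e (u x) (v x) (k x)
          * (Real.exp (-(5 / 4) * x) * Real.exp (5 / 4 * x)) := by ring
      _ = _ := by rw [h3, mul_one]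
  rw [h5] at h4
  rw [mul_assoc, div_mul_eq_mul_div, le_div_iff₀ hκ0]
  linarith

/-! ### Families of unstable modes on the closed half-plane. -/

/-- A family of unstable modes with the properties needed below. -/
structure ModeFamily (V g : ℝ → ℝ) (G : ℝ) (W : ℂ → ℝ → Fin 3 → ℂ) : Prop where
  V_nonneg : ∀ x, 0 ≤ V x
  V_le_one : ∀ x, V x ≤ 1
  f_le : ∀ x, |V x - g x| ≤ G
  solves : ∀ z ∈ closedRHP, Solves (fun x => coeffMatrix (V x) (V x - g x) z) (W z)
  ne_zero : ∀ z ∈ closedRHP, W z 0 ≠ 0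
  analytic : ∀ x, AnalyticOnNhd ℂ (fun z => W z x) closedRHP
  fast : ∀ z : ℂ, 0 < z.re →
    FastDecay (fun x => W z x 0) (fun x => W z x 1) (fun x => z * W z x 1 + W z x 2)

theorem tendsto_coord {W : ℝ → Fin 3 → ℂ} {l : Filter ℝ} (h : Tendsto W l (𝓝 0)) (i : Fin 3) :
    Tendsto (fun x => W x i) l (𝓝 0) := tendsto_pi_nhds.1 h i

theorem IsUnstableMode.modeFamily {γ vp : ℝ} {vhat : ℝ → ℝ} {W : ℂ → ℝ → Fin 3 → ℂ}
    (h : SmallEnd γ vp) (hp : IsProfile γ vp vhat) (hW : IsUnstableMode (matA γ vp vhat) W) :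
    ModeFamily vhat (fun x => gCoeff γ vp (vhat x)) (γ + 1) W := by
  have hsol : ∀ z ∈ closedRHP, Solves
      (fun x => coeffMatrix (vhat x) (vhat x - gCoeff γ vp (vhat x)) z) (W z) := by
    intro z hz
    simpa only [matA_eq] using hW.solves z hz
  refine ⟨fun x => (hp.pos x).le, hp.le_one h, fun x => ?_, hsol, hW.ne_zero, hW.analytic,
    fun z hz => ?_⟩
  · obtain ⟨h1, h2⟩ := gCoeff_sub_mem h (hp.vp_le h x)
    have h3 := hp.pos x
    have h4 := hp.le_one h x
    rw [abs_le]; constructor <;> linarith [h.one_le]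
  · have hd := hW.decays z hz.le
    have ha := h.rhConst_pos
    have hγ := h.one_le
    have hβ : 0 < rhConst γ vp * γ := by positivity
    -- Here `g` has the positive limit `a γ`, and `β = e` kills the cross term.
    refine (hsol z hz.le).forcedMode.fastDecay (β := rhConst γ vp * γ) (e := rhConst γ vp * γ)
      hz (hp.le_one h) hp.tendsto_atBot
      (tendsto_gCoeff_one.comp hp.tendsto_atBot) hβ.le le_rfl hβ h.rhConst_mul_gamma_le
      (by simpa using by positivity) (tendsto_coord hd 0) (tendsto_coord hd 1) ?_
    simpa using ((tendsto_coord hd 1).const_mul z).add (tendsto_coord hd 2)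

theorem IsUnstableMode.modeFamily_lim {γ : ℝ} {W : ℂ → ℝ → Fin 3 → ℂ} (hγ : 1 ≤ γ)
    (hW : IsUnstableMode matA0 W) :
    ModeFamily limProfile (fun x => 1 - limProfile x) (γ + 1) W := by
  have hsol : ∀ z ∈ closedRHP, Solves
      (fun x => coeffMatrix (limProfile x) (limProfile x - (1 - limProfile x)) z) (W z) := by
    intro z hz
    simpa only [matA0_eq] using hW.solves z hz
  refine ⟨fun x => (limProfile_pos x).le, fun x => (limProfile_lt_one x).le, fun x => ?_, hsol,
    hW.ne_zero, hW.analytic, fun z hz => ?_⟩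
  · have h3 := limProfile_pos x
    have h4 := limProfile_lt_one x
    rw [abs_le]; constructor <;> linarith
  · have hd := hW.decays z hz.le
    -- In the limiting system `e = 0`, so `β ≤ Re z` is required; the parameter may depend on `z`
    -- since fast decay is only qualitative.
    have hβ : 0 < min z.re (1 / 16) := by positivity
    refine (hsol z hz.le).forcedMode.fastDecay (β := min z.re (1 / 16)) (e := 0)
      hz (fun x => (limProfile_lt_one x).le) tendsto_limProfile_atBot
      (by simpa using tendsto_limProfile_atBot.const_sub 1) le_rfl hβ.le hβ (min_le_right _ _)
      ?_ (tendsto_coord hd 0) (tendsto_coord hd 1) ?_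
    · rw [sub_zero, sq]
      exact mul_le_mul_of_nonneg_left (min_le_left _ _) hβ.le
    · simpa using ((tendsto_coord hd 1).const_mul z).add (tendsto_coord hd 2)

namespace ModeFamily
variable {V g : ℝ → ℝ} {G τ x₀ M κ : ℝ} {W : ℂ → ℝ → Fin 3 → ℂ} (h : ModeFamily V g G W)
include h

theorem norm_deriv_le {z : ℂ} (hM : ‖z‖ ≤ M) (x : ℝ) (y : Fin 3 → ℂ) :
    ‖(coeffMatrix (V x) (V x - g x) z).mulVec y‖ ≤ (3 * M + G + 1) * ‖y‖ :=
  norm_coeffMatrix_mulVec_le (by rw [abs_of_nonneg (h.V_nonneg x)]; exact h.V_le_one x)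
    (h.f_le x) hM y

theorem ne_zero_at {z : ℂ} (hz : z ∈ closedRHP) (x : ℝ) : W z x ≠ 0 := fun h0 =>
  h.ne_zero z hz (eq_zero_of_norm_deriv_le (h.solves z hz)
    (fun t => h.norm_deriv_le le_rfl t _) h0 0)

theorem continuousAt {z : ℂ} (hz : z ∈ closedRHP) (x : ℝ) (i : Fin 3) :
    ContinuousAt (fun z => W z x i) z :=
  (continuous_apply i).continuousAt.comp (h.analytic x z hz).continuousAt

theorem continuousAt_coneForm {z : ℂ} (hz : z ∈ closedRHP) (x : ℝ) : ContinuousAt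
    (fun z => coneForm κ (W z x 0) (W z x 1) (z * W z x 1 + W z x 2)) z := by
  have h0 := h.continuousAt hz x 0
  have h1 := h.continuousAt hz x 1
  have h2 := h.continuousAt hz x 2
  have h3 : ContinuousAt (fun z => z * W z x 1 + W z x 2) z := (continuousAt_id.mul h1).add h2
  have h4 : ContinuousAt (fun z => ((z * W z x 1 + W z x 2) * star (W z x 0)).re) z :=
    Complex.continuous_re.continuousAt.comp (h3.mul h0.star)
  exact ((((h0.norm.pow 2).const_mul _).sub h4).add ((h3.norm.pow 2).const_mul _)).add
    ((h1.norm.pow 2).div_const _)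

/-- Fast decay is known only for `Re z > 0`, so `z` is approached by `z + t` with `t ↓ 0`; the cone
is closed and the mode continuous in `z`. The bound `2 + M` replaces `1 + M` because `|z + t|` may
exceed `M` by up to 1. -/
theorem coneForm_nonpos (hVg : NearEnd V g τ x₀) (hτ : τ * (2 + M) ≤ 1 / 200) (hκ : 0 ≤ κ)
    (hκM : κ * (2 + M) ≤ 1 / 200) {z : ℂ} (hz : z ∈ closedRHP) (hM : ‖z‖ ≤ M) {x : ℝ}
    (hx : x ≤ x₀) : coneForm κ (W z x 0) (W z x 1) (z * W z x 1 + W z x 2) ≤ 0 := by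
  have hcont := h.continuousAt_coneForm (κ := κ) hz x
  have hpath : Tendsto (fun t : ℝ => z + (t : ℂ)) (𝓝[>] 0) (𝓝 z) := by
    have : Continuous fun t : ℝ => z + (t : ℂ) := by fun_prop
    simpa using (this.tendsto 0).mono_left nhdsWithin_le_nhds
  refine le_of_tendsto (hcont.tendsto.comp hpath) ?_
  filter_upwards [Ioo_mem_nhdsGT (show (0 : ℝ) < 1 by norm_num)] with t ht
  have hre : 0 < (z + (t : ℂ)).re := by
    have : 0 ≤ z.re := hz
    have := ht.1
    simp; linarith
  have hn : ‖z + (t : ℂ)‖ ≤ M + 1 := by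
    refine (norm_add_le _ _).trans (add_le_add hM ?_)
    rw [Complex.norm_real, Real.norm_of_nonneg ht.1.le]
    exact ht.2.le
  have := (h.solves _ (le_of_lt hre : (z + (t : ℂ)) ∈ closedRHP)).forcedMode.coneForm_le
    (r := 0) hVg hre.le hn (by convert hτ using 2; ring) hκ (by convert hκM using 2; ring)
    (fun x _ => by simp) (h.fast _ hre) hx
  simpa using this

theorem modeSq_le (hVg : NearEnd V g τ x₀) (hτ : τ * (2 + M) ≤ 1 / 200) (hκ : 0 < κ)
    (hκM : κ * (2 + M) ≤ 1 / 200) {z : ℂ} (hz : z ∈ closedRHP) (hM : ‖z‖ ≤ M) {x : ℝ}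
    (hx : x ≤ x₀) :
    modeSq (W z x 0) (W z x 1) (z * W z x 1 + W z x 2)
      ≤ 17 / κ ^ 2 * ‖W z x₀ 0‖ ^ 2 * Real.exp (5 / 4 * (x - x₀)) := by
  have hτ0 : 0 ≤ τ := (abs_nonneg _).trans (hVg x₀ le_rfl).2.2.2
  exact (h.solves z hz).forcedMode.modeSq_le hVg hz hM (by nlinarith) hκ
    (fun t ht => h.coneForm_nonpos hVg hτ hκ.le hκM hz hM ht) hx

/-- Inside the cone `u` controls the whole vector, so its vanishing would make the mode trivial.
This licenses normalization by the first component. -/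
theorem u_ne_zero (hVg : NearEnd V g τ x₀) (hτ : τ * (2 + M) ≤ 1 / 200) (hκ : 0 < κ)
    (hκM : κ * (2 + M) ≤ 1 / 200) {z : ℂ} (hz : z ∈ closedRHP) (hM : ‖z‖ ≤ M) :
    W z x₀ 0 ≠ 0 := by
  intro h0
  have h1 := h.modeSq_le hVg hτ hκ hκM hz hM le_rfl
  rw [h0] at h1
  unfold modeSq at h1
  simp only [norm_zero] at h1
  have h2 := sq_nonneg ‖z * W z x₀ 1 + W z x₀ 2‖
  have h3 := sq_nonneg ‖W z x₀ 1‖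
  norm_num at h1
  have h4 : ‖W z x₀ 1‖ ^ 2 = 0 := by linarith
  have h5 : ‖z * W z x₀ 1 + W z x₀ 2‖ ^ 2 = 0 := by linarith
  have h6 : W z x₀ 1 = 0 := by simpa using h4
  rw [h6] at h5
  have h7 : W z x₀ 2 = 0 := by simpa using h5
  apply h.ne_zero_at hz x₀
  funext i
  fin_cases i
  · exact h0
  · exact h6
  · exact h7

end ModeFamily

/-! ### Comparison of the unstable modes of two nearby systems. -/

section compare
variable {V g V₀ g₀ : ℝ → ℝ} {z : ℂ} {u v k u₀ v₀ k₀ : ℝ → ℂ}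

theorem ForcedMode.smul_sub_smul (h : ForcedMode V g z (fun _ => 0) u v k)
    (h₀ : ForcedMode V₀ g₀ z (fun _ => 0) u₀ v₀ k₀) (c c₀ : ℂ) :
    ForcedMode V g z
      (fun x => (V x - V₀ x) * (z * (c₀ * u₀ x) + c₀ * k₀ x)
        - (g x - g₀ x) * (c₀ * k₀ x - z * (c₀ * v₀ x)))
      (fun x => c * u x - c₀ * u₀ x) (fun x => c * v x - c₀ * v₀ x)
      (fun x => c * k x - c₀ * k₀ x) where
  u_deriv x := ((h.u_deriv x).const_mul c).sub ((h₀.u_deriv x).const_mul c₀)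
  v_deriv x := (((h.v_deriv x).const_mul c).sub ((h₀.v_deriv x).const_mul c₀)).congr_deriv
    (by ring)
  k_deriv x := (((h.k_deriv x).const_mul c).sub ((h₀.k_deriv x).const_mul c₀)).congr_deriv
    (by ring)

theorem norm_smul_sub_sq_le (c c₀ a b : ℂ) :
    ‖c * a - c₀ * b‖ ^ 2 ≤ 2 * (‖c‖ ^ 2 * ‖a‖ ^ 2) + 2 * (‖c₀‖ ^ 2 * ‖b‖ ^ 2) := by
  have h := norm_sub_le (c * a) (c₀ * b)
  rw [norm_mul, norm_mul] at h
  nlinarith [norm_nonneg (c * a - c₀ * b), sq_nonneg (‖c‖ * ‖a‖ - ‖c₀‖ * ‖b‖)]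

theorem FastDecay.smul_sub_smul (h : FastDecay u v k) (h₀ : FastDecay u₀ v₀ k₀) (c c₀ : ℂ) :
    FastDecay (fun x => c * u x - c₀ * u₀ x) (fun x => c * v x - c₀ * v₀ x)
      (fun x => c * k x - c₀ * k₀ x) := by
  obtain ⟨C, x₁, hC⟩ := h
  obtain ⟨C₀, x₂, hC₀⟩ := h₀
  refine ⟨2 * ‖c‖ ^ 2 * C + 2 * ‖c₀‖ ^ 2 * C₀, min x₁ x₂, fun x hx => ?_⟩
  have h1 := hC x (hx.trans (min_le_left _ _))
  have h2 := hC₀ x (hx.trans (min_le_right _ _))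
  have h3 : modeSq (c * u x - c₀ * u₀ x) (c * v x - c₀ * v₀ x) (c * k x - c₀ * k₀ x)
      ≤ 2 * ‖c‖ ^ 2 * modeSq (u x) (v x) (k x) + 2 * ‖c₀‖ ^ 2 * modeSq (u₀ x) (v₀ x) (k₀ x) := by
    unfold modeSq
    linarith [norm_smul_sub_sq_le c c₀ (u x) (u₀ x), norm_smul_sub_sq_le c c₀ (v x) (v₀ x),
      norm_smul_sub_sq_le c c₀ (k x) (k₀ x)]
  have h4 := mul_le_mul_of_nonneg_left h1 (by positivity : (0 : ℝ) ≤ 2 * ‖c‖ ^ 2)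
  have h5 := mul_le_mul_of_nonneg_left h2 (by positivity : (0 : ℝ) ≤ 2 * ‖c₀‖ ^ 2)
  linarith

end compare

theorem norm_sq_forcing_le {V V₀ g g₀ ω M : ℝ} {z u v k : ℂ} (hM : ‖z‖ ≤ M)
    (hV : |V - V₀| ≤ ω) (hg : |g - g₀| ≤ ω) :
    ‖((V : ℂ) - V₀) * (z * u + k) - ((g : ℂ) - g₀) * (k - z * v)‖ ^ 2
      ≤ 12 * (1 + M) ^ 2 * ω ^ 2 * modeSq u v k := by
  have hM0 : 0 ≤ M := (norm_nonneg z).trans hM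
  have hω : 0 ≤ ω := (abs_nonneg _).trans hV
  have h1 : ‖((V : ℂ) - V₀) * (z * u + k)‖ ≤ ω * (M * ‖u‖ + ‖k‖) := by
    rw [norm_mul, ← Complex.ofReal_sub, Complex.norm_real, Real.norm_eq_abs]
    gcongr
    refine (norm_add_le _ _).trans ?_
    rw [norm_mul]; gcongr
  have h2 : ‖((g : ℂ) - g₀) * (k - z * v)‖ ≤ ω * (‖k‖ + M * ‖v‖) := by
    rw [norm_mul, ← Complex.ofReal_sub, Complex.norm_real, Real.norm_eq_abs]
    gcongr
    refine (norm_sub_le _ _).trans ?_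
    rw [norm_mul]; gcongr
  have h3 : ‖((V : ℂ) - V₀) * (z * u + k) - ((g : ℂ) - g₀) * (k - z * v)‖
      ≤ 2 * ((1 + M) * ω) * (‖u‖ + ‖k‖ + ‖v‖) := by
    refine (norm_sub_le _ _).trans ((add_le_add h1 h2).trans ?_)
    have a1 := mul_nonneg hω (norm_nonneg u)
    have a2 := mul_nonneg hω (norm_nonneg k)
    have a3 := mul_nonneg hω (norm_nonneg v)
    have b1 := mul_nonneg hM0 a1
    have b2 := mul_nonneg hM0 a2
    have b3 := mul_nonneg hM0 a3
    linarith
  calc _ ≤ (2 * ((1 + M) * ω) * (‖u‖ + ‖k‖ + ‖v‖)) ^ 2 :=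
        pow_le_pow_left₀ (norm_nonneg _) h3 2
    _ = 4 * (1 + M) ^ 2 * ω ^ 2 * (‖u‖ + ‖k‖ + ‖v‖) ^ 2 := by ring
    _ ≤ 4 * (1 + M) ^ 2 * ω ^ 2 * (3 * modeSq u v k) := by
        gcongr
        unfold modeSq
        nlinarith [sq_nonneg (‖u‖ - ‖k‖), sq_nonneg (‖u‖ - ‖v‖), sq_nonneg (‖k‖ - ‖v‖)]
    _ = _ := by ring

theorem norm_le_of_coords {y : Fin 3 → ℂ} {B M : ℝ} {z : ℂ} (hM : ‖z‖ ≤ M) (hB : 0 ≤ B)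
    (h0 : ‖y 0‖ ≤ B) (h1 : ‖y 1‖ ≤ B) (h2 : ‖z * y 1 + y 2‖ ≤ B) : ‖y‖ ≤ (1 + M) * B := by
  have hM0 : 0 ≤ M := (norm_nonneg z).trans hM
  have hMB := mul_nonneg hM0 hB
  refine (pi_norm_le_iff_of_nonneg (by positivity)).2 fun i => ?_
  fin_cases i
  · show ‖y 0‖ ≤ _
    linarith
  · show ‖y 1‖ ≤ _
    linarith
  · show ‖y 2‖ ≤ _
    have : y 2 = (z * y 1 + y 2) - z * y 1 := by ring
    rw [this]
    refine (norm_sub_le _ _).trans ?_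
    rw [norm_mul]
    have := mul_le_mul hM h1 (norm_nonneg _) hM0
    linarith

/-- An unstable mode, normalized by its first component at `x₀`. -/
noncomputable def normalized (x₀ : ℝ) (W : ℝ → Fin 3 → ℂ) (x : ℝ) : Fin 3 → ℂ :=
  (W x₀ 0)⁻¹ • W x

theorem normalized_apply (x₀ : ℝ) (W : ℝ → Fin 3 → ℂ) (x : ℝ) (i : Fin 3) :
    normalized x₀ W x i = (W x₀ 0)⁻¹ * W x i := rfl

theorem Solves.normalized {A : ℝ → Matrix (Fin 3) (Fin 3) ℂ} {W : ℝ → Fin 3 → ℂ}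
    (h : Solves A W) (x₀ : ℝ) : Solves A (normalized x₀ W) := fun x => by
  refine ((h x).const_smul (W x₀ 0)⁻¹).congr_deriv ?_
  rw [← Matrix.mulVec_smul]; rfl

theorem modeSq_smul (c u v k : ℂ) :
    modeSq (c * u) (c * v) (c * k) = ‖c‖ ^ 2 * modeSq u v k := by
  unfold modeSq; simp only [norm_mul]; ring

namespace ModeFamily
variable {V g V₀ g₀ : ℝ → ℝ} {G τ x₀ x₁ M κ ω : ℝ} {W W₀ : ℂ → ℝ → Fin 3 → ℂ}

theorem fastDecay (h : ModeFamily V g G W) (hVg : NearEnd V g τ x₀)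
    (hτ : τ * (2 + M) ≤ 1 / 200) (hκ : 0 < κ) (hκM : κ * (2 + M) ≤ 1 / 200) {z : ℂ}
    (hz : z ∈ closedRHP) (hM : ‖z‖ ≤ M) :
    FastDecay (fun x => W z x 0) (fun x => W z x 1) (fun x => z * W z x 1 + W z x 2) := by
  refine ⟨17 / κ ^ 2 * ‖W z x₀ 0‖ ^ 2 * Real.exp (-(5 / 4) * x₀), x₀, fun x hx => ?_⟩
  refine (h.modeSq_le hVg hτ hκ hκM hz hM hx).trans (le_of_eq ?_)
  rw [mul_assoc _ (Real.exp _), ← Real.exp_add]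
  ring_nf

theorem modeSq_normalized_le (h : ModeFamily V g G W) (hVg : NearEnd V g τ x₀)
    (hτ : τ * (2 + M) ≤ 1 / 200) (hκ : 0 < κ) (hκM : κ * (2 + M) ≤ 1 / 200) {z : ℂ}
    (hz : z ∈ closedRHP) (hM : ‖z‖ ≤ M) {x : ℝ} (hx : x ≤ x₀) :
    modeSq ((W z x₀ 0)⁻¹ * W z x 0) ((W z x₀ 0)⁻¹ * W z x 1)
      ((W z x₀ 0)⁻¹ * (z * W z x 1 + W z x 2))
      ≤ 17 / κ ^ 2 * Real.exp (5 / 4 * (x - x₀)) := by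
  have hu : ‖W z x₀ 0‖ ≠ 0 := norm_ne_zero_iff.2 (h.u_ne_zero hVg hτ hκ hκM hz hM)
  rw [modeSq_smul, norm_inv]
  have h1 := mul_le_mul_of_nonneg_left (h.modeSq_le hVg hτ hκ hκM hz hM hx)
    (by positivity : 0 ≤ ‖W z x₀ 0‖⁻¹ ^ 2)
  refine h1.trans (le_of_eq ?_)
  field_simp

theorem norm_normalized_le (h : ModeFamily V g G W) (hVg : NearEnd V g τ x₀)
    (hτ : τ * (2 + M) ≤ 1 / 200) (hκ : 0 < κ) (hκM : κ * (2 + M) ≤ 1 / 200) {z : ℂ}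
    (hz : z ∈ closedRHP) (hM : ‖z‖ ≤ M) :
    ‖normalized x₀ (W z) x₀‖ ≤ (1 + M) * (5 / κ) := by
  have h1 := h.modeSq_normalized_le hVg hτ hκ hκM hz hM le_rfl
  simp only [sub_self, mul_zero, Real.exp_zero, mul_one] at h1
  have h2 : (17 : ℝ) / κ ^ 2 ≤ (5 / κ) ^ 2 := by
    rw [div_pow]; gcongr; norm_num
  have h3 := h1.trans h2
  unfold modeSq at h3
  have hpos : 0 ≤ 5 / κ := by positivity
  refine norm_le_of_coords hM hpos ?_ ?_ ?_
  · refine abs_le_of_sq_le_sq' ?_ hpos |>.2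
    rw [normalized_apply]
    nlinarith [sq_nonneg ‖(W z x₀ 0)⁻¹ * W z x₀ 1‖,
      sq_nonneg ‖(W z x₀ 0)⁻¹ * (z * W z x₀ 1 + W z x₀ 2)‖]
  · refine abs_le_of_sq_le_sq' ?_ hpos |>.2
    rw [normalized_apply]
    nlinarith [sq_nonneg ‖(W z x₀ 0)⁻¹ * W z x₀ 0‖,
      sq_nonneg ‖(W z x₀ 0)⁻¹ * (z * W z x₀ 1 + W z x₀ 2)‖]
  · refine abs_le_of_sq_le_sq' ?_ hpos |>.2
    have e : z * normalized x₀ (W z) x₀ 1 + normalized x₀ (W z) x₀ 2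
        = (W z x₀ 0)⁻¹ * (z * W z x₀ 1 + W z x₀ 2) := by
      simp only [normalized_apply]; ring
    rw [e]
    nlinarith [sq_nonneg ‖(W z x₀ 0)⁻¹ * W z x₀ 0‖, sq_nonneg ‖(W z x₀ 0)⁻¹ * W z x₀ 1‖]

/-- The difference decays fast and solves the first system with a forcing of size `ω`, so its cone
form at `x₀` is `O(ω²)`. Its first component vanishes there by normalization, leaving only the
positive terms in `k` and `v`. -/
theorem norm_normalized_sub_le (h : ModeFamily V g G W) (h₀ : ModeFamily V₀ g₀ G W₀)
    (hx₀ : x₀ ≤ 0) (hVg : NearEnd V g τ x₀) (hVg₀ : NearEnd V₀ g₀ τ x₀)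
    (hτ : τ * (2 + M) ≤ 1 / 200) (hκ : 0 < κ) (hκM : κ * (2 + M) ≤ 1 / 200)
    (hω : 0 ≤ ω) (hV : ∀ x ≤ x₀, |V x - V₀ x| ≤ ω * Real.exp (|x| / 16))
    (hg : ∀ x ≤ x₀, |g x - g₀ x| ≤ ω * Real.exp (|x| / 16)) {z : ℂ} (hz : z ∈ closedRHP)
    (hM : ‖z‖ ≤ M) :
    ‖normalized x₀ (W z) x₀ - normalized x₀ (W₀ z) x₀‖
      ≤ (1 + M) * (4000 * (1 + M) / κ ^ 2 * Real.exp (-x₀) * ω) := by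
  have hM0 : 0 ≤ M := (norm_nonneg z).trans hM
  have hκ1 : κ ≤ 1 / 400 := by nlinarith
  have hτ0 : 0 ≤ τ := (abs_nonneg _).trans (hVg x₀ le_rfl).2.2.2
  set c := (W z x₀ 0)⁻¹ with hc
  set c₀ := (W₀ z x₀ 0)⁻¹ with hc₀
  have hu : W z x₀ 0 ≠ 0 := h.u_ne_zero hVg hτ hκ hκM hz hM
  have hu₀ : W₀ z x₀ 0 ≠ 0 := h₀.u_ne_zero hVg₀ hτ hκ hκM hz hM
  have hF := (h.solves z hz).forcedMode.smul_sub_smul (h₀.solves z hz).forcedMode c c₀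
  have hfast := (h.fastDecay hVg hτ hκ hκM hz hM).smul_sub_smul
    (h₀.fastDecay hVg₀ hτ hκ hκM hz hM) c c₀
  set r := 12 * (1 + M) ^ 2 * ω ^ 2 * (17 / κ ^ 2 * Real.exp (-(5 / 4) * x₀)) with hr
  have hE : ∀ x ≤ x₀, ‖((V x : ℂ) - V₀ x) * (z * (c₀ * W₀ z x 0)
      + c₀ * (z * W₀ z x 1 + W₀ z x 2)) - ((g x : ℂ) - g₀ x) * (c₀ * (z * W₀ z x 1 + W₀ z x 2)
        - z * (c₀ * W₀ z x 1))‖ ^ 2 ≤ r * Real.exp (9 / 8 * x) := by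
    intro x hx
    refine (norm_sq_forcing_le hM (hV x hx) (hg x hx)).trans ?_
    have h1 := h₀.modeSq_normalized_le hVg₀ hτ hκ hκM hz hM hx
    have h2 := mul_le_mul_of_nonneg_left h1
      (by positivity : 0 ≤ 12 * (1 + M) ^ 2 * (ω * Real.exp (|x| / 16)) ^ 2)
    refine h2.trans (le_of_eq ?_)
    rw [abs_of_nonpos (hx.trans hx₀), hr]
    -- The squared weight `exp (|x| / 16)` costs `1/8`, leaving `5/4 - 1/8 = 9/8 > 1`, as the forced
    -- cone estimate demands.
    have e1 : Real.exp (-x / 16) ^ 2 * Real.exp (5 / 4 * (x - x₀))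
        = Real.exp (-(5 / 4) * x₀) * Real.exp (9 / 8 * x) := by
      rw [← Real.exp_nat_mul, ← Real.exp_add, ← Real.exp_add]
      congr 1
      push_cast
      ring
    calc _ = 12 * (1 + M) ^ 2 * ω ^ 2 * (17 / κ ^ 2)
          * (Real.exp (-x / 16) ^ 2 * Real.exp (5 / 4 * (x - x₀))) := by ring
      _ = _ := by rw [e1]; ring
  have hcone := hF.coneForm_le (κ := κ) hVg hz hM (by nlinarith) hκ.le (by nlinarith) hE hfast le_rfl
  have hu0 : c * W z x₀ 0 - c₀ * W₀ z x₀ 0 = 0 := by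
    rw [hc, hc₀, inv_mul_cancel₀ hu, inv_mul_cancel₀ hu₀, sub_self]
  set B := 4000 * (1 + M) / κ ^ 2 * Real.exp (-x₀) * ω with hB
  have hB0 : 0 ≤ B := by positivity
  have hrB : 1600 * r * Real.exp (9 / 8 * x₀) ≤ κ * B ^ 2 := by
    have e1 : Real.exp (-(5 / 4) * x₀) * Real.exp (9 / 8 * x₀) ≤ Real.exp (-x₀) ^ 2 := by
      rw [← Real.exp_nat_mul, ← Real.exp_add]
      apply Real.exp_le_exp.2
      push_cast
      linarith
    have e2 : κ * B ^ 2 = 16000000 * (1 + M) ^ 2 / κ ^ 3 * Real.exp (-x₀) ^ 2 * ω ^ 2 := by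
      rw [hB]; field_simp; ring
    have e3 : 1600 * 12 * 17 * (1 + M) ^ 2 / κ ^ 2 ≤ 16000000 * (1 + M) ^ 2 / κ ^ 3 := by
      rw [div_le_div_iff₀ (by positivity) (by positivity)]
      have : κ ^ 3 = κ * κ ^ 2 := by ring
      rw [this]
      have hp : 0 ≤ (1 + M) ^ 2 * κ ^ 2 := by positivity
      nlinarith
    calc _ = 1600 * 12 * 17 * (1 + M) ^ 2 / κ ^ 2
          * (Real.exp (-(5 / 4) * x₀) * Real.exp (9 / 8 * x₀)) * ω ^ 2 := by rw [hr]; ring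
      _ ≤ 16000000 * (1 + M) ^ 2 / κ ^ 3 * Real.exp (-x₀) ^ 2 * ω ^ 2 := by gcongr
      _ = _ := e2.symm
  have h1 := hcone.trans hrB
  simp only [hu0, coneForm, norm_zero, star_zero, mul_zero, Complex.zero_re] at h1
  have hv : ‖c * W z x₀ 1 - c₀ * W₀ z x₀ 1‖ ≤ B := by
    refine abs_le_of_sq_le_sq' ?_ hB0 |>.2
    have := sq_nonneg ‖c * (z * W z x₀ 1 + W z x₀ 2) - c₀ * (z * W₀ z x₀ 1 + W₀ z x₀ 2)‖
    have := mul_nonneg hκ.le this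
    nlinarith [sq_nonneg B]
  have hk : ‖c * (z * W z x₀ 1 + W z x₀ 2) - c₀ * (z * W₀ z x₀ 1 + W₀ z x₀ 2)‖ ≤ B := by
    refine abs_le_of_sq_le_sq' ?_ hB0 |>.2
    have := sq_nonneg ‖c * W z x₀ 1 - c₀ * W₀ z x₀ 1‖
    refine le_of_mul_le_mul_left ?_ hκ
    linarith
  refine norm_le_of_coords hM hB0 ?_ ?_ ?_
  · simp only [Pi.sub_apply, normalized_apply]
    rw [← hc, ← hc₀, hu0, norm_zero]
    exact hB0
  · simpa only [Pi.sub_apply, normalized_apply] using hv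
  · convert hk using 2
    simp only [Pi.sub_apply, normalized_apply]
    ring

end ModeFamily

theorem norm_coeffMatrix_sub_mulVec_le {V g V₀ g₀ ω M : ℝ} {z : ℂ} (hM : ‖z‖ ≤ M)
    (hV : |V - V₀| ≤ ω) (hg : |g - g₀| ≤ ω) (y : Fin 3 → ℂ) :
    ‖(coeffMatrix V (V - g) z).mulVec y - (coeffMatrix V₀ (V₀ - g₀) z).mulVec y‖
      ≤ (2 * M + 2) * ω * ‖y‖ := by
  have hM0 : 0 ≤ M := (norm_nonneg z).trans hM
  have hω : 0 ≤ ω := (abs_nonneg _).trans hV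
  refine (pi_norm_le_iff_of_nonneg (by positivity)).2 fun i => ?_
  have h0 := norm_le_pi_norm y 0
  have h1 := norm_le_pi_norm y 1
  have h2 := norm_le_pi_norm y 2
  have hV' : ‖(V : ℂ) - V₀‖ ≤ ω := by
    rw [← Complex.ofReal_sub, Complex.norm_real]; exact hV
  have hg' : ‖(g : ℂ) - g₀‖ ≤ ω := by
    rw [← Complex.ofReal_sub, Complex.norm_real]; exact hg
  fin_cases i
  · have : ((coeffMatrix V (V - g) z).mulVec y - (coeffMatrix V₀ (V₀ - g₀) z).mulVec y) 0 = 0 := by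
      simp [coeffMatrix, Matrix.mulVec, dotProduct, Fin.sum_univ_three]
    simp only [Fin.zero_eta, this, norm_zero]
    positivity
  · have : ((coeffMatrix V (V - g) z).mulVec y - (coeffMatrix V₀ (V₀ - g₀) z).mulVec y) 1 = 0 := by
      simp [coeffMatrix, Matrix.mulVec, dotProduct, Fin.sum_univ_three]
    simp only [Fin.mk_one, this, norm_zero]
    positivity
  · have : ((coeffMatrix V (V - g) z).mulVec y - (coeffMatrix V₀ (V₀ - g₀) z).mulVec y) 2
        = z * ((V : ℂ) - V₀) * (y 0 + y 1) + (((V : ℂ) - V₀) - ((g : ℂ) - g₀)) * y 2 := by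
      simp [coeffMatrix, Matrix.mulVec, dotProduct, Fin.sum_univ_three]
      ring
    simp only [Fin.reduceFinMk, this]
    calc _ ≤ ‖z‖ * ‖(V : ℂ) - V₀‖ * (‖y 0‖ + ‖y 1‖)
          + (‖(V : ℂ) - V₀‖ + ‖(g : ℂ) - g₀‖) * ‖y 2‖ := by
          refine (norm_add_le _ _).trans ?_
          rw [norm_mul, norm_mul, norm_mul]
          gcongr
          · exact norm_add_le _ _
          · exact norm_sub_le _ _
      _ ≤ M * ω * (‖y‖ + ‖y‖) + (ω + ω) * ‖y‖ := by gcongr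
      _ = _ := by ring

/-- Normalized unstable modes of two nearby systems are close at any fixed place. -/
theorem ModeFamily.exists_norm_normalized_sub_le (G M κ x₀ x₁ : ℝ) (hG : 0 ≤ G) (hM0 : 0 ≤ M)
    (hκ : 0 < κ) (hκM : κ * (2 + M) ≤ 1 / 200) (hx₀ : x₀ ≤ 0) (hx₁ : x₀ ≤ x₁) :
    ∃ C : ℝ, 0 ≤ C ∧ ∀ (V g V₀ g₀ : ℝ → ℝ) (W W₀ : ℂ → ℝ → Fin 3 → ℂ) (τ ω : ℝ) (z : ℂ),
      ModeFamily V g G W → ModeFamily V₀ g₀ G W₀ → NearEnd V g τ x₀ → NearEnd V₀ g₀ τ x₀ →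
      τ * (2 + M) ≤ 1 / 200 → 0 ≤ ω → (∀ x ≤ x₁, |V x - V₀ x| ≤ ω * Real.exp (|x| / 16)) →
      (∀ x ≤ x₁, |g x - g₀ x| ≤ ω * Real.exp (|x| / 16)) → z ∈ closedRHP → ‖z‖ ≤ M →
      ‖normalized x₀ (W z) x₁ - normalized x₀ (W₀ z) x₁‖ ≤ C * ω := by
  set K := 3 * M + G + 1 with hK
  have hK0 : 0 < K := by positivity
  set C₁ := (1 + M) * (4000 * (1 + M) / κ ^ 2 * Real.exp (-x₀)) with hC₁
  set B := (1 + M) * (5 / κ) * Real.exp (K * (x₁ - x₀)) with hB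
  set C₂ := (2 * M + 2) * Real.exp ((|x₀| + |x₁|) / 16) * B with hC₂
  have he : 1 ≤ Real.exp (K * (x₁ - x₀)) :=
    Real.one_le_exp (mul_nonneg hK0.le (by linarith))
  refine ⟨C₁ * Real.exp (K * (x₁ - x₀)) + C₂ / K * (Real.exp (K * (x₁ - x₀)) - 1),
    by have : 0 ≤ Real.exp (K * (x₁ - x₀)) - 1 := by linarith
       positivity, ?_⟩
  intro V g V₀ g₀ W W₀ τ ω z h h₀ hVg hVg₀ hτ hω hV hg hz hM
  have hs := (h.solves z hz).normalized x₀
  have hs₀ := (h₀.solves z hz).normalized x₀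
  have hinit : ‖normalized x₀ (W z) x₀ - normalized x₀ (W₀ z) x₀‖ ≤ C₁ * ω := by
    refine (h.norm_normalized_sub_le h₀ hx₀ hVg hVg₀ hτ hκ hκM hω
      (fun x hx => hV x (hx.trans hx₁)) (fun x hx => hg x (hx.trans hx₁)) hz hM).trans
      (le_of_eq ?_)
    rw [hC₁]; ring
  have hbound : ∀ x ∈ Set.Icc x₀ x₁, ‖normalized x₀ (W₀ z) x‖ ≤ B := by
    intro x hx
    have h1 := norm_le_exp_of_norm_deriv_le hs₀ (fun t => h₀.norm_deriv_le hM t _) x₀ x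
    refine h1.trans ?_
    rw [abs_of_nonneg (by linarith [hx.1])]
    have h2 := h₀.norm_normalized_le hVg₀ hτ hκ hκM hz hM
    have h3 : x ≤ x₁ := hx.2
    rw [hB]
    gcongr
  have hg := norm_le_of_norm_deriv_le (K := K) (ε := C₂ * ω) hx₁ (fun x => (hs x).sub (hs₀ x))
    (fun x hx => by
      have h1 := norm_coeffMatrix_sub_mulVec_le hM (hV x hx.2) (hg x hx.2)
        (normalized x₀ (W₀ z) x)
      have h2 := h.norm_deriv_le hM x (normalized x₀ (W z) x - normalized x₀ (W₀ z) x)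
      rw [Matrix.mulVec_sub] at h2
      have h3 : ω * Real.exp (|x| / 16) ≤ ω * Real.exp ((|x₀| + |x₁|) / 16) := by
        gcongr
        exact (abs_le_max_abs_abs hx.1 hx.2).trans
          (max_le_add_of_nonneg (abs_nonneg _) (abs_nonneg _))
      have h4 : (2 * M + 2) * (ω * Real.exp (|x| / 16)) * ‖normalized x₀ (W₀ z) x‖ ≤ C₂ * ω := by
        calc _ ≤ (2 * M + 2) * (ω * Real.exp ((|x₀| + |x₁|) / 16)) * B := by
              gcongr
              exact hbound x hx
          _ = _ := by rw [hC₂]; ring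
      have h5 := norm_add_le
        ((coeffMatrix (V x) (V x - g x) z).mulVec (normalized x₀ (W z) x)
          - (coeffMatrix (V x) (V x - g x) z).mulVec (normalized x₀ (W₀ z) x))
        ((coeffMatrix (V x) (V x - g x) z).mulVec (normalized x₀ (W₀ z) x)
          - (coeffMatrix (V₀ x) (V₀ x - g₀ x) z).mulVec (normalized x₀ (W₀ z) x))
      rw [sub_add_sub_cancel] at h5
      push_cast at h1 h2 h5 ⊢
      exact h5.trans (add_le_add h2 (h1.trans h4)))
  refine hg.trans ?_
  rw [gronwallBound_of_K_ne_0 hK0.ne']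
  have h1 : ‖normalized x₀ (W z) x₀ - normalized x₀ (W₀ z) x₀‖ * Real.exp (K * (x₁ - x₀))
      ≤ C₁ * ω * Real.exp (K * (x₁ - x₀)) := by gcongr
  calc _ ≤ C₁ * ω * Real.exp (K * (x₁ - x₀))
        + C₂ * ω / K * (Real.exp (K * (x₁ - x₀)) - 1) := add_le_add h1 le_rfl
    _ = _ := by ring

/-! ### The limiting system at `+∞` and its Evans function. -/

section growth
variable {M : ℝ}

/-- Here `w`, `Y`, `U` are the third, second and first components with weights `1`, `1/8`, `b`. The
weights make the couplings within the triangular limit small, and smallness of `V` controls the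
feedback. Any growth rate below that of `exp x` would serve. -/
theorem lim_energy_bound {b V w Y U p q r s : ℝ} (hM0 : 0 ≤ M) (hb : b = 1 / (64 * (1 + M)))
    (hV0 : 0 ≤ V) (hMV : M * V ≤ b / 16) (hw : 0 ≤ w) (hY : 0 ≤ Y) (hU : 0 ≤ U)
    (hp : p ≤ M * V * ((U / b + 8 * Y) * w)) (hq : q ≤ w * (8 * Y))
    (hr : r ≤ M * (8 * Y) * (U / b)) (hs : s ≤ w * (U / b)) :
    2 * p + 2 / 64 * q + 2 * b ^ 2 * (r + s) ≤ 1 / 2 * (w ^ 2 + Y ^ 2 + U ^ 2) := by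
  have hb0 : 0 < b := by rw [hb]; positivity
  have hbM : b * (64 * (1 + M)) = 1 := by rw [hb]; field_simp
  have hb1 : b ≤ 1 / 64 := by nlinarith
  have hbM' : b * M ≤ 1 / 64 := by nlinarith
  have hUw := mul_nonneg hU hw
  have hYw := mul_nonneg hY hw
  have hUY := mul_nonneg hU hY
  have h1 : p ≤ 1 / 16 * (U * w) + 1 / 128 * (Y * w) := by
    calc p ≤ M * V * ((U / b + 8 * Y) * w) := hp
      _ ≤ b / 16 * ((U / b + 8 * Y) * w) := by gcongr
      _ = 1 / 16 * (U * w) + b / 2 * (Y * w) := by field_simp; ring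
      _ ≤ _ := by nlinarith
  have h2 : b ^ 2 * r ≤ 1 / 8 * (U * Y) := by
    calc b ^ 2 * r ≤ b ^ 2 * (M * (8 * Y) * (U / b)) := by gcongr
      _ = 8 * (b * M) * (U * Y) := by field_simp
      _ ≤ _ := by nlinarith
  have h3 : b ^ 2 * s ≤ 1 / 64 * (U * w) := by
    calc b ^ 2 * s ≤ b ^ 2 * (w * (U / b)) := by gcongr
      _ = b * (U * w) := by field_simp
      _ ≤ _ := by nlinarith
  nlinarith [sq_nonneg (U - w), sq_nonneg (Y - w), sq_nonneg (U - Y)]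

section bounds
variable {z : ℂ} {y : ℝ → Fin 3 → ℂ} {x₂ b : ℝ}

theorem lim_transport_le (hM : ‖z‖ ≤ M) (a : ℂ) (c : ℂ) (t : ℝ) :
    (z * limProfile t * a * star c).re ≤ M * limProfile t * (‖a‖ * ‖c‖) := by
  refine ((le_abs_self _).trans (abs_re_mul_star_le _ _)).trans ?_
  rw [norm_mul, norm_mul, Complex.norm_real, Real.norm_of_nonneg (limProfile_pos t).le, mul_assoc]
  have := (limProfile_pos t).le
  gcongr

theorem hasDerivAt_lim_norm_sq
    (hy : Solves (fun x => coeffMatrix (limProfile x) (limProfile x - (1 - limProfile x)) z) y)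
    (t : ℝ) : HasDerivAt (fun t => ‖y t 2‖ ^ 2)
      (2 * ((z * limProfile t * y t 0 * star (y t 2)).re
        + (z * limProfile t * y t 1 * star (y t 2)).re)
        + 2 * (2 * limProfile t - 1 - z.re) * ‖y t 2‖ ^ 2) t := by
  refine (hasDerivAt_norm_sq (hy.hasDerivAt_coord
    (φ := fun x => limProfile x - (1 - limProfile x)) t).2.2).congr_deriv ?_
  rw [← re_mul_star_self]
  simp [Complex.mul_re, Complex.mul_im]
  ring

/-- Energy controlling the growth of solutions of the limiting system. -/
noncomputable def limEnergy (b : ℝ) (y : Fin 3 → ℂ) : ℝ :=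
  ‖y 2‖ ^ 2 + 1 / 64 * ‖y 1‖ ^ 2 + b ^ 2 * ‖y 0‖ ^ 2

theorem limEnergy_le (hM0 : 0 ≤ M) (hb : b = 1 / (64 * (1 + M))) (hz : 0 ≤ z.re) (hM : ‖z‖ ≤ M)
    (hy : Solves (fun x => coeffMatrix (limProfile x) (limProfile x - (1 - limProfile x)) z) y)
    (hV : ∀ x ≥ x₂, (1 + M) * limProfile x ≤ b / 16) {x : ℝ} (hx : x₂ ≤ x) :
    limEnergy b (y x) ≤ limEnergy b (y x₂) * Real.exp (1 / 2 * (x - x₂)) := by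
  have hb0 : 0 < b := by rw [hb]; positivity
  have hbM : b * (64 * (1 + M)) = 1 := by rw [hb]; field_simp
  have hb1 : b ≤ 1 / 64 := by nlinarith
  have hcoord := fun x => hy.hasDerivAt_coord (φ := fun x => limProfile x - (1 - limProfile x)) x
  have hd : ∀ t, HasDerivAt (fun t => limEnergy b (y t)) _ t := fun t =>
    ((hasDerivAt_lim_norm_sq hy t).add ((hasDerivAt_norm_sq (hcoord t).2.1).const_mul (1 / 64))).add
      ((hasDerivAt_norm_sq (hcoord t).1).const_mul (b ^ 2))
  have h1 := exp_weight_le_of_le (θ := 1 / 2) hx hd (fun t ht => by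
    have hVt := hV t ht.1
    have hV0 := limProfile_pos t
    have e0 : b * ‖y t 0‖ / b = ‖y t 0‖ := by field_simp
    have e1 : 8 * (‖y t 1‖ / 8) = ‖y t 1‖ := by ring
    have hbound := lim_energy_bound (V := limProfile t) (w := ‖y t 2‖) (Y := ‖y t 1‖ / 8)
      (U := b * ‖y t 0‖) hM0 hb hV0.le (by nlinarith) (norm_nonneg _) (by positivity)
      (by positivity)
      (p := (z * limProfile t * y t 0 * star (y t 2)).re
        + (z * limProfile t * y t 1 * star (y t 2)).re)
      (q := (y t 2 * star (y t 1)).re) (r := (z * y t 1 * star (y t 0)).re)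
      (s := (y t 2 * star (y t 0)).re)
      (by
        rw [e0, e1]
        linarith [lim_transport_le hM (y t 0) (y t 2) t, lim_transport_le hM (y t 1) (y t 2) t])
      (by rw [e1]; exact (le_abs_self _).trans (abs_re_mul_star_le _ _))
      (by
        rw [e0, e1]
        refine ((le_abs_self _).trans (abs_re_mul_star_le _ _)).trans ?_
        rw [norm_mul]
        gcongr)
      (by rw [e0]; exact (le_abs_self _).trans (abs_re_mul_star_le _ _))
    have hneg : 2 * (2 * limProfile t - 1 - z.re) * ‖y t 2‖ ^ 2 ≤ 0 := by
      have : limProfile t ≤ 1 / 2 := by nlinarith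
      have h2 := sq_nonneg ‖y t 2‖
      nlinarith
    have e3 : ((z * y t 1 + y t 2) * star (y t 0)).re
        = (z * y t 1 * star (y t 0)).re + (y t 2 * star (y t 0)).re := by
      rw [← Complex.add_re, ← add_mul]
    have e4 : (‖y t 1‖ / 8) ^ 2 = 1 / 64 * ‖y t 1‖ ^ 2 := by ring
    have e5 : (b * ‖y t 0‖) ^ 2 = b ^ 2 * ‖y t 0‖ ^ 2 := by ring
    rw [e4, e5] at hbound
    rw [e3]
    unfold limEnergy
    linarith)
  have e1 : Real.exp (-(1 / 2) * x₂) = Real.exp (-(1 / 2) * x) * Real.exp (1 / 2 * (x - x₂)) := by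
    rw [← Real.exp_add]; ring_nf
  rw [e1, mul_assoc] at h1
  have h2 := le_of_mul_le_mul_left h1 (Real.exp_pos _)
  linarith

/-- The damping of the square is at least `3/2`; part of it absorbs the forcing by Young's
inequality and rate 1 remains. -/
theorem lim_last_sq_le (hz : 0 ≤ z.re) (hM : ‖z‖ ≤ M)
    (hy : Solves (fun x => coeffMatrix (limProfile x) (limProfile x - (1 - limProfile x)) z) y)
    (hV : ∀ x ≥ x₂, limProfile x ≤ 1 / 8) {A : ℝ}
    (hA : ∀ x ≥ x₂, M * limProfile x * (‖y x 0‖ + ‖y x 1‖) ≤ A * Real.exp (-(3 / 4) * x)) {x : ℝ}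
    (hx : x₂ ≤ x) :
    Real.exp x * ‖y x 2‖ ^ 2
      ≤ Real.exp x₂ * ‖y x₂ 2‖ ^ 2 + 4 * A ^ 2 * Real.exp (-(1 / 2) * x₂) := by
  have h1 := exp_weight_le (θ := -1) (ω := -(3 / 2)) (r := 2 * A ^ 2)
    (by norm_num) hx (hasDerivAt_lim_norm_sq hy) (fun t ht => by
    have h2 := lim_transport_le hM (y t 0) (y t 2) t
    have h3 := lim_transport_le hM (y t 1) (y t 2) t
    have h4 := mul_le_mul_of_nonneg_right (hA t ht.1) (norm_nonneg (y t 2))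
    have e1 : Real.exp (-(3 / 2) * t) = Real.exp (-(3 / 4) * t) ^ 2 := by
      rw [← Real.exp_nat_mul]; push_cast; ring_nf
    rw [e1]
    have h5 := sq_nonneg (‖y t 2‖ - 2 * (A * Real.exp (-(3 / 4) * t)))
    have h6 : (2 * limProfile t - 1 - z.re) * ‖y t 2‖ ^ 2 ≤ -(3 / 4) * ‖y t 2‖ ^ 2 :=
      mul_le_mul_of_nonneg_right (by linarith [hV t ht.1]) (sq_nonneg _)
    linarith)
  have e1 : (2 * A ^ 2 : ℝ) / (-(3 / 2) - -1) = -(4 * A ^ 2) := by ring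
  have e2 : ∀ t : ℝ, (-(3 / 2) - -1) * t = -(1 / 2) * t := fun t => by ring
  rw [e1, e2, e2] at h1
  have h4 : 0 ≤ 4 * A ^ 2 * Real.exp (-(1 / 2) * x) := by positivity
  simp only [neg_neg, one_mul] at h1
  linarith

end bounds

/-- Growth bounds at `+∞` for solutions of the limiting system. -/
theorem exists_lim_growth (hM0 : 0 ≤ M) (x₀ : ℝ) : ∃ C x₂ : ℝ, 0 ≤ C ∧ x₀ ≤ x₂ ∧
    ∀ (z : ℂ) (y : ℝ → Fin 3 → ℂ), z ∈ closedRHP → ‖z‖ ≤ M →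
      Solves (fun x => coeffMatrix (limProfile x) (limProfile x - (1 - limProfile x)) z) y →
      ∀ x ≥ x₂, ‖y x 0‖ ≤ C * ‖y x₀‖ * Real.exp (x / 4) ∧
        ‖y x 1‖ ≤ C * ‖y x₀‖ * Real.exp (x / 4) ∧ ‖y x 2‖ ≤ C * ‖y x₀‖ * Real.exp (-(x / 2)) := by
  obtain ⟨b, hb⟩ : ∃ b : ℝ, b = 1 / (64 * (1 + M)) := ⟨_, rfl⟩
  have hb0 : 0 < b := by rw [hb]; positivity
  have hbM : b * (64 * (1 + M)) = 1 := by rw [hb]; field_simp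
  have hb1 : b ≤ 1 / 64 := by nlinarith
  obtain ⟨x₁, hx₁⟩ : ∃ x₁ : ℝ, ∀ x ≥ x₁, (1 + M) * Real.exp (-x) ≤ b / 16 := by
    have : Tendsto (fun x : ℝ => (1 + M) * Real.exp (-x)) atTop (𝓝 0) := by
      simpa using (Real.tendsto_exp_neg_atTop_nhds_zero).const_mul (1 + M)
    exact eventually_atTop.1 (this.eventually (ge_mem_nhds (by positivity)))
  obtain ⟨x₂, hx₂⟩ : ∃ x₂ : ℝ, x₂ = max x₀ x₁ := ⟨_, rfl⟩
  have hx₀₂ : x₀ ≤ x₂ := hx₂ ▸ le_max_left _ _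
  have hx₁₂ : x₁ ≤ x₂ := hx₂ ▸ le_max_right _ _
  obtain ⟨L, hL⟩ : ∃ L : ℝ, L = Real.exp ((3 * M + 1 + 1) * (x₂ - x₀)) := ⟨_, rfl⟩
  have hL0 : 0 < L := hL ▸ Real.exp_pos _
  obtain ⟨S, hS⟩ : ∃ S : ℝ, S = 2 * L * Real.exp (-(x₂ / 4)) := ⟨_, rfl⟩
  have hS0 : 0 < S := by rw [hS]; positivity
  obtain ⟨A, hA⟩ : ∃ A : ℝ, A = M * (S / b + 8 * S) := ⟨_, rfl⟩
  have hA0 : 0 ≤ A := by rw [hA]; positivity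
  obtain ⟨Q, hQ⟩ : ∃ Q : ℝ, Q = Real.exp x₂ * L ^ 2 + 4 * A ^ 2 * Real.exp (-(1 / 2) * x₂) :=
    ⟨_, rfl⟩
  have hQ0 : 0 ≤ Q := by rw [hQ]; positivity
  have hSb : 0 ≤ S / b := by positivity
  have hsq := Real.sqrt_nonneg Q
  refine ⟨8 * S + S / b + Real.sqrt Q, x₂, by positivity, hx₀₂, ?_⟩
  intro z y hz hM hy
  obtain ⟨n, hn⟩ : ∃ n : ℝ, n = ‖y x₀‖ := ⟨_, rfl⟩
  rw [← hn]
  have hn0 : 0 ≤ n := hn ▸ norm_nonneg _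
  have hVx : ∀ x ≥ x₂, (1 + M) * limProfile x ≤ b / 16 := fun x hx =>
    (mul_le_mul_of_nonneg_left (limProfile_le_exp x) (by positivity)).trans
      (hx₁ x (hx₁₂.trans hx))
  have hinit : ‖y x₂‖ ≤ n * L := by
    have := norm_le_exp_of_norm_deriv_le hy (fun t =>
      norm_coeffMatrix_mulVec_le (G := 1) (by
        rw [abs_of_pos (limProfile_pos t)]; exact (limProfile_lt_one t).le)
        (by rw [abs_le]; constructor <;> linarith [limProfile_pos t, limProfile_lt_one t]) hM _)
        x₀ x₂
    rwa [abs_of_nonneg (sub_nonneg.2 hx₀₂), ← hL, ← hn] at this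
  have hE : ∀ x ≥ x₂, limEnergy b (y x) ≤ (S * n * Real.exp (x / 4)) ^ 2 := by
    intro x hx
    have h2 : limEnergy b (y x₂) ≤ 4 * (n * L) ^ 2 := by
      have a0 := pow_le_pow_left₀ (norm_nonneg _) ((norm_le_pi_norm (y x₂) 0).trans hinit) 2
      have a1 := pow_le_pow_left₀ (norm_nonneg _) ((norm_le_pi_norm (y x₂) 1).trans hinit) 2
      have a2 := pow_le_pow_left₀ (norm_nonneg _) ((norm_le_pi_norm (y x₂) 2).trans hinit) 2
      have a3 : b ^ 2 * ‖y x₂ 0‖ ^ 2 ≤ (1 / 64) ^ 2 * (n * L) ^ 2 := by gcongr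
      have a4 := sq_nonneg (n * L)
      unfold limEnergy
      linarith
    refine ((limEnergy_le hM0 hb hz hM hy hVx hx).trans
      (mul_le_mul_of_nonneg_right h2 (Real.exp_pos _).le)).trans (le_of_eq ?_)
    have e1 : Real.exp (1 / 2 * (x - x₂)) = Real.exp (-(x₂ / 4)) ^ 2 * Real.exp (x / 4) ^ 2 := by
      rw [← Real.exp_nat_mul, ← Real.exp_nat_mul, ← Real.exp_add]; push_cast; ring_nf
    rw [e1, hS]
    ring
  have hE0 : ∀ x ≥ x₂, ‖y x 0‖ ≤ S / b * n * Real.exp (x / 4) := by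
    intro x hx
    have h1 : b * ‖y x 0‖ ≤ S * n * Real.exp (x / 4) := by
      refine abs_le_of_sq_le_sq' ?_ (by positivity) |>.2
      have := hE x hx
      unfold limEnergy at this
      rw [mul_pow]
      linarith [sq_nonneg ‖y x 2‖, sq_nonneg ‖y x 1‖]
    have e : S / b * n * Real.exp (x / 4) = S * n * Real.exp (x / 4) / b := by ring
    rw [e, le_div_iff₀ hb0]
    linarith
  have hE1 : ∀ x ≥ x₂, ‖y x 1‖ ≤ 8 * S * n * Real.exp (x / 4) := by
    intro x hx
    have h1 : 1 / 8 * ‖y x 1‖ ≤ S * n * Real.exp (x / 4) := by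
      refine abs_le_of_sq_le_sq' ?_ (by positivity) |>.2
      have := hE x hx
      unfold limEnergy at this
      rw [mul_pow]
      have h2 : 0 ≤ b ^ 2 * ‖y x 0‖ ^ 2 := by positivity
      norm_num at this ⊢
      linarith [sq_nonneg ‖y x 2‖]
    linarith
  intro x hx
  refine ⟨(hE0 x hx).trans ?_, (hE1 x hx).trans ?_, ?_⟩
  · gcongr
    linarith
  · gcongr
    linarith
  · have h3 := lim_last_sq_le (A := A * n) hz hM hy (fun t ht => by
        have := limProfile_pos t
        have := hVx t ht
        nlinarith)
      (fun t ht => by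
        have hV := limProfile_le_exp t
        have hV0 := (limProfile_pos t).le
        calc _ ≤ M * Real.exp (-t) * (S / b * n * Real.exp (t / 4)
              + 8 * S * n * Real.exp (t / 4)) := by
              gcongr
              · exact hE0 t ht
              · exact hE1 t ht
          _ = A * n * (Real.exp (-t) * Real.exp (t / 4)) := by rw [hA]; ring
          _ = _ := by rw [← Real.exp_add]; ring_nf) hx
    have h2 := pow_le_pow_left₀ (norm_nonneg _) ((norm_le_pi_norm (y x₂) 2).trans hinit) 2
    have h5 := mul_le_mul_of_nonneg_left h2 (Real.exp_pos x₂).le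
    have h6 : Real.exp x * ‖y x 2‖ ^ 2 ≤ Q * n ^ 2 := by
      have : Q * n ^ 2 = Real.exp x₂ * (n * L) ^ 2
        + 4 * (A * n) ^ 2 * Real.exp (-(1 / 2) * x₂) := by rw [hQ]; ring
      rw [this]
      linarith
    have h4 : ‖y x 2‖ ≤ Real.sqrt Q * n * Real.exp (-(x / 2)) := by
      refine abs_le_of_sq_le_sq' ?_ (by positivity) |>.2
      rw [mul_pow, mul_pow, Real.sq_sqrt hQ0]
      have e3 : Real.exp (-(x / 2)) ^ 2 = (Real.exp x)⁻¹ := by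
        rw [← Real.exp_nat_mul, ← Real.exp_neg]; push_cast; ring_nf
      rw [e3, ← div_eq_mul_inv, le_div_iff₀ (Real.exp_pos x)]
      linarith
    refine h4.trans ?_
    gcongr
    linarith

end growth

theorem norm_sub_lim_le {f f' : ℝ → ℂ} {B s X : ℝ} {l : ℂ} (hs : 0 < s)
    (hf : ∀ x, HasDerivAt f (f' x) x) (hB : ∀ x ≥ X, ‖f' x‖ ≤ B * Real.exp (-(s * x)))
    (hl : Tendsto f atTop (𝓝 l)) {x : ℝ} (hx : X ≤ x) :
    ‖f x - l‖ ≤ B / s * Real.exp (-(s * x)) := by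
  have h1 : ∀ y ≥ x, ‖f x - f y‖ ≤ B / s * Real.exp (-(s * x)) := by
    intro y hy
    have hB0 : 0 ≤ B := by
      have := (norm_nonneg _).trans (hB x hx)
      exact nonneg_of_mul_nonneg_left this (Real.exp_pos _)
    have h2 := norm_sub_le_of_hasDerivAt (φ := fun t => B / s * Real.exp (-s * t))
      (φ' := fun t => B / s * (-s * Real.exp (-s * t))) hy hf
      (fun t => (hasDerivAt_exp_mul (-s) t).const_mul _) (fun t ht => by
        refine (hB t (hx.trans ht.1)).trans (le_of_eq ?_)
        field_simp)
    rw [norm_sub_rev]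
    refine h2.trans ?_
    have : 0 ≤ B / s * Real.exp (-s * y) := by positivity
    rw [neg_mul] at this ⊢
    rw [neg_mul]
    linarith
  exact le_of_tendsto ((tendsto_const_nhds.sub hl).norm) (eventually_atTop.2 ⟨x, h1⟩)

theorem tendsto_limProfile_atTop : Tendsto limProfile atTop (𝓝 0) :=
  tendsto_of_tendsto_of_tendsto_of_le_of_le tendsto_const_nhds
    Real.tendsto_exp_neg_atTop_nhds_zero (fun x => (limProfile_pos x).le) limProfile_le_exp

theorem tendsto_exp_neg_mul {c : ℝ} (hc : 0 < c) :
    Tendsto (fun x : ℝ => Real.exp (-(c * x))) atTop (𝓝 0) := by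
  simpa [Function.comp_def] using
    Real.tendsto_exp_neg_atTop_nhds_zero.comp (tendsto_id.const_mul_atTop hc)

/-- The limiting Evans function is the limit at `+∞` of the second component of the unstable
mode. -/
theorem tendsto_limEvans {W Y : ℝ → Fin 3 → ℂ} {z : ℂ} (hz : z ∈ closedRHP)
    (hW : Solves (fun x => matA0 x z) W) (hY : SolvesAdjoint (fun x => matA0 x z) Y)
    (hlim : Tendsto Y atTop (𝓝 (limDualVector z))) :
    Tendsto (fun x => W x 1) atTop (𝓝 (dotProduct (star (Y 0)) (W 0))) := by
  simp only [matA0_eq] at hW hY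
  obtain ⟨C, x₂, hC0, -, hC⟩ := exists_lim_growth (norm_nonneg z) 0
  have hg := hC z W hz le_rfl hW
  set A := C * ‖W 0‖ with hA
  have hA0 : 0 ≤ A := by positivity
  have hcoord := fun x => hY.hasDerivAt_coord (φ := fun x => limProfile x - (1 - limProfile x)) x
  have l0 : Tendsto (fun x => star (Y x 0)) atTop (𝓝 0) := by
    simpa [limDualVector] using ((tendsto_pi_nhds.1 hlim) 0).star
  have l1 : Tendsto (fun x => star (Y x 1)) atTop (𝓝 1) := by
    simpa [limDualVector] using ((tendsto_pi_nhds.1 hlim) 1).star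
  have l2 := ((tendsto_pi_nhds.1 hlim) 2).norm
  set B := ‖limDualVector z 2‖ + 1 with hBdef
  have hB0 : 0 < B := by positivity
  obtain ⟨X, hX⟩ := eventually_atTop.1
    (l2.eventually (ge_mem_nhds (show ‖limDualVector z 2‖ < B by rw [hBdef]; linarith)))
  have hstar : ∀ x ≥ X, ‖star (Y x 2)‖ ≤ B := fun x hx => by rw [norm_star]; exact hX x hx
  have hflux : ∀ x ≥ X, ‖z * limProfile x * star (Y x 2)‖ ≤ ‖z‖ * B * Real.exp (-(1 * x)) := by
    intro x hx
    rw [norm_mul, norm_mul, Complex.norm_real, Real.norm_of_nonneg (limProfile_pos x).le, one_mul]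
    calc _ ≤ ‖z‖ * Real.exp (-x) * B := by
          gcongr
          · exact limProfile_le_exp x
          · exact hstar x hx
      _ = _ := by ring
  have h0 : ∀ x ≥ X, ‖star (Y x 0)‖ ≤ ‖z‖ * B * Real.exp (-(1 * x)) := by
    intro x hx
    have := norm_sub_lim_le one_pos (fun x => (hcoord x).1)
      (fun x hx => by rw [norm_neg]; exact hflux x hx) l0 hx
    simpa using this
  have h1 : ∀ x ≥ X, ‖star (Y x 1) - 1‖ ≤ (‖z‖ * (‖z‖ * B) + ‖z‖ * B) * Real.exp (-(1 * x)) := by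
    intro x hx
    have := norm_sub_lim_le one_pos (fun x => (hcoord x).2.1)
      (B := ‖z‖ * (‖z‖ * B) + ‖z‖ * B)
      (fun x hx => by
        refine (norm_sub_le _ _).trans ?_
        rw [norm_neg, norm_mul, add_mul, mul_assoc ‖z‖ (‖z‖ * B)]
        exact add_le_add (mul_le_mul_of_nonneg_left (h0 x hx) (norm_nonneg _)) (hflux x hx))
      l1 hx
    simpa using this
  have hD := fun x => dotProduct_star_const (φ := fun x => limProfile x - (1 - limProfile x))
    hW hY 0 x
  rw [tendsto_iff_norm_sub_tendsto_zero]
  -- The first two dual components reach their limits at rate `exp (-x)`, beating the growth `exp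
  -- (x/4)` of the mode; the third is bounded and meets a component decaying like `exp (-x/2)`.
  have hlimB : Tendsto (fun x : ℝ => (‖z‖ * B * A + (‖z‖ * (‖z‖ * B) + ‖z‖ * B) * A)
      * Real.exp (-(3 / 4 * x)) + B * A * Real.exp (-(1 / 2 * x))) atTop (𝓝 0) := by
    simpa using ((tendsto_exp_neg_mul (by norm_num : (0 : ℝ) < 3 / 4)).const_mul _).add
      ((tendsto_exp_neg_mul (by norm_num : (0 : ℝ) < 1 / 2)).const_mul (B * A))
  refine squeeze_zero' (Eventually.of_forall fun _ => norm_nonneg _) ?_ hlimB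
  filter_upwards [eventually_ge_atTop X, eventually_ge_atTop x₂] with x hx hx'
  obtain ⟨g0, g1, g2⟩ := hg x hx'
  rw [hD x, norm_sub_rev]
  have e1 : dotProduct (star (Y x)) (W x) - W x 1
      = star (Y x 0) * W x 0 + (star (Y x 1) - 1) * W x 1 + star (Y x 2) * W x 2 := by
    simp only [dotProduct, Fin.sum_univ_three, Pi.star_apply]; ring
  have e2 : Real.exp (-(3 / 4 * x)) = Real.exp (-(1 * x)) * Real.exp (x / 4) := by
    rw [← Real.exp_add]; ring_nf
  have e3 : Real.exp (-(1 / 2 * x)) = Real.exp (-(x / 2)) := by ring_nf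
  rw [e1, e2, e3]
  refine (norm_add₃_le).trans ?_
  rw [norm_mul, norm_mul, norm_mul]
  calc _ ≤ ‖z‖ * B * Real.exp (-(1 * x)) * (A * Real.exp (x / 4))
        + (‖z‖ * (‖z‖ * B) + ‖z‖ * B) * Real.exp (-(1 * x)) * (A * Real.exp (x / 4))
        + B * (A * Real.exp (-(x / 2))) := by
        gcongr
        · exact h0 x hx
        · exact h1 x hx
        · exact hstar x hx
    _ = _ := by ring

/-- At `z = 0` the limiting unstable mode is explicit and the limiting Evans function does not
vanish. -/
theorem limEvans_zero_ne_zero {W : ℝ → Fin 3 → ℂ} {l : ℂ}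
    (hW : Solves (fun x => matA0 x 0) W) (hne : W 0 ≠ 0) (hdec : Tendsto W atBot (𝓝 0))
    (hl : Tendsto (fun x => W x 1) atTop (𝓝 l)) : l ≠ 0 := by
  simp only [matA0_eq] at hW
  have hcoord := fun x => hW.hasDerivAt_coord (φ := fun x => limProfile x - (1 - limProfile x)) x
  simp only [zero_mul, zero_add, sub_zero] at hcoord
  have hV : ∀ x, HasDerivAt (fun t => (limProfile t : ℂ))
      ((limProfile x * (limProfile x - 1) : ℝ) : ℂ) x :=
    fun x => (hasDerivAt_limProfile x).ofReal_comp
  -- This is the derivative of the limiting profile `V₀`, which solves the scalar equation of the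
  -- third component at `z = 0`. Decay at `-∞` then forces the mode to be `c (V₀ - 1, V₀ - 1, V₀')`.
  set p : ℝ → ℂ := fun x => ((limProfile x * (limProfile x - 1) : ℝ) : ℂ) with hp
  have hpd : ∀ x, HasDerivAt p
      (((limProfile x - (1 - limProfile x) : ℝ) : ℂ) * p x) x := by
    intro x
    have := ((hasDerivAt_limProfile x).mul ((hasDerivAt_limProfile x).sub_const 1)).ofReal_comp
    refine this.congr_deriv ?_
    simp only [hp]
    push_cast
    ring
  have hp0 : p 0 ≠ 0 := by
    simp only [hp]
    have h1 := limProfile_pos 0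
    have h2 := limProfile_lt_one 0
    exact_mod_cast mul_ne_zero h1.ne' (by linarith)
  set c := W 0 2 / p 0 with hc
  have h2 : ∀ x, W x 2 = c * p x := by
    intro x
    have := eq_zero_of_norm_deriv_le (f := fun t => W t 2 - c * p t) (K := 1)
      (fun t => (hcoord t).2.2.sub ((hpd t).const_mul c)) (fun t => by
        have e : ((limProfile t - (1 - limProfile t) : ℝ) : ℂ) * W t 2
            - c * (((limProfile t - (1 - limProfile t) : ℝ) : ℂ) * p t)
            = ((limProfile t - (1 - limProfile t) : ℝ) : ℂ) * (W t 2 - c * p t) := by ring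
        rw [e, norm_mul, Complex.norm_real]
        gcongr
        rw [Real.norm_eq_abs, abs_le]
        constructor <;> linarith [limProfile_pos t, limProfile_lt_one t])
      (a := 0) (by simp only [hc]; field_simp; ring) x
    exact sub_eq_zero.1 this
  have hcomp : ∀ i : Fin 3, (∀ x, HasDerivAt (fun t => W t i) (W x 2) x) →
      ∀ x, W x i = c * (limProfile x - 1) := by
    intro i hi x
    have hd : ∀ t, HasDerivAt (fun t => W t i - c * limProfile t) 0 t := fun t =>
      ((hi t).sub ((hV t).const_mul c)).congr_deriv (by rw [h2 t]; simp only [hp]; ring)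
    have hconst : ∀ a, W a i - c * limProfile a = W x i - c * limProfile x := fun a =>
      is_const_of_deriv_eq_zero (fun t => (hd t).differentiableAt) (fun t => (hd t).deriv) a x
    have hlim : Tendsto (fun a => W a i - c * limProfile a) atBot (𝓝 (0 - c * 1)) := by
      have hVc : Tendsto (fun a => (limProfile a : ℂ)) atBot (𝓝 1) := by
        simpa [Function.comp_def] using (Complex.continuous_ofReal.tendsto 1).comp tendsto_limProfile_atBot
      exact (tendsto_coord hdec i).sub (hVc.const_mul c)
    have hlim2 : Tendsto (fun a => W a i - c * limProfile a) atBot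
        (𝓝 (W x i - c * limProfile x)) := by
      simp only [hconst]; exact tendsto_const_nhds
    have := tendsto_nhds_unique hlim2 hlim
    linear_combination this
  intro hl0
  have h1 := hcomp 1 (fun x => (hcoord x).2.1)
  have h0 := hcomp 0 (fun x => (hcoord x).1)
  have hlim : Tendsto (fun x => W x 1) atTop (𝓝 (c * (0 - 1))) := by
    have hVc : Tendsto (fun a => (limProfile a : ℂ)) atTop (𝓝 0) := by
      simpa [Function.comp_def] using (Complex.continuous_ofReal.tendsto 0).comp tendsto_limProfile_atTop
    simp only [h1]
    exact (hVc.sub_const 1).const_mul c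
  have hc0 : c = 0 := by
    have := tendsto_nhds_unique hl hlim
    rw [hl0] at this
    linear_combination this
  apply hne
  funext i
  fin_cases i
  · simp [h0, hc0]
  · simp [h1, hc0]
  · simp [h2, hc0]

/-! ### Uniform convergence and holomorphy in `z` of the normalized limiting Evans function. -/

section limit
variable {G τ x₀ M κ : ℝ} {W : ℂ → ℝ → Fin 3 → ℂ} {D₀ : ℂ → ℂ}

/-- Uniform convergence of the normalized second component to the normalized limiting Evans
function. -/
theorem exists_norm_normalized_sub_limEvans_le
    (h : ModeFamily limProfile (fun x => 1 - limProfile x) G W)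
    (hVg : NearEnd limProfile (fun x => 1 - limProfile x) τ x₀)
    (hτ : τ * (2 + M) ≤ 1 / 200) (hκ : 0 < κ) (hκM : κ * (2 + M) ≤ 1 / 200) (hM0 : 0 ≤ M)
    (hD : ∀ z ∈ closedRHP, Tendsto (fun x => W z x 1) atTop (𝓝 (D₀ z))) :
    ∃ C x₂ : ℝ, 0 ≤ C ∧ x₀ ≤ x₂ ∧ ∀ z ∈ closedRHP, ‖z‖ ≤ M → ∀ x ≥ x₂,
      ‖normalized x₀ (W z) x 0‖ ≤ C * Real.exp (x / 4) ∧
      ‖normalized x₀ (W z) x 1‖ ≤ C * Real.exp (x / 4) ∧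
      ‖normalized x₀ (W z) x 2‖ ≤ C * Real.exp (-(x / 2)) ∧
      ‖normalized x₀ (W z) x 1 - D₀ z / W z x₀ 0‖ ≤ C * Real.exp (-(x / 2)) := by
  obtain ⟨C, x₂, hC0, hx₂, hC⟩ := exists_lim_growth hM0 x₀
  set B := (1 + M) * (5 / κ) with hB
  have hB0 : 0 ≤ B := by positivity
  refine ⟨2 * (C * B), x₂, by positivity, hx₂, fun z hz hM x hx => ?_⟩
  have hs := (h.solves z hz).normalized x₀
  have hn := h.norm_normalized_le hVg hτ hκ hκM hz hM
  have hg : ∀ x ≥ x₂, ‖normalized x₀ (W z) x 0‖ ≤ C * B * Real.exp (x / 4) ∧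
      ‖normalized x₀ (W z) x 1‖ ≤ C * B * Real.exp (x / 4) ∧
      ‖normalized x₀ (W z) x 2‖ ≤ C * B * Real.exp (-(x / 2)) := by
    intro x hx
    obtain ⟨h0, h1, h2⟩ := hC z _ hz hM hs x hx
    refine ⟨h0.trans ?_, h1.trans ?_, h2.trans ?_⟩ <;> gcongr
  have hCB : 0 ≤ C * B := by positivity
  obtain ⟨h0, h1, h2⟩ := hg x hx
  have e4 := Real.exp_pos (x / 4)
  have e2 := Real.exp_pos (-(x / 2))
  refine ⟨by nlinarith [mul_nonneg hCB e4.le], by nlinarith [mul_nonneg hCB e4.le],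
    by nlinarith [mul_nonneg hCB e2.le], ?_⟩
  have hlim : Tendsto (fun x => normalized x₀ (W z) x 1) atTop (𝓝 (D₀ z / W z x₀ 0)) := by
    rw [div_eq_inv_mul]
    exact (hD z hz).const_mul _
  have := norm_sub_lim_le (s := 1 / 2) (B := C * B) (by norm_num)
    (fun x => (hs.hasDerivAt_coord (φ := fun x => limProfile x - (1 - limProfile x)) x).2.1)
    (fun t ht => by
      have := (hg t ht).2.2
      rwa [show -(t / 2) = -(1 / 2 * t) by ring] at this) hlim hx
  refine this.trans (le_of_eq ?_)
  rw [show -(1 / 2 * x) = -(x / 2) by ring]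
  ring

theorem tendstoUniformlyOn_limEvans
    (h : ModeFamily limProfile (fun x => 1 - limProfile x) G W)
    (hVg : NearEnd limProfile (fun x => 1 - limProfile x) τ x₀)
    (hτ : τ * (2 + M) ≤ 1 / 200) (hκ : 0 < κ) (hκM : κ * (2 + M) ≤ 1 / 200) (hM0 : 0 ≤ M)
    (hD : ∀ z ∈ closedRHP, Tendsto (fun x => W z x 1) atTop (𝓝 (D₀ z))) :
    TendstoUniformlyOn (fun (x : ℝ) z => normalized x₀ (W z) x 1) (fun z => D₀ z / W z x₀ 0)
      atTop {z | z ∈ closedRHP ∧ ‖z‖ ≤ M} := by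
  obtain ⟨C, x₂, hC0, -, hC⟩ := exists_norm_normalized_sub_limEvans_le h hVg hτ hκ hκM hM0 hD
  rw [Metric.tendstoUniformlyOn_iff]
  intro ε hε
  have hlim : Tendsto (fun x : ℝ => C * Real.exp (-(1 / 2 * x))) atTop (𝓝 0) := by
    simpa using (tendsto_exp_neg_mul (by norm_num : (0 : ℝ) < 1 / 2)).const_mul C
  filter_upwards [eventually_ge_atTop x₂, hlim.eventually (gt_mem_nhds hε)] with x hx hx' z hz
  rw [dist_comm, dist_eq_norm]
  refine (hC z hz.1 hz.2 x hx).2.2.2.trans_lt ?_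
  rwa [show -(x / 2) = -(1 / 2 * x) by ring]

theorem ModeFamily.analyticAt_normalized {V g : ℝ → ℝ} (h : ModeFamily V g G W)
    (hVg : NearEnd V g τ x₀) (hτ : τ * (2 + M) ≤ 1 / 200) (hκ : 0 < κ)
    (hκM : κ * (2 + M) ≤ 1 / 200) {z : ℂ} (hz : z ∈ closedRHP) (hM : ‖z‖ ≤ M) (x : ℝ)
    (i : Fin 3) : AnalyticAt ℂ (fun z => normalized x₀ (W z) x i) z := by
  have hc : ∀ x i, AnalyticAt ℂ (fun z => W z x i) z := fun x i =>
    (analyticAt_pi_iff.1 (h.analytic x z hz)) i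
  exact ((hc x₀ 0).inv (h.u_ne_zero hVg hτ hκ hκM hz hM)).mul (hc x i)

/-- Analyticity of `D₀` in `z` is not part of its definition. Continuity up to the imaginary axis,
and below holomorphy in the interior, come from uniform convergence of analytic functions. -/
theorem continuousOn_limEvans
    (h : ModeFamily limProfile (fun x => 1 - limProfile x) G W)
    (hVg : NearEnd limProfile (fun x => 1 - limProfile x) τ x₀)
    (hτ : τ * (2 + M) ≤ 1 / 200) (hκ : 0 < κ) (hκM : κ * (2 + M) ≤ 1 / 200) (hM0 : 0 ≤ M)
    (hD : ∀ z ∈ closedRHP, Tendsto (fun x => W z x 1) atTop (𝓝 (D₀ z))) :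
    ContinuousOn (fun z => D₀ z / W z x₀ 0) {z | z ∈ closedRHP ∧ ‖z‖ ≤ M} :=
  (tendstoUniformlyOn_limEvans h hVg hτ hκ hκM hM0 hD).continuousOn
    (Frequently.of_forall fun x z hz =>
      (h.analyticAt_normalized hVg hτ hκ hκM hz.1 hz.2 x 1).continuousAt.continuousWithinAt)

theorem isOpen_halfDisc (M : ℝ) : IsOpen {z : ℂ | 0 < z.re ∧ ‖z‖ < M} :=
  (isOpen_lt continuous_const Complex.continuous_re).inter
    (isOpen_lt continuous_norm continuous_const)

theorem differentiableOn_limEvans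
    (h : ModeFamily limProfile (fun x => 1 - limProfile x) G W)
    (hVg : NearEnd limProfile (fun x => 1 - limProfile x) τ x₀)
    (hτ : τ * (2 + M) ≤ 1 / 200) (hκ : 0 < κ) (hκM : κ * (2 + M) ≤ 1 / 200) (hM0 : 0 ≤ M)
    (hD : ∀ z ∈ closedRHP, Tendsto (fun x => W z x 1) atTop (𝓝 (D₀ z))) :
    DifferentiableOn ℂ (fun z => D₀ z / W z x₀ 0) {z : ℂ | 0 < z.re ∧ ‖z‖ < M} := by
  have hu := (tendstoUniformlyOn_limEvans h hVg hτ hκ hκM hM0 hD).mono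
    (s' := {z : ℂ | 0 < z.re ∧ ‖z‖ < M}) (fun z hz => ⟨hz.1.le, hz.2.le⟩)
  exact hu.tendstoLocallyUniformlyOn.differentiableOn
    (Eventually.of_forall fun x z hz =>
      (h.analyticAt_normalized hVg hτ hκ hκM hz.1.le hz.2.le x
        1).differentiableAt.differentiableWithinAt) (isOpen_halfDisc M)

end limit

/-! ### The adjoint system at `+∞`: fast variable and slow rates. -/

/-- The conjugated adjoint system in coordinates, with `c = -f`. -/
structure DualCoords (V c : ℝ → ℝ) (z : ℂ) (y₁ y₂ m : ℝ → ℂ) : Prop where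
  d₁ : ∀ x, HasDerivAt y₁ (-(z * V x * m x)) x
  d₂ : ∀ x, HasDerivAt y₂ (-(z * y₁ x) - z * V x * m x) x
  d₃ : ∀ x, HasDerivAt m (-(y₁ x + y₂ x) + (z + c x) * m x) x

/-- The variable `m` is repelled from 0 at rate at least `3/4`, so a solution tending to 0 must be
slaved to its forcing `y₁ + y₂`: the nonincreasing quantity `exp (-x) (2 H² - |m|²)` tends to 0,
hence is nonnegative. -/
theorem DualCoords.norm_m_le {V c : ℝ → ℝ} {z : ℂ} {y₁ y₂ m : ℝ → ℂ}
    (h : DualCoords V c z y₁ y₂ m) (hz : 0 ≤ z.re) {x H : ℝ} (hc : ∀ t ≥ x, 3 / 4 ≤ c t)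
    (hH : ∀ t ≥ x, ‖y₁ t + y₂ t‖ ≤ H) (hm : Tendsto m atTop (𝓝 0)) : ‖m x‖ ≤ 2 * H := by
  have hH0 : 0 ≤ H := (norm_nonneg _).trans (hH x le_rfl)
  have hd : ∀ t, HasDerivAt (fun t => -‖m t‖ ^ 2)
      (-(2 * ((-(y₁ t + y₂ t) + (z + c t) * m t) * star (m t)).re)) t :=
    fun t => (hasDerivAt_norm_sq (h.d₃ t)).neg
  have hle : ∀ t ≥ x, -(2 * ((-(y₁ t + y₂ t) + (z + c t) * m t) * star (m t)).re)
      ≤ 1 * (-‖m t‖ ^ 2) + 2 * H ^ 2 * Real.exp (0 * t) := by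
    intro t ht
    have e1 : ((-(y₁ t + y₂ t) + (z + c t) * m t) * star (m t)).re
        = -((y₁ t + y₂ t) * star (m t)).re + (z.re + c t) * ‖m t‖ ^ 2 := by
      have : (-(y₁ t + y₂ t) + (z + c t) * m t) * star (m t)
          = -((y₁ t + y₂ t) * star (m t)) + (z + c t) * ((‖m t‖ ^ 2 : ℝ) : ℂ) := by
        have : m t * star (m t) = ((‖m t‖ ^ 2 : ℝ) : ℂ) := by
          rw [← Complex.normSq_eq_norm_sq]; exact Complex.mul_conj _
        rw [← this]; ring
      rw [this, Complex.add_re, Complex.neg_re, Complex.re_mul_ofReal]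
      simp
    have e2 := (abs_le.1 (abs_re_mul_star_le (y₁ t + y₂ t) (m t))).2
    have e3 := mul_le_mul_of_nonneg_right (hH t ht) (norm_nonneg (m t))
    have e4 : 3 / 4 * ‖m t‖ ^ 2 ≤ (z.re + c t) * ‖m t‖ ^ 2 :=
      mul_le_mul_of_nonneg_right (by linarith [hc t ht]) (sq_nonneg _)
    rw [e1, zero_mul, Real.exp_zero]
    nlinarith [sq_nonneg (‖m t‖ - 2 * H)]
  have key : ∀ b ≥ x, Real.exp (-1 * b) * (-‖m b‖ ^ 2 + 2 * H ^ 2)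
      ≤ Real.exp (-1 * x) * (-‖m x‖ ^ 2 + 2 * H ^ 2) := by
    intro b hb
    have := exp_weight_le (θ := 1) (ω := 0) (r := 2 * H ^ 2) (by norm_num) hb hd
      (fun t ht => hle t ht.1)
    norm_num at this ⊢
    linarith
  have hlim : Tendsto (fun b : ℝ => Real.exp (-1 * b) * (-‖m b‖ ^ 2 + 2 * H ^ 2)) atTop (𝓝 0) := by
    have h1 : Tendsto (fun b : ℝ => Real.exp (-(1 * b))) atTop (𝓝 0) :=
      tendsto_exp_neg_mul one_pos
    have h2 := h1.mul ((hm.norm.pow 2).neg.add_const (2 * H ^ 2))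
    simpa using h2
  have h0 := ge_of_tendsto hlim (b := Real.exp (-1 * x) * (-‖m x‖ ^ 2 + 2 * H ^ 2))
  have h1 : 0 ≤ Real.exp (-1 * x) * (-‖m x‖ ^ 2 + 2 * H ^ 2) :=
    le_of_tendsto hlim ((eventually_ge_atTop x).mono key)
  have h2 : 0 ≤ -‖m x‖ ^ 2 + 2 * H ^ 2 := nonneg_of_mul_nonneg_right h1 (Real.exp_pos _)
  exact (sq_le_sq₀ (norm_nonneg _) (by positivity)).1 (by nlinarith)

/-- Fixed point form of the equation for the slow rates at `+∞`. -/
theorem exists_slow_fixedPoint {ν θ : ℂ} (hν : ‖ν‖ ≤ 1 / 64) (hθ : ‖θ‖ ≤ 1) :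
    ∃ h : ℂ, ‖h‖ ≤ 2 * ‖ν‖ ∧
      h = -h ^ 2 / 2 + ν * (1 + h) - θ * ν * (1 + h) ^ 3 / 2 := by
  set G : ℂ → ℂ := fun h => -h ^ 2 / 2 + ν * (1 + h) - θ * ν * (1 + h) ^ 3 / 2 with hG
  have hθν : ‖θ * ν‖ ≤ ‖ν‖ := by
    rw [norm_mul]; nlinarith [norm_nonneg ν]
  have h1 : ∀ h : ℂ, ‖h‖ ≤ 1 / 8 → ‖1 + h‖ ≤ 9 / 8 := fun h hh => by
    have := norm_add_le (1 : ℂ) h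
    rw [norm_one] at this; linarith
  have hGn : ∀ h : ℂ, ‖h‖ ≤ 1 / 8 → ‖G h‖ ≤ ‖h‖ / 16 + 15 / 8 * ‖ν‖ := by
    intro h hh
    have a1 : ‖-h ^ 2 / 2‖ ≤ ‖h‖ / 16 := by
      rw [norm_div, norm_neg, norm_pow]; norm_num; nlinarith [norm_nonneg h]
    have a2 : ‖ν * (1 + h)‖ ≤ 9 / 8 * ‖ν‖ := by
      rw [norm_mul]; nlinarith [norm_nonneg ν, h1 h hh]
    have a3 : ‖θ * ν * (1 + h) ^ 3 / 2‖ ≤ 3 / 4 * ‖ν‖ := by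
      rw [norm_div, norm_mul, norm_pow]
      have : ‖1 + h‖ ^ 3 ≤ (9 / 8) ^ 3 := pow_le_pow_left₀ (norm_nonneg _) (h1 h hh) 3
      have := mul_le_mul hθν this (by positivity) (norm_nonneg ν)
      norm_num at this ⊢
      linarith [norm_nonneg ν]
    calc ‖G h‖ ≤ ‖-h ^ 2 / 2 + ν * (1 + h)‖ + ‖θ * ν * (1 + h) ^ 3 / 2‖ := norm_sub_le _ _
      _ ≤ ‖-h ^ 2 / 2‖ + ‖ν * (1 + h)‖ + ‖θ * ν * (1 + h) ^ 3 / 2‖ := by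
        gcongr; exact norm_add_le _ _
      _ ≤ _ := by linarith
  have hmaps : Set.MapsTo G (Metric.closedBall 0 (1 / 8)) (Metric.closedBall 0 (1 / 8)) := by
    intro h hh
    rw [mem_closedBall_zero_iff] at hh ⊢
    linarith [hGn h hh]
  have hlip : ∀ a b : ℂ, ‖a‖ ≤ 1 / 8 → ‖b‖ ≤ 1 / 8 → ‖G a - G b‖ ≤ 1 / 2 * ‖a - b‖ := by
    intro a b ha hb
    have e : G a - G b = (-(a + b) / 2 + ν
        - θ * ν * ((1 + a) ^ 2 + (1 + a) * (1 + b) + (1 + b) ^ 2) / 2) * (a - b) := by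
      simp only [hG]; ring
    rw [e, norm_mul]
    refine mul_le_mul_of_nonneg_right ?_ (norm_nonneg _)
    have b1 : ‖-(a + b) / 2‖ ≤ 1 / 8 := by
      rw [norm_div, norm_neg]; norm_num; linarith [norm_add_le a b]
    have b2 : ‖(1 + a) ^ 2 + (1 + a) * (1 + b) + (1 + b) ^ 2‖ ≤ 4 := by
      have hA := h1 a ha
      have hB := h1 b hb
      refine norm_add₃_le.trans ?_
      rw [norm_pow, norm_mul, norm_pow]
      nlinarith [norm_nonneg (1 + a), norm_nonneg (1 + b)]
    have b3 : ‖θ * ν * ((1 + a) ^ 2 + (1 + a) * (1 + b) + (1 + b) ^ 2) / 2‖ ≤ 1 / 32 := by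
      rw [norm_div, norm_mul]
      have := mul_le_mul (hθν.trans hν) b2 (norm_nonneg _) (by norm_num)
      norm_num at this ⊢
      linarith
    have := norm_sub_le (-(a + b) / 2 + ν)
      (θ * ν * ((1 + a) ^ 2 + (1 + a) * (1 + b) + (1 + b) ^ 2) / 2)
    linarith [norm_add_le (-(a + b) / 2) ν]
  have hcon : ContractingWith (1 / 2) (hmaps.restrict G _ _) := by
    refine ⟨by rw [← NNReal.coe_lt_coe]; norm_num, LipschitzWith.of_dist_le_mul ?_⟩
    rintro ⟨a, ha⟩ ⟨b, hb⟩
    rw [mem_closedBall_zero_iff] at ha hb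
    have := hlip a b ha hb
    simpa [Subtype.dist_eq, dist_eq_norm] using this
  obtain ⟨h, hmem, hfix, -⟩ := hcon.exists_fixedPoint' Metric.isClosed_closedBall.isComplete hmaps
    (x := 0) (by simp) (edist_ne_top _ _)
  rw [mem_closedBall_zero_iff] at hmem
  have hfix' : G h = h := hfix
  refine ⟨h, ?_, hfix'.symm⟩
  have := hGn h hmem
  rw [hfix'] at this
  linarith [norm_nonneg ν]

/-- Sign of the slow rates at `+∞`. -/
theorem re_mul_slowRate {v c : ℝ} {z k : ℂ} (hv : 0 < v) (hz : 0 ≤ z.re) (hk : k ≠ 0)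
    (hk1 : 1 + k ≠ 0) (hr1 : 1 < ‖1 + 1 / k‖) (hk2 : k ^ 2 * (z + c + z * k) = v * (1 + 2 * k)) :
    ∃ s : ℝ, 0 ≤ s ∧ (z * k).re = s * (1 + 1 / k).re := by
  obtain ⟨r, hr⟩ : ∃ r, r = 1 + 1 / k := ⟨_, rfl⟩
  rw [← hr] at hr1 ⊢
  have hr0 : r ≠ 0 := norm_pos_iff.1 (by linarith)
  have hrk : r * k = 1 + k := by rw [hr]; field_simp; ring
  have hR : 1 < Complex.normSq r := by
    rw [Complex.normSq_eq_norm_sq]; nlinarith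
  have hR0 : 0 < Complex.normSq r := by linarith
  -- In terms of `r = 1 + 1/k`, the real part of `z k` is `Re r` times `v - (c + v) / |r|²`, so only
  -- the sign of this real factor has to be found.
  have hzk : z * k = v * r - (c + v) * r⁻¹ := by
    have h1 : r⁻¹ = k / (1 + k) := by
      rw [← hrk]; field_simp
    have h2 : r = (1 + k) / k := by rw [← hrk]; field_simp
    rw [h1, h2]
    field_simp
    linear_combination hk2
  have hz' : z = (r - 1) * (v * r - (c + v) * r⁻¹) := by
    rw [← hzk, hr]; field_simp; ring
  have hinv : (r⁻¹).re = r.re / Complex.normSq r := Complex.inv_re r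
  have hre : (z * k).re = v * r.re - (c + v) * (r.re / Complex.normSq r) := by
    rw [hzk, ← hinv]
    simp [Complex.sub_re, Complex.mul_re]
  have hzre : z.re = v * (2 * r.re ^ 2 - Complex.normSq r) - v * r.re - (c + v)
      + (c + v) * (r.re / Complex.normSq r) := by
    have e : z = v * r ^ 2 - v * r - (c + v) + (c + v) * r⁻¹ := by
      rw [hz']; field_simp; ring
    rw [e, ← hinv, Complex.normSq_apply]
    simp only [Complex.sub_re, Complex.add_re, Complex.mul_re, pow_two, Complex.ofReal_re,
      Complex.ofReal_im, Complex.add_im]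
    ring
  refine ⟨v - (c + v) / Complex.normSq r, ?_, by rw [hre]; ring⟩
  rw [sub_nonneg, div_le_iff₀ hR0]
  -- A negative factor would give `Re z < 0`, because `Re r < |r|²`.
  by_contra hlt
  rw [not_le] at hlt
  have hρ : r.re ^ 2 ≤ Complex.normSq r := by
    rw [Complex.normSq_apply]; nlinarith [sq_nonneg r.im]
  have hρ1 : r.re < Complex.normSq r := by nlinarith
  have h1 : z.re ≤ (c + v - v * Complex.normSq r) * (r.re / Complex.normSq r - 1) := by
    rw [hzre]
    have : (c + v - v * Complex.normSq r) * (r.re / Complex.normSq r - 1)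
      = (c + v) * (r.re / Complex.normSq r) - (c + v) - v * r.re + v * Complex.normSq r := by
      field_simp; ring
    rw [this]
    nlinarith
  have h2 : r.re / Complex.normSq r - 1 < 0 := by
    rw [sub_neg, div_lt_one hR0]; exact hρ1
  nlinarith

/-- The two slow rates at `+∞` and their signs. -/
theorem exists_slowRates {v c : ℝ} {z : ℂ} (hv : 0 < v) (hvs : v ≤ 1 / 8192) (hc : 1 / 2 ≤ c)
    (hz : 0 ≤ z.re) : ∃ ν h₁ h₂ : ℂ, ν ^ 2 * (z + c) = v ∧ ‖ν‖ ≤ 1 / 64 ∧ 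
      ‖h₁‖ ≤ 2 * ‖ν‖ ∧ ‖h₂‖ ≤ 2 * ‖ν‖ ∧
      (∀ k, k = ν * (1 + h₁) →
        k ^ 2 * (z + c + z * k) = v * (1 + 2 * k) ∧ 0 ≤ (z * k).re) ∧
      (∀ k, k = -ν * (1 + h₂) →
        k ^ 2 * (z + c + z * k) = v * (1 + 2 * k) ∧ (z * k).re ≤ 0) := by
  have hs : 1 / 2 ≤ (z + c).re := by simp; linarith
  have hs0 : z + c ≠ 0 := fun h => by rw [h] at hs; norm_num at hs
  have hsn : 1 / 2 ≤ ‖z + c‖ := hs.trans (Complex.re_le_norm _)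
  obtain ⟨ν, hν, hνre⟩ : ∃ ν : ℂ, ν ^ 2 = v / (z + c) ∧ 0 ≤ ν.re := by
    obtain ⟨ν, hν⟩ := IsAlgClosed.exists_pow_nat_eq ((v : ℂ) / (z + c)) (n := 2) (by norm_num)
    rcases le_total 0 ν.re with h | h
    · exact ⟨ν, hν, h⟩
    · exact ⟨-ν, by rw [neg_sq, hν], by simpa using h⟩
  have hv0 : (v : ℂ) ≠ 0 := by exact_mod_cast hv.ne'
  have hν2 : ν ^ 2 * (z + c) = v := by rw [hν]; field_simp
  have hν0 : ν ≠ 0 := by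
    rintro rfl; simp at hν2; exact hv.ne' (by exact_mod_cast hν2.symm)
  have hνn : ‖ν‖ ≤ 1 / 64 := by
    have h1 : ‖ν‖ ^ 2 * ‖z + c‖ = v := by
      rw [← norm_pow, ← norm_mul, hν2]; simp [hv.le]
    have h2 : ‖ν‖ ^ 2 * (1 / 2) ≤ v := by
      rw [← h1]; gcongr
    exact (sq_le_sq₀ (norm_nonneg _) (by norm_num)).1 (by linarith)
  have hθ : ‖z / (z + c)‖ ≤ 1 := by
    rw [norm_div, div_le_one (by linarith)]
    rw [← sq_le_sq₀ (norm_nonneg _) (norm_nonneg _), ← Complex.normSq_eq_norm_sq,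
      ← Complex.normSq_eq_norm_sq, Complex.normSq_apply, Complex.normSq_apply]
    simp
    nlinarith
  -- Substitution of `k = ν' (1 + h)` in the rate equation and division by `ν'² (z + c) = v` leave
  -- exactly the fixed point equation with `θ = z / (z + c)`; the two roots correspond to `ν' = ±ν`.
  have heq : ∀ (ν' h : ℂ), ν' ^ 2 = ν ^ 2 →
      h = -h ^ 2 / 2 + ν' * (1 + h) - z / (z + c) * ν' * (1 + h) ^ 3 / 2 →
      ∀ k, k = ν' * (1 + h) → k ^ 2 * (z + c + z * k) = v * (1 + 2 * k) := by
    rintro ν' h hν' hh k rfl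
    rw [← hν2, ← hν']
    have e : z = z / (z + c) * (z + c) := by field_simp
    linear_combination (2 * ν' ^ 2 * (z + c)) * hh + ν' ^ 3 * (1 + h) ^ 3 * e
  -- the real part of `1 / ν` dominates
  have hq : (ν⁻¹).re ≥ 1 / 2 * ‖ν‖⁻¹ := by
    have h1 : (ν⁻¹) ^ 2 = (z + c) / v := by
      rw [inv_pow, hν, inv_div]
    have h2 : 0 ≤ (ν⁻¹ ^ 2).re := by
      rw [h1, Complex.div_ofReal_re]; exact div_nonneg (by linarith) hv.le
    have h3 : 0 ≤ (ν⁻¹).re := by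
      rw [Complex.inv_re]; exact div_nonneg hνre (Complex.normSq_nonneg _)
    have h4 : ‖ν‖⁻¹ ^ 2 = (ν⁻¹).re ^ 2 + (ν⁻¹).im ^ 2 := by
      rw [← norm_inv, ← Complex.normSq_eq_norm_sq, Complex.normSq_apply]; ring
    have h5 : (ν⁻¹ ^ 2).re = (ν⁻¹).re ^ 2 - (ν⁻¹).im ^ 2 := by
      rw [pow_two, Complex.mul_re]; ring
    have h6 : 0 ≤ ‖ν‖⁻¹ := by positivity
    nlinarith
  have hinv : (64 : ℝ) ≤ ‖ν‖⁻¹ := by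
    rw [le_inv_comm₀ (by norm_num) (norm_pos_iff.2 hν0)]; linarith
  -- The correction changes `1/ν` by at most 4, while its real part is at least `64 / 2 = 32`; hence
  -- `Re (1 + 1/k)` keeps its sign and exceeds 1 in modulus.
  have hdiff : ∀ h : ℂ, ‖h‖ ≤ 2 * ‖ν‖ → 1 + h ≠ 0 ∧ ‖ν⁻¹ * (1 + h)⁻¹ - ν⁻¹‖ ≤ 4 := by
    intro h hh
    have h1 : 1 / 2 ≤ ‖1 + h‖ := by
      have := norm_sub_le (1 + h) h
      simp at this; linarith
    have h2 : 1 + h ≠ 0 := norm_pos_iff.1 (by linarith)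
    refine ⟨h2, ?_⟩
    have e : ν⁻¹ * (1 + h)⁻¹ - ν⁻¹ = -(h / (ν * (1 + h))) := by field_simp; ring
    have hνp := norm_pos_iff.2 hν0
    rw [e, norm_neg, norm_div, norm_mul, div_le_iff₀ (by positivity)]
    nlinarith
  obtain ⟨h₁, hb₁, hf₁⟩ := exists_slow_fixedPoint hνn hθ
  obtain ⟨h₂, hb₂, hf₂⟩ := exists_slow_fixedPoint (ν := -ν) (by simpa using hνn) hθ
  rw [norm_neg] at hb₂
  have hsmall : ∀ (ν' h : ℂ), ‖ν'‖ = ‖ν‖ → ‖h‖ ≤ 2 * ‖ν‖ → 1 + ν' * (1 + h) ≠ 0 := by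
    intro ν' h hn hh h0
    have h1 : ‖ν' * (1 + h)‖ = 1 := by
      rw [eq_neg_of_add_eq_zero_right h0]; simp
    rw [norm_mul, hn] at h1
    have := norm_add_le (1 : ℂ) h
    rw [norm_one] at this
    nlinarith [norm_nonneg ν]
  refine ⟨ν, h₁, h₂, hν2, hνn, hb₁, hb₂, ?_, ?_⟩
  · rintro k hk
    have he := heq ν h₁ rfl hf₁ k hk
    refine ⟨he, ?_⟩
    obtain ⟨hh0, hd⟩ := hdiff h₁ hb₁
    have hkinv : 1 / k = ν⁻¹ * (1 + h₁)⁻¹ := by rw [hk, one_div, mul_inv]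
    have hre : 1 < (1 + 1 / k).re := by
      have := (abs_le.1 (Complex.abs_re_le_norm (ν⁻¹ * (1 + h₁)⁻¹ - ν⁻¹))).1
      rw [hkinv, Complex.add_re, Complex.one_re]
      rw [Complex.sub_re] at this
      linarith
    obtain ⟨s, hs, hsk⟩ := re_mul_slowRate hv hz (by rw [hk]; exact mul_ne_zero hν0 hh0)
      (by rw [hk]; exact hsmall ν h₁ rfl hb₁) (hre.trans_le (Complex.re_le_norm _)) he
    rw [hsk]; exact mul_nonneg hs (by linarith)
  · rintro k hk
    have he := heq (-ν) h₂ (neg_sq ν) hf₂ k hk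
    refine ⟨he, ?_⟩
    obtain ⟨hh0, hd⟩ := hdiff h₂ hb₂
    have hkinv : 1 / k = -(ν⁻¹ * (1 + h₂)⁻¹) := by rw [hk, one_div, mul_inv, inv_neg]; ring
    have hre : (1 + 1 / k).re < -1 := by
      have := (abs_le.1 (Complex.abs_re_le_norm (ν⁻¹ * (1 + h₂)⁻¹ - ν⁻¹))).1
      rw [hkinv, Complex.add_re, Complex.one_re, Complex.neg_re]
      rw [Complex.sub_re] at this
      linarith
    have hnorm : 1 < ‖1 + 1 / k‖ := by
      have := (abs_le.1 (Complex.abs_re_le_norm (1 + 1 / k))).1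
      linarith
    obtain ⟨s, hs, hsk⟩ := re_mul_slowRate hv hz
      (by rw [hk]; exact mul_ne_zero (neg_ne_zero.2 hν0) hh0)
      (by rw [hk]; exact hsmall (-ν) h₂ (norm_neg ν) hb₂) hnorm he
    rw [hsk]; exact mul_nonpos_of_nonneg_of_nonpos hs (by linarith)

/-- Variation of constants estimate for a nonexpanding scalar equation. -/
theorem norm_le_add_of_re_nonpos {f e : ℝ → ℂ} {φ φ' : ℝ → ℝ} {α : ℂ} {a b : ℝ} (hab : a ≤ b)
    (hf : ∀ x, HasDerivAt f (α * f x + e x) x) (hφ : ∀ x, HasDerivAt φ (φ' x) x)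
    (h : ∀ x ∈ Set.Icc a b, ‖e x‖ ≤ -φ' x) (hα : α.re ≤ 0) : ‖f b‖ ≤ ‖f a‖ + (φ a - φ b) := by
  have hexp : ∀ x : ℝ, HasDerivAt (fun t : ℝ => Complex.exp (-(α * t)))
      (Complex.exp (-(α * x)) * -(α * 1)) x := fun x =>
    ((Complex.ofRealCLM.hasDerivAt (x := x)).const_mul α).neg.cexp
  have hn : ∀ x : ℝ, ‖Complex.exp (-(α * x))‖ = Real.exp (-(α.re * x)) := fun x => by
    rw [Complex.norm_exp]; simp
  have key := norm_sub_le_of_hasDerivAt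
    (f := fun x : ℝ => Complex.exp (-(α * x)) * f x)
    (f' := fun x : ℝ => Complex.exp (-(α * x)) * e x)
    (φ := fun x => Real.exp (-(α.re * b)) * φ x)
    (φ' := fun x => Real.exp (-(α.re * b)) * φ' x) hab
    (fun x => ((hexp x).mul (hf x)).congr_deriv (by ring))
    (fun x => (hφ x).const_mul _) (fun x hx => by
      rw [norm_mul, hn, ← mul_neg (Real.exp _)]
      refine mul_le_mul (Real.exp_le_exp.2 ?_) (h x hx) (norm_nonneg _) (Real.exp_pos _).le
      nlinarith [hx.2])
  have h1 := (norm_sub_norm_le _ _).trans key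
  rw [norm_mul, norm_mul, hn, hn] at h1
  have h2 : Real.exp (-(α.re * a)) ≤ Real.exp (-(α.re * b)) := Real.exp_le_exp.2 (by nlinarith)
  have h3 := mul_le_mul_of_nonneg_right h2 (norm_nonneg (f a))
  have h4 : Real.exp (-(α.re * b)) * ‖f b‖
      ≤ Real.exp (-(α.re * b)) * (‖f a‖ + (φ a - φ b)) := by linarith
  exact le_of_mul_le_mul_left h4 (Real.exp_pos _)

theorem norm_le_add_of_re_nonneg {f e : ℝ → ℂ} {φ φ' : ℝ → ℝ} {α : ℂ} {a b : ℝ} (hab : a ≤ b)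
    (hf : ∀ x, HasDerivAt f (α * f x + e x) x) (hφ : ∀ x, HasDerivAt φ (φ' x) x)
    (h : ∀ x ∈ Set.Icc a b, ‖e x‖ ≤ -φ' x) (hα : 0 ≤ α.re) : ‖f a‖ ≤ ‖f b‖ + (φ a - φ b) := by
  have := norm_le_add_of_re_nonpos (f := fun x => f (-x)) (e := fun x => -e (-x))
    (φ := fun x => -φ (-x)) (φ' := fun x => φ' (-x)) (α := -α) (neg_le_neg hab)
    (fun x => by
      have := (hf (-x)).scomp x (hasDerivAt_neg x)
      refine this.congr_deriv ?_
      simp)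
    (fun x => by
      have := ((hφ (-x)).scomp x (hasDerivAt_neg x)).neg
      refine this.congr_deriv ?_
      simp)
    (fun x hx => by
      rw [norm_neg]
      exact h (-x) ⟨by linarith [hx.2], by linarith [hx.1]⟩)
    (by simpa using hα)
  simp only [neg_neg] at this
  linarith

/-- Absorption argument: the implication is applied to the supremum, finite by the a priori bound
`B`, whose value does not enter the result. -/
theorem le_two_mul_of_forall_bound {ι : Type*} {s : Set ι} {f : ι → ℝ} {q B : ℝ}
    (hB : ∀ x ∈ s, f x ≤ B)
    (h : ∀ S, (∀ x ∈ s, f x ≤ S) → ∀ x ∈ s, f x ≤ S / 2 + q) : ∀ x ∈ s, f x ≤ 2 * q := by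
  intro x hx
  have hbdd : BddAbove (f '' s) := ⟨B, by rintro _ ⟨y, hy, rfl⟩; exact hB y hy⟩
  have h1 : ∀ y ∈ s, f y ≤ sSup (f '' s) := fun y hy => le_csSup hbdd ⟨y, hy, rfl⟩
  have h2 : sSup (f '' s) ≤ sSup (f '' s) / 2 + q :=
    csSup_le ⟨f x, x, hx, rfl⟩ (by rintro _ ⟨y, hy, rfl⟩; exact h _ h1 y hy)
  linarith [h1 x hx]

theorem exists_bound_of_tendsto {f : ℝ → ℝ} (hf : Continuous f) (hl : Tendsto f atTop (𝓝 0))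
    (X : ℝ) : ∃ B, ∀ x ∈ Set.Ici X, f x ≤ B := by
  obtain ⟨T, hT⟩ := eventually_atTop.1 (hl.eventually (ge_mem_nhds (zero_lt_one' ℝ)))
  obtain ⟨B, hB⟩ := (isCompact_Icc (a := X) (b := T)).bddAbove_image hf.continuousOn
  refine ⟨max 1 B, fun x hx => ?_⟩
  rcases le_total T x with h | h
  · exact (hT x h).trans (le_max_left _ _)
  · exact (hB ⟨x, ⟨hx, h⟩, rfl⟩).trans (le_max_right _ _)

/-- The row `(1 + k, k, z k²)` is a left eigenvector, for the rate `-z k`, of the system frozen at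
`V = v`, `c = c₀`; the rate equation is the eigenvalue condition. What remains is linear in the
deviation of the coefficients from the end state. -/
theorem DualCoords.hasDerivAt_slow {V c : ℝ → ℝ} {z k : ℂ} {y₁ y₂ m : ℝ → ℂ} {v c₀ : ℝ}
    (h : DualCoords V c z y₁ y₂ m) (hk : k ^ 2 * (z + c₀ + z * k) = v * (1 + 2 * k)) (x : ℝ) :
    HasDerivAt (fun x => (1 + k) * y₁ x + k * y₂ x + z * k ^ 2 * m x)
      (-(z * k) * ((1 + k) * y₁ x + k * y₂ x + z * k ^ 2 * m x)
        + z * m x * (k ^ 2 * (c x - c₀) - (V x - v) * (1 + 2 * k))) x := by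
  refine ((((h.d₁ x).const_mul (1 + k)).add ((h.d₂ x).const_mul k)).add
    ((h.d₃ x).const_mul (z * k ^ 2))).congr_deriv ?_
  linear_combination (z * m x) * hk

theorem norm_slowRate_le {ν' h : ℂ} {n : ℝ} (hn : ‖ν'‖ = n) (hn1 : n ≤ 1 / 64)
    (hh : ‖h‖ ≤ 2 * n) : ‖ν' * (1 + h)‖ ≤ 33 / 32 * n := by
  have := norm_add_le (1 : ℂ) h
  rw [norm_one] at this
  rw [norm_mul, hn]
  nlinarith [norm_nonneg ν']

theorem norm_slow_sub_le {z ν' h k y₁ y₂ m : ℂ} {n M S : ℝ} (hn : ‖ν'‖ = n) (hn1 : n ≤ 1 / 64)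
    (hh : ‖h‖ ≤ 2 * n) (hk : k = ν' * (1 + h)) (hz : ‖z‖ ≤ M) (h₁ : ‖y₁‖ ≤ n * S) (h₂ : ‖y₂‖ ≤ S)
    (hm : ‖m‖ ≤ 2 * S) :
    ‖(1 + k) * y₁ + k * y₂ + z * k ^ 2 * m - (y₁ + ν' * y₂)‖ ≤ n ^ 2 * (4 + 4 * M) * S := by
  have hn0 : 0 ≤ n := hn ▸ norm_nonneg ν'
  have hS : 0 ≤ S := (norm_nonneg _).trans h₂
  have hM : 0 ≤ M := (norm_nonneg _).trans hz
  have hkn : ‖k‖ ≤ 33 / 32 * n := hk ▸ norm_slowRate_le hn hn1 hh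
  have e : (1 + k) * y₁ + k * y₂ + z * k ^ 2 * m - (y₁ + ν' * y₂)
      = k * y₁ + ν' * h * y₂ + z * k ^ 2 * m := by rw [hk]; ring
  rw [e]
  have a1 : ‖k * y₁‖ ≤ (33 / 32 * n) * (n * S) := by
    rw [norm_mul]; exact mul_le_mul hkn h₁ (norm_nonneg _) (by positivity)
  have a2 : ‖ν' * h * y₂‖ ≤ n * (2 * n) * S := by
    rw [norm_mul, norm_mul, hn]
    exact mul_le_mul (mul_le_mul_of_nonneg_left hh hn0) h₂ (norm_nonneg _) (by positivity)
  have a3 : ‖z * k ^ 2 * m‖ ≤ M * (33 / 32 * n) ^ 2 * (2 * S) := by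
    rw [norm_mul, norm_mul, norm_pow]
    exact mul_le_mul (mul_le_mul hz (pow_le_pow_left₀ (norm_nonneg _) hkn 2) (by positivity) hM)
      hm (norm_nonneg _) (by positivity)
  have hp : 0 ≤ n ^ 2 * S := by positivity
  have hp2 : 0 ≤ M * (n ^ 2 * S) := by positivity
  refine norm_add₃_le.trans ?_
  nlinarith

/-- The coefficient in the bound for the coupling of the slow variables. -/
noncomputable def slowConst (γ M : ℝ) : ℝ := 2 * M * (M + γ ^ 2 + γ + 3)

/-- Both error terms are quadratic in `n = |ν|`: one through `k²`, the other because `ν² (z + c) =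
v₊` bounds `v₊` by a multiple of `n²`. As `y₁` has natural size `n`, this leaves one spare factor
`n`. -/
theorem norm_slow_error_le {γ vp M n w S : ℝ} {z ν k m : ℂ} (h : SmallEnd γ vp) (hw : vp ≤ w)
    (hz : ‖z‖ ≤ M) (hm : ‖m‖ ≤ 2 * S) (hn1 : n ≤ 1 / 64) (hn : ‖ν‖ = n)
    (hk : ‖k‖ ≤ 33 / 32 * n)
    (hν : ν ^ 2 * (z + ((gCoeff γ vp vp - vp : ℝ) : ℂ)) = vp) :
    ‖z * m * (k ^ 2 * (((gCoeff γ vp w - w : ℝ) : ℂ) - ((gCoeff γ vp vp - vp : ℝ) : ℂ))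
      - ((w : ℂ) - vp) * (1 + 2 * k))‖ ≤ slowConst γ M * n ^ 2 * (2 * S) * ((w - vp) / vp) := by
  have hn0 : 0 ≤ n := hn ▸ norm_nonneg ν
  have hM : 0 ≤ M := (norm_nonneg _).trans hz
  have hS : 0 ≤ 2 * S := (norm_nonneg _).trans hm
  have hγ := h.one_le
  have hvp := h.pos
  set ω := (w - vp) / vp with hω
  have hω0 : 0 ≤ ω := div_nonneg (by linarith) hvp.le
  have hwω : w - vp = vp * ω := by rw [hω]; field_simp
  obtain ⟨hc0, hc1⟩ := gCoeff_sub_mem h (le_refl vp)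
  have hle := h.le_sixteenth
  have hs : ‖z + ((gCoeff γ vp vp - vp : ℝ) : ℂ)‖ ≤ M + γ + 1 := by
    refine (norm_add_le _ _).trans ?_
    rw [Complex.norm_real, Real.norm_eq_abs, abs_of_nonneg (by linarith)]
    linarith
  have hvn : vp ≤ n ^ 2 * (M + γ + 1) := by
    have : n ^ 2 * ‖z + ((gCoeff γ vp vp - vp : ℝ) : ℂ)‖ = vp := by
      rw [← hn, ← norm_pow, ← norm_mul, hν]; simp [hvp.le]
    rw [← this]; gcongr
  have e1 : ‖(1 : ℂ) + 2 * k‖ ≤ 11 / 10 := by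
    refine (norm_add_le _ _).trans ?_
    rw [norm_one, norm_mul]; norm_num; linarith
  have e2 : ‖((w : ℂ) - vp) * (1 + 2 * k)‖ ≤ n ^ 2 * (M + γ + 1) * ω * (11 / 10) := by
    rw [norm_mul, ← Complex.ofReal_sub, Complex.norm_real, Real.norm_eq_abs,
      abs_of_nonneg (by linarith), hwω]
    exact mul_le_mul (mul_le_mul_of_nonneg_right hvn hω0) e1 (norm_nonneg _) (by positivity)
  have e3 : ‖k ^ 2 * (((gCoeff γ vp w - w : ℝ) : ℂ) - ((gCoeff γ vp vp - vp : ℝ) : ℂ))‖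
      ≤ (33 / 32 * n) ^ 2 * ((γ ^ 2 + 2) * ω) := by
    rw [norm_mul, norm_pow, ← Complex.ofReal_sub, Complex.norm_real, Real.norm_eq_abs]
    exact mul_le_mul (pow_le_pow_left₀ (norm_nonneg _) hk 2) (abs_gCoeff_sub_sub_le h hw)
      (abs_nonneg _) (by positivity)
  have e4 := (norm_sub_le (k ^ 2 * (((gCoeff γ vp w - w : ℝ) : ℂ)
    - ((gCoeff γ vp vp - vp : ℝ) : ℂ))) (((w : ℂ) - vp) * (1 + 2 * k))).trans (add_le_add e3 e2)
  rw [norm_mul, norm_mul]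
  have hγ2 : 0 ≤ γ ^ 2 := sq_nonneg _
  have e5 : (33 / 32 * n) ^ 2 * ((γ ^ 2 + 2) * ω) + n ^ 2 * (M + γ + 1) * ω * (11 / 10)
      ≤ 2 * (M + γ ^ 2 + γ + 3) * (n ^ 2 * ω) := by
    have : 0 ≤ n ^ 2 * ω := by positivity
    have e : (33 / 32 * n) ^ 2 * ((γ ^ 2 + 2) * ω) + n ^ 2 * (M + γ + 1) * ω * (11 / 10)
      = (1089 / 1024 * (γ ^ 2 + 2) + 11 / 10 * (M + γ + 1)) * (n ^ 2 * ω) := by ring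
    rw [e]
    exact mul_le_mul_of_nonneg_right (by linarith) this
  calc _ ≤ M * (2 * S) * (2 * (M + γ ^ 2 + γ + 3) * (n ^ 2 * ω)) :=
        mul_le_mul (mul_le_mul hz hm (norm_nonneg _) hM) (e4.trans e5) (norm_nonneg _)
          (by positivity)
    _ = _ := by rw [slowConst]; ring

/-! ### Bounds for decaying dual solutions, beyond and before the point `X`. -/

section dual
variable {γ vp M μ X : ℝ} {vhat : ℝ → ℝ} {z : ℂ} {y₁ y₂ m : ℝ → ℂ}

theorem le_gCoeff_sub (h : SmallEnd γ vp) {w : ℝ} (hw : vp ≤ w) (hw1 : w ≤ 1 / 8) :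
    3 / 4 ≤ gCoeff γ vp w - w := by
  linarith [(gCoeff_sub_mem h hw).1]

set_option maxHeartbeats 1000000 in
/-- Beyond the point where the profile equals `2 v₊`, decaying solutions of the adjoint equation
are slaved to their second coordinate. -/
theorem DualCoords.far_bound (h : SmallEnd γ vp) (hp : IsProfile γ vp vhat)
    (hy : DualCoords vhat (fun x => gCoeff γ vp (vhat x) - vhat x) z y₁ y₂ m)
    (h₁ : Tendsto y₁ atTop (𝓝 0)) (h₂ : Tendsto y₂ atTop (𝓝 0)) (hm : Tendsto m atTop (𝓝 0))
    (hz : 0 ≤ z.re) (hM : ‖z‖ ≤ M) (hμ0 : 0 < μ) (hμ : μ ^ 4 = vp)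
    (hμM : 128 * (1 + M + slowConst γ M) * μ ^ 2 ≤ 1) (hX : vhat X = 2 * vp) {x : ℝ} (hx : X ≤ x) :
    ‖y₁ x‖ ≤ 8 * μ ^ 2 * ‖y₂ X‖ ∧ ‖y₁ x‖ + ‖y₂ x‖ ≤ 4 * ‖y₂ X‖ := by
  have hM0 : 0 ≤ M := (norm_nonneg _).trans hM
  have hγ := h.one_le
  have hvp := h.pos
  have hC0 : 0 ≤ slowConst γ M := by rw [slowConst]; positivity
  have hμ2 : μ ^ 2 ≤ 1 / 128 := by
    have : 128 * 1 * μ ^ 2 ≤ 128 * (1 + M + slowConst γ M) * μ ^ 2 := by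
      gcongr; linarith
    linarith
  have hvs : vp ≤ 1 / 8192 := by
    rw [← hμ]; nlinarith [sq_nonneg μ]
  have hV8 : ∀ t ≥ X, vhat t ≤ 1 / 8 := fun t ht => by
    have := hp.antitone h ht
    linarith
  have hc : ∀ t ≥ X, 3 / 4 ≤ gCoeff γ vp (vhat t) - vhat t := fun t ht =>
    le_gCoeff_sub h (hp.vp_le h t) (hV8 t ht)
  obtain ⟨ν, a, b, hν, hν64, ha, hb, hk₁, hk₂⟩ := exists_slowRates hvp hvs
    (c := gCoeff γ vp vp - vp) (by linarith [le_gCoeff_sub h (le_refl vp) (by linarith)]) hz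
  obtain ⟨k₁, hk₁e⟩ : ∃ k, k = ν * (1 + a) := ⟨_, rfl⟩
  obtain ⟨k₂, hk₂e⟩ : ∃ k, k = -ν * (1 + b) := ⟨_, rfl⟩
  obtain ⟨hq₁, hs₁⟩ := hk₁ k₁ hk₁e
  obtain ⟨hq₂, hs₂⟩ := hk₂ k₂ hk₂e
  obtain ⟨n, hn⟩ : ∃ n, ‖ν‖ = n := ⟨_, rfl⟩
  rw [hn] at hν64 ha hb
  have hν0 : ν ≠ 0 := by
    rintro rfl; simp at hν; exact hvp.ne' (by exact_mod_cast hν.symm)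
  have hn0 : 0 < n := hn ▸ norm_pos_iff.2 hν0
  have hnμ : n ≤ 2 * μ ^ 2 := by
    refine (sq_le_sq₀ hn0.le (by positivity)).1 ?_
    have h1 : n ^ 2 * ‖z + ((gCoeff γ vp vp - vp : ℝ) : ℂ)‖ = vp := by
      rw [← hn, ← norm_pow, ← norm_mul, hν]; simp [hvp.le]
    have h2 : 1 / 2 ≤ ‖z + ((gCoeff γ vp vp - vp : ℝ) : ℂ)‖ := by
      refine le_trans ?_ (Complex.re_le_norm _)
      rw [Complex.add_re, Complex.ofReal_re]
      linarith [le_gCoeff_sub h (le_refl vp) (by linarith)]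
    have h3 : n ^ 2 * (1 / 2) ≤ vp := by rw [← h1]; gcongr
    nlinarith [sq_nonneg (μ ^ 2)]
  have hnC : 64 * (1 + M + slowConst γ M) * n ≤ 1 := by
    refine le_trans ?_ hμM
    have : 0 ≤ 64 * (1 + M + slowConst γ M) := by positivity
    nlinarith
  -- the function to be bounded
  have hcont : Continuous fun t => ‖y₁ t‖ / n + ‖y₂ t‖ := by
    have c1 : Continuous y₁ := continuous_iff_continuousAt.2 fun t => (hy.d₁ t).continuousAt
    have c2 : Continuous y₂ := continuous_iff_continuousAt.2 fun t => (hy.d₂ t).continuousAt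
    fun_prop
  have hlim : Tendsto (fun t => ‖y₁ t‖ / n + ‖y₂ t‖) atTop (𝓝 0) := by
    simpa using (h₁.norm.div_const n).add h₂.norm
  obtain ⟨B, hB⟩ := exists_bound_of_tendsto hcont hlim X
  -- The weight `1/n` puts `y₁`, which behaves like a multiple of `ν y₂`, on the scale of `y₂`. The
  -- errors sum to `6 K + 4 E = O(n² S)`, at most half of `n S`, so the absorption lemma applies.
  have main : ∀ t ∈ Set.Ici X, ‖y₁ t‖ / n + ‖y₂ t‖ ≤ 2 * (2 * ‖y₂ X‖) := by
    refine le_two_mul_of_forall_bound hB fun S hS t ht => ?_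
    have hS1 : ∀ r ≥ X, ‖y₁ r‖ ≤ n * S := fun r hr => by
      have := hS r hr
      have h1 : ‖y₁ r‖ / n ≤ S := by linarith [norm_nonneg (y₂ r)]
      rw [div_le_iff₀ hn0] at h1; linarith
    have hS2 : ∀ r ≥ X, ‖y₂ r‖ ≤ S := fun r hr => by
      have := hS r hr
      have h1 : 0 ≤ ‖y₁ r‖ / n := by positivity
      linarith
    have hS0 : 0 ≤ S := (norm_nonneg _).trans (hS2 X le_rfl)
    have hmS : ∀ r ≥ X, ‖m r‖ ≤ 2 * S := fun r hr =>
      hy.norm_m_le hz (fun s hs => hc s (hr.le.trans hs)) (fun s hs => by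
        have hs' : X ≤ s := hr.le.trans hs
        refine (norm_add_le _ _).trans (le_trans ?_ (hS s hs'))
        gcongr
        rw [le_div_iff₀ hn0]
        nlinarith [norm_nonneg (y₁ s)]) hm
    have hkn₁ : ‖k₁‖ ≤ 33 / 32 * n := hk₁e ▸ norm_slowRate_le hn hν64 ha
    have hkn₂ : ‖k₂‖ ≤ 33 / 32 * n := hk₂e ▸ norm_slowRate_le (by rw [norm_neg, hn]) hν64 hb
    obtain ⟨K, hK⟩ : ∃ K, K = slowConst γ M * n ^ 2 * (2 * S) := ⟨_, rfl⟩
    have hK0 : 0 ≤ K := by rw [hK]; positivity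
    -- Since `V' ≤ -(V - v₊) / 2`, this function dominates the tail integral of the error, and it
    -- equals `2 K` at `X` because `V(X) = 2 v₊`.
    have hφ : ∀ r, HasDerivAt (fun r => K * (2 * ((vhat r - vp) / vp)))
        (K * (2 * ((vhat r * profileRate γ vp (vhat r)) / vp))) r := fun r =>
      ((((hp.hasDerivAt r).sub_const vp).div_const vp).const_mul 2).const_mul K
    have herr : ∀ k : ℂ, ‖k‖ ≤ 33 / 32 * n → ∀ r ≥ X,
        ‖z * m r * (k ^ 2 * (((gCoeff γ vp (vhat r) - vhat r : ℝ) : ℂ)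
          - ((gCoeff γ vp vp - vp : ℝ) : ℂ)) - ((vhat r : ℂ) - vp) * (1 + 2 * k))‖
        ≤ -(K * (2 * ((vhat r * profileRate γ vp (vhat r)) / vp))) := by
      intro k hk r hr
      refine (norm_slow_error_le h (hp.vp_le h r) hM (hmS r hr) hν64 hn hk hν).trans ?_
      rw [← hK, ← mul_neg]
      refine mul_le_mul_of_nonneg_left ?_ hK0
      have := hp.deriv_le h (x := r) (by linarith [hV8 r hr])
      rw [← mul_neg, ← neg_div, ← mul_div_assoc]
      gcongr
      linarith
    have hφ0 : ∀ r, 0 ≤ K * (2 * ((vhat r - vp) / vp)) := fun r => by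
      have := hp.vp_le h r
      have : 0 ≤ (vhat r - vp) / vp := div_nonneg (by linarith) hvp.le
      positivity
    have hφX : K * (2 * ((vhat X - vp) / vp)) = 2 * K := by
      rw [hX]; field_simp; ring
    have hφt : K * (2 * ((vhat t - vp) / vp)) ≤ 2 * K := by
      rw [← hφX]
      have := hp.antitone h (Set.mem_Ici.1 ht)
      gcongr
    -- the nonexpanding slow variable
    have z₁ := norm_le_add_of_re_nonpos (Set.mem_Ici.1 ht) (hy.hasDerivAt_slow hq₁) hφ
      (fun r hr => herr k₁ hkn₁ r hr.1) (by simpa using hs₁)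
    -- the expanding slow variable vanishes in the limit
    have z₂ : ‖(1 + k₂) * y₁ t + k₂ * y₂ t + z * k₂ ^ 2 * m t‖ ≤ 2 * K := by
      have hb2 : ∀ r ≥ t, ‖(1 + k₂) * y₁ t + k₂ * y₂ t + z * k₂ ^ 2 * m t‖
          ≤ ‖(1 + k₂) * y₁ r + k₂ * y₂ r + z * k₂ ^ 2 * m r‖ + 2 * K := by
        intro r hr
        have := norm_le_add_of_re_nonneg hr (hy.hasDerivAt_slow hq₂) hφ
          (fun s hs => herr k₂ hkn₂ s ((Set.mem_Ici.1 ht).trans hs.1)) (by simpa using hs₂)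
        linarith [hφ0 r]
      have hl : Tendsto (fun r => ‖(1 + k₂) * y₁ r + k₂ * y₂ r + z * k₂ ^ 2 * m r‖ + 2 * K)
          atTop (𝓝 (0 + 2 * K)) := by
        have := (((h₁.const_mul (1 + k₂)).add (h₂.const_mul k₂)).add
          (hm.const_mul (z * k₂ ^ 2))).norm.add_const (2 * K)
        simpa using this
      rw [zero_add] at hl
      exact ge_of_tendsto hl ((eventually_ge_atTop t).mono hb2)
    rw [hφX] at z₁
    have s₁ : ∀ r ≥ X, _ := fun r hr => norm_slow_sub_le hn hν64 ha hk₁e hM (hS1 r hr) (hS2 r hr)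
      (hmS r hr)
    have s₂ := norm_slow_sub_le (by rw [norm_neg, hn]) hν64 hb hk₂e hM (hS1 t ht) (hS2 t ht)
      (hmS t ht)
    obtain ⟨E, hE⟩ : ∃ E, E = n ^ 2 * (4 + 4 * M) * S := ⟨_, rfl⟩
    rw [← hE] at s₂
    have p₁ : ‖y₁ t + ν * y₂ t‖ ≤ ‖y₁ X + ν * y₂ X‖ + 2 * K + 2 * E := by
      have q1 := (abs_le.1 (abs_norm_sub_norm_le _ _)).1.trans' (neg_le_neg (s₁ t ht))
      have q2 := (abs_le.1 (abs_norm_sub_norm_le _ _)).2.trans (s₁ X le_rfl)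
      rw [← hE] at q1 q2
      linarith [hφ0 t]
    have p₂ : ‖y₁ t - ν * y₂ t‖ ≤ 2 * K + E := by
      have q1 := (abs_le.1 (abs_norm_sub_norm_le _ _)).1.trans' (neg_le_neg s₂)
      rw [neg_mul, ← sub_eq_add_neg] at q1
      linarith
    have p₃ : ‖y₁ X + ν * y₂ X‖ ≤ 2 * n * ‖y₂ X‖ + 2 * K + E := by
      have z₃ : ‖(1 + k₂) * y₁ X + k₂ * y₂ X + z * k₂ ^ 2 * m X‖ ≤ 2 * K := by
        have hb2 : ∀ r ≥ X, ‖(1 + k₂) * y₁ X + k₂ * y₂ X + z * k₂ ^ 2 * m X‖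
            ≤ ‖(1 + k₂) * y₁ r + k₂ * y₂ r + z * k₂ ^ 2 * m r‖ + 2 * K := by
          intro r hr
          have := norm_le_add_of_re_nonneg hr (hy.hasDerivAt_slow hq₂) hφ
            (fun s hs => herr k₂ hkn₂ s hs.1) (by simpa using hs₂)
          linarith [hφ0 r]
        have hl : Tendsto (fun r => ‖(1 + k₂) * y₁ r + k₂ * y₂ r + z * k₂ ^ 2 * m r‖ + 2 * K)
            atTop (𝓝 (0 + 2 * K)) := by
          have := (((h₁.const_mul (1 + k₂)).add (h₂.const_mul k₂)).add
            (hm.const_mul (z * k₂ ^ 2))).norm.add_const (2 * K)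
          simpa using this
        rw [zero_add] at hl
        exact ge_of_tendsto hl ((eventually_ge_atTop X).mono hb2)
      have s₃ := norm_slow_sub_le (by rw [norm_neg, hn]) hν64 hb hk₂e hM (hS1 X le_rfl)
        (hS2 X le_rfl) (hmS X le_rfl)
      rw [← hE] at s₃
      have q1 := (abs_le.1 (abs_norm_sub_norm_le _ _)).1.trans' (neg_le_neg s₃)
      have e : y₁ X + ν * y₂ X = (y₁ X + -ν * y₂ X) + 2 * ν * y₂ X := by ring
      have q2 : ‖2 * ν * y₂ X‖ = 2 * n * ‖y₂ X‖ := by rw [norm_mul, norm_mul, hn]; norm_num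
      rw [e]
      refine (norm_add_le _ _).trans ?_
      rw [q2]; linarith
    have r1 : 2 * ‖y₁ t‖ ≤ ‖y₁ t + ν * y₂ t‖ + ‖y₁ t - ν * y₂ t‖ := by
      have := norm_add_le (y₁ t + ν * y₂ t) (y₁ t - ν * y₂ t)
      rwa [show y₁ t + ν * y₂ t + (y₁ t - ν * y₂ t) = 2 * y₁ t by ring, norm_mul,
        show ‖(2 : ℂ)‖ = 2 by norm_num] at this
    have r2 : 2 * (n * ‖y₂ t‖) ≤ ‖y₁ t + ν * y₂ t‖ + ‖y₁ t - ν * y₂ t‖ := by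
      have := norm_sub_le (y₁ t + ν * y₂ t) (y₁ t - ν * y₂ t)
      rwa [show y₁ t + ν * y₂ t - (y₁ t - ν * y₂ t) = 2 * (ν * y₂ t) by ring, norm_mul, norm_mul,
        hn, show ‖(2 : ℂ)‖ = 2 by norm_num] at this
    have r3 : 6 * K + 4 * E ≤ n * (S / 2) := by
      have : 6 * K + 4 * E = (12 * slowConst γ M + 16 + 16 * M) * n * (n * S) := by
        rw [hK, hE]; ring
      rw [this]
      have hh : (12 * slowConst γ M + 16 + 16 * M) * n ≤ 1 / 2 := by
        linarith [mul_nonneg hC0 hn0.le, mul_nonneg hM0 hn0.le]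
      have := mul_le_mul_of_nonneg_right hh (by positivity : 0 ≤ n * S)
      linarith
    have r4 : ‖y₁ t‖ / n + ‖y₂ t‖ = (‖y₁ t‖ + n * ‖y₂ t‖) / n := by field_simp
    rw [r4, div_le_iff₀ hn0]
    linarith
  have hmain := main x hx
  have h1 : ‖y₁ x‖ ≤ ‖y₁ x‖ / n := by
    rw [le_div_iff₀ hn0]; nlinarith [norm_nonneg (y₁ x)]
  refine ⟨?_, by linarith⟩
  have h2 : ‖y₁ x‖ / n ≤ 4 * ‖y₂ X‖ := by linarith [norm_nonneg (y₂ x)]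
  rw [div_le_iff₀ hn0] at h2
  nlinarith [norm_nonneg (y₂ X)]

/-- On `[x₁, X]` the changes of `y₁` and `y₂` are governed by the integrals of `V` and `|y₁|`. From
`V ≤ v₊ - 2 V'`, the first is at most `2 V(x₁) + 8 μ³`. Starting from `y₁(X) = O(μ²)`, the length
`8/μ` makes the drift of `y₂` of order `V(x₁) + μ`. The bound on `m` is bootstrapped simultaneously.
-/
theorem DualCoords.near_bound (h : SmallEnd γ vp) (hp : IsProfile γ vp vhat)
    (hy : DualCoords vhat (fun x => gCoeff γ vp (vhat x) - vhat x) z y₁ y₂ m)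
    (h₁ : Tendsto y₁ atTop (𝓝 0)) (h₂ : Tendsto y₂ atTop (𝓝 0)) (hm : Tendsto m atTop (𝓝 0))
    (hz : 0 ≤ z.re) (hM : ‖z‖ ≤ M) (hμ0 : 0 < μ) (hμ : μ ^ 4 = vp)
    (hμM : 128 * (1 + M + slowConst γ M) * μ ^ 2 ≤ 1) (hX : vhat X = 2 * vp) {x₁ : ℝ}
    (hx₁ : x₁ ≤ X) (hL : X - x₁ ≤ 8 / μ) (hV₁ : vhat x₁ ≤ 1 / 8)
    (hsm : 650 * (M + 1) ^ 2 * (vhat x₁ + μ) ≤ 1 / 4) :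
    ‖y₁ x₁‖ ≤ 1300 * (M + 1) ^ 2 * (vhat x₁ + μ) * ‖y₂ X‖ ∧
    ‖y₂ x₁ - y₂ X‖ ≤ 1300 * (M + 1) ^ 2 * (vhat x₁ + μ) * ‖y₂ X‖ ∧
    ‖m x₁‖ ≤ 16 * ‖y₂ X‖ := by
  have hM0 : 0 ≤ M := (norm_nonneg _).trans hM
  have hvp := h.pos
  have hfar := fun {x : ℝ} (hx : X ≤ x) =>
    DualCoords.far_bound h hp hy h₁ h₂ hm hz hM hμ0 hμ hμM hX hx
  have hV8 : ∀ t ≥ x₁, vhat t ≤ 1 / 8 := fun t ht => (hp.antitone h ht).trans hV₁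
  have hμ1 : μ ≤ 1 := by
    have : 0 ≤ slowConst γ M := by
      have := h.one_le; rw [slowConst]; positivity
    nlinarith
  obtain ⟨D, hD⟩ : ∃ D, D = 650 * (M + 1) ^ 2 * (vhat x₁ + μ) := ⟨_, rfl⟩
  have hV0 : 0 < vhat x₁ := hp.pos x₁
  have hD0 : 0 ≤ D := by rw [hD]; positivity
  have step : ∀ S, (∀ x ∈ Set.Icc x₁ X, ‖y₁ x‖ + ‖y₂ x‖ ≤ S) → ∀ x ∈ Set.Icc x₁ X,
      ‖m x‖ ≤ 8 * S ∧ ‖y₁ x‖ ≤ D * S ∧ ‖y₂ x - y₂ X‖ ≤ D * S := by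
    intro S hS
    have hqS : ‖y₂ X‖ ≤ S := by
      linarith [hS X ⟨hx₁, le_rfl⟩, norm_nonneg (y₁ X)]
    have hS0 : 0 ≤ S := (norm_nonneg _).trans hqS
    have hmS : ∀ x ≥ x₁, ‖m x‖ ≤ 8 * S := by
      intro x hx
      have := hy.norm_m_le hz (H := 4 * S) (x := x)
        (fun t ht => le_gCoeff_sub h (hp.vp_le h t) (hV8 t (hx.le.trans ht))) (fun t ht => by
          refine (norm_add_le _ _).trans ?_
          rcases le_total t X with hh | hh
          · linarith [hS t ⟨hx.le.trans ht, hh⟩]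
          · linarith [(hfar hh).2]) hm
      linarith
    have hVd : ∀ t ≥ x₁, vhat t ≤ -(2 * (vhat t * profileRate γ vp (vhat t)) - vp) := by
      intro t ht
      have := hp.deriv_le h (x := t) (by linarith [hV8 t ht])
      linarith
    have hVm : ∀ t ≥ x₁, ‖z * vhat t * m t‖ ≤ 8 * M * S * vhat t := by
      intro t ht
      rw [norm_mul, norm_mul, Complex.norm_real, Real.norm_eq_abs, abs_of_pos (hp.pos t)]
      have := mul_le_mul (mul_le_mul_of_nonneg_right hM (hp.pos t).le) (hmS t ht) (norm_nonneg _)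
        (by have := hp.pos t; positivity)
      linarith
    have hψ : ∀ r, HasDerivAt (fun r => 2 * vhat r - vp * r)
        (2 * (vhat r * profileRate γ vp (vhat r)) - vp) r := fun r =>
      (((hp.hasDerivAt r).const_mul 2).sub ((hasDerivAt_id r).const_mul vp)).congr_deriv
        (by rw [mul_one])
    have hψb : ∀ x ∈ Set.Icc x₁ X, 2 * vhat x - vp * x - (2 * vhat X - vp * X)
        ≤ 2 * vhat x + 8 * μ ^ 3 := by
      intro x hx
      have h1 : vp * (X - x) ≤ vp * (8 / μ) := by
        refine mul_le_mul_of_nonneg_left ?_ hvp.le; linarith [hx.1]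
      have h2 : vp * (8 / μ) = 8 * μ ^ 3 := by rw [← hμ]; field_simp
      linarith [hp.pos X]
    have hy1 : ∀ x ∈ Set.Icc x₁ X,
        ‖y₁ x‖ ≤ S * (8 * μ ^ 2 + 64 * M * μ ^ 3 + 16 * M * vhat x) := by
      intro x hx
      have k := norm_sub_le_of_hasDerivAt hx.2 hy.d₁ (fun r => (hψ r).const_mul (8 * M * S))
        (fun t ht => by
          rw [norm_neg, ← mul_neg]
          exact (hVm t (hx.1.trans ht.1)).trans
            (mul_le_mul_of_nonneg_left (hVd t (hx.1.trans ht.1)) (by positivity)))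
      have k2 : ‖y₁ x‖ ≤ ‖y₁ X‖ + ‖y₁ X - y₁ x‖ := by
        have := norm_sub_le (y₁ X) (y₁ X - y₁ x)
        rwa [sub_sub_cancel] at this
      have k3 := mul_le_mul_of_nonneg_left (hψb x hx) (by positivity : 0 ≤ 8 * M * S)
      have k4 := (hfar le_rfl).1
      have k5 := mul_le_mul_of_nonneg_left hqS (by positivity : 0 ≤ 8 * μ ^ 2)
      linarith
    have hμ2 : μ ^ 2 ≤ μ := by nlinarith
    have hμ3 : μ ^ 3 ≤ μ := by nlinarith [sq_nonneg μ]
    have hMμ : 0 ≤ M * μ := by positivity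
    have hMV : 0 ≤ M * vhat x₁ := by positivity
    have hMMμ : 0 ≤ M ^ 2 * μ := by positivity
    have hMMV : 0 ≤ M ^ 2 * vhat x₁ := by positivity
    intro x hx
    refine ⟨hmS x hx.1, (hy1 x hx).trans ?_, ?_⟩
    · rw [mul_comm]
      refine mul_le_mul_of_nonneg_right ?_ hS0
      have : vhat x ≤ vhat x₁ := hp.antitone h hx.1
      have e1 : M * μ ^ 3 ≤ M * μ := mul_le_mul_of_nonneg_left hμ3 hM0
      have e2 : M * vhat x ≤ M * vhat x₁ := mul_le_mul_of_nonneg_left this hM0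
      rw [hD]
      linarith
    · obtain ⟨A, hA⟩ : ∃ A, A = 8 * M * μ ^ 2 + 64 * M ^ 2 * μ ^ 3 := ⟨_, rfl⟩
      obtain ⟨F, hF⟩ : ∃ F, F = 16 * M ^ 2 + 8 * M := ⟨_, rfl⟩
      have hA0 : 0 ≤ A := by rw [hA]; positivity
      have hF0 : 0 ≤ F := by rw [hF]; positivity
      have k := norm_sub_le_of_hasDerivAt hx.2 hy.d₂
        (φ := fun r => S * (F * (2 * vhat r - vp * r) - A * r))
        (fun r => (((hψ r).const_mul F).sub ((hasDerivAt_id r).const_mul A)).const_mul S)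
        (fun t ht => by
          have ht1 := hx.1.trans ht.1
          refine (norm_sub_le _ _).trans ?_
          rw [norm_neg, norm_mul]
          have m1 := mul_le_mul hM (hy1 t ⟨ht1, ht.2⟩) (norm_nonneg _) hM0
          have m2 := hVm t ht1
          have m3 := mul_le_mul_of_nonneg_left (hVd t ht1) (by positivity : 0 ≤ S * F)
          have m4 : M * (S * (8 * μ ^ 2 + 64 * M * μ ^ 3 + 16 * M * vhat t))
            + 8 * M * S * vhat t = S * A + S * F * vhat t := by rw [hA, hF]; ring
          linarith)
      rw [norm_sub_rev] at k
      refine k.trans ?_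
      have n1 := mul_le_mul_of_nonneg_left (hψb x hx) hF0
      have n2 : A * (X - x) ≤ A * (8 / μ) :=
        mul_le_mul_of_nonneg_left (by linarith [hx.1]) hA0
      have n3 : A * (8 / μ) = 64 * M * μ + 512 * M ^ 2 * μ ^ 2 := by
        rw [hA]; field_simp; ring
      have n4 : vhat x ≤ vhat x₁ := hp.antitone h hx.1
      have n5 : F * (2 * vhat x + 8 * μ ^ 3) ≤ F * (2 * vhat x₁ + 8 * μ) := by gcongr
      have n6 : M ^ 2 * μ ^ 2 ≤ M ^ 2 * μ := by gcongr
      have n7 : F * (2 * vhat x₁ + 8 * μ) + 64 * M * μ + 512 * M ^ 2 * μ ≤ D := by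
        rw [hD, hF]; linarith
      have n8 : F * (2 * vhat x - vp * x) - A * x - (F * (2 * vhat X - vp * X) - A * X) ≤ D := by
        linarith
      have n9 := mul_le_mul_of_nonneg_left n8 hS0
      linarith
  have hcont : ContinuousOn (fun t => ‖y₁ t‖ + ‖y₂ t‖) (Set.Icc x₁ X) := by
    have c1 : Continuous y₁ := continuous_iff_continuousAt.2 fun t => (hy.d₁ t).continuousAt
    have c2 : Continuous y₂ := continuous_iff_continuousAt.2 fun t => (hy.d₂ t).continuousAt
    fun_prop
  obtain ⟨B, hB⟩ := isCompact_Icc.bddAbove_image hcont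
  have hfin := le_two_mul_of_forall_bound (q := ‖y₂ X‖) (fun x hx => hB ⟨x, hx, rfl⟩)
    (fun S hS x hx => by
      obtain ⟨-, a1, a2⟩ := step S hS x hx
      have a3 : ‖y₂ x‖ ≤ ‖y₂ X‖ + ‖y₂ x - y₂ X‖ := by
        have := norm_add_le (y₂ X) (y₂ x - y₂ X)
        rwa [add_sub_cancel] at this
      have hS0 : 0 ≤ S := le_trans (by positivity) (hS x hx)
      have : D * S ≤ 1 / 4 * S := mul_le_mul_of_nonneg_right (hD ▸ hsm) hS0
      linarith)
  obtain ⟨b1, b2, b3⟩ := step _ hfin x₁ ⟨le_rfl, hx₁⟩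
  have e : D * (2 * ‖y₂ X‖) = 1300 * (M + 1) ^ 2 * (vhat x₁ + μ) * ‖y₂ X‖ := by rw [hD]; ring
  rw [e] at b2 b3
  exact ⟨b2, b3, by linarith⟩

end dual

/-! ### Dual modes of the eigenvalue system, including `z = 0`. -/

theorem norm_conjTranspose_mulVec_le {w φ M G : ℝ} {z : ℂ} (hw : |w| ≤ 1) (hφ : |φ| ≤ G)
    (hz : ‖z‖ ≤ M) (y : Fin 3 → ℂ) :
    ‖-((coeffMatrix w φ z).conjTranspose.mulVec y)‖ ≤ (2 + 2 * M + G) * ‖y‖ := by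
  have hM : 0 ≤ M := (norm_nonneg z).trans hz
  have hG : 0 ≤ G := (abs_nonneg φ).trans hφ
  have hn := norm_nonneg y
  have hb : ∀ {p : ℂ} {P : ℝ} (i : Fin 3), ‖p‖ ≤ P → ‖p * y i‖ ≤ P * ‖y‖ := by
    intro p P i hp
    rw [norm_mul]
    exact mul_le_mul hp (norm_le_pi_norm y i) (norm_nonneg _) ((norm_nonneg _).trans hp)
  have hz' : ‖star z‖ ≤ M := by rwa [norm_star]
  have hzw : ‖star z * (w : ℂ)‖ ≤ M := by
    rw [norm_mul, Complex.norm_real, Real.norm_eq_abs]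
    nlinarith [norm_nonneg (star z)]
  have hφz : ‖(φ : ℂ) - star z‖ ≤ G + M := by
    refine (norm_sub_le _ _).trans (add_le_add ?_ hz')
    rwa [Complex.norm_real, Real.norm_eq_abs]
  have hMn : 0 ≤ M * ‖y‖ := by positivity
  have hGn : 0 ≤ G * ‖y‖ := by positivity
  rw [norm_neg]
  refine (pi_norm_le_iff_of_nonneg (by positivity)).2 fun i => ?_
  fin_cases i
  · have : (coeffMatrix w φ z).conjTranspose.mulVec y 0 = star z * (w : ℂ) * y 2 := by
      simp [coeffMatrix, Matrix.mulVec, dotProduct, Fin.sum_univ_three, Matrix.conjTranspose]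
    simp only [Fin.zero_eta, this]
    nlinarith [hb 2 hzw]
  · have : (coeffMatrix w φ z).conjTranspose.mulVec y 1
        = star z * y 0 + star z * (w : ℂ) * y 2 := by
      simp [coeffMatrix, Matrix.mulVec, dotProduct, Fin.sum_univ_three, Matrix.conjTranspose]
    simp only [Fin.mk_one, this]
    refine (norm_add_le _ _).trans ?_
    nlinarith [hb 2 hzw, hb 0 hz']
  · have : (coeffMatrix w φ z).conjTranspose.mulVec y 2
        = 1 * y 0 + 1 * y 1 + ((φ : ℂ) - star z) * y 2 := by
      simp [coeffMatrix, Matrix.mulVec, dotProduct, Fin.sum_univ_three, Matrix.conjTranspose]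
    simp only [Fin.reduceFinMk, this]
    refine norm_add₃_le.trans ?_
    nlinarith [hb (P := 1) 0 (by simp : ‖(1 : ℂ)‖ ≤ 1), hb (P := 1) 1 (by simp : ‖(1 : ℂ)‖ ≤ 1),
      hb 2 hφz]

theorem SolvesAdjoint.eq_zero {γ vp : ℝ} {vhat : ℝ → ℝ} {Y : ℝ → Fin 3 → ℂ} {z : ℂ}
    (h : SmallEnd γ vp) (hp : IsProfile γ vp vhat)
    (hY : SolvesAdjoint (fun x => matA γ vp vhat x z) Y) {a : ℝ} (ha : Y a = 0) (b : ℝ) :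
    Y b = 0 := by
  refine eq_zero_of_norm_deriv_le (K := 2 + 2 * ‖z‖ + (γ + 1)) hY (fun x => ?_) ha b
  simp only [matA_eq]
  refine norm_conjTranspose_mulVec_le ?_ ?_ le_rfl _
  · rw [abs_of_pos (hp.pos x)]; exact hp.le_one h x
  · obtain ⟨h1, h2⟩ := gCoeff_sub_mem h (hp.vp_le h x)
    have h3 := hp.pos x
    have h4 := hp.le_one h x
    rw [abs_le]; constructor <;> linarith [h.one_le]

theorem SolvesAdjoint.dualCoords {γ vp : ℝ} {vhat : ℝ → ℝ} {Y : ℝ → Fin 3 → ℂ} {z : ℂ}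
    (hY : SolvesAdjoint (fun x => matA γ vp vhat x z) Y) :
    DualCoords vhat (fun x => gCoeff γ vp (vhat x) - vhat x) z
      (fun x => star (Y x 0)) (fun x => star (Y x 1)) (fun x => star (Y x 2)) := by
  simp only [matA_eq] at hY
  have hc := fun x => hY.hasDerivAt_coord (φ := fun x => vhat x - gCoeff γ vp (vhat x)) x
  refine ⟨fun x => (hc x).1, fun x => (hc x).2.1, fun x => (hc x).2.2.congr_deriv ?_⟩
  push_cast
  ring

theorem AnalyticOnNhd.continuousAt_star_coord {Wt : ℂ → ℝ → Fin 3 → ℂ} {x : ℝ}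
    (h : AnalyticOnNhd ℂ (fun z => star (Wt z x)) closedRHP) {z : ℂ} (hz : z ∈ closedRHP)
    (i : Fin 3) : ContinuousAt (fun z => star (Wt z x i)) z :=
  (continuous_apply i).continuousAt.comp (h z hz).continuousAt

/-- Decay is available only for `z ≠ 0`; the closed inequalities pass to `z = 0` along the positive
reals. They bound the whole vector at `x₁` by the second component at `X`, so that component cannot
vanish. -/
theorem IsDualMode.near_bound {γ vp M μ X x₁ : ℝ} {vhat : ℝ → ℝ} {Wt : ℂ → ℝ → Fin 3 → ℂ}
    (h : SmallEnd γ vp) (hp : IsProfile γ vp vhat) (hWt : IsDualMode (matA γ vp vhat) Wt)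
    (hM0 : 0 < M) (hμ0 : 0 < μ) (hμ : μ ^ 4 = vp)
    (hμM : 128 * (1 + M + slowConst γ M) * μ ^ 2 ≤ 1) (hX : vhat X = 2 * vp)
    (hx₁ : x₁ ≤ X) (hL : X - x₁ ≤ 8 / μ) (hV₁ : vhat x₁ ≤ 1 / 8)
    (hsm : 650 * (M + 1) ^ 2 * (vhat x₁ + μ) ≤ 1 / 4) {z : ℂ} (hz : z ∈ closedRHP)
    (hM : ‖z‖ ≤ M) :
    star (Wt z X 1) ≠ 0 ∧
    ‖star (Wt z x₁ 0)‖ ≤ 1300 * (M + 1) ^ 2 * (vhat x₁ + μ) * ‖star (Wt z X 1)‖ ∧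
    ‖star (Wt z x₁ 1) - star (Wt z X 1)‖
      ≤ 1300 * (M + 1) ^ 2 * (vhat x₁ + μ) * ‖star (Wt z X 1)‖ ∧
    ‖star (Wt z x₁ 2)‖ ≤ 16 * ‖star (Wt z X 1)‖ := by
  have hne : ∀ z ∈ closedRHP, z ≠ 0 → ‖z‖ ≤ M →
      ‖star (Wt z x₁ 0)‖ ≤ 1300 * (M + 1) ^ 2 * (vhat x₁ + μ) * ‖star (Wt z X 1)‖ ∧
      ‖star (Wt z x₁ 1) - star (Wt z X 1)‖
        ≤ 1300 * (M + 1) ^ 2 * (vhat x₁ + μ) * ‖star (Wt z X 1)‖ ∧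
      ‖star (Wt z x₁ 2)‖ ≤ 16 * ‖star (Wt z X 1)‖ := by
    intro z hz hz0 hM
    have hl : ∀ i, Tendsto (fun x => star (Wt z x i)) atTop (𝓝 0) := fun i => by
      simpa using (tendsto_coord (hWt.decays z hz hz0) i).star
    exact (hWt.solves z hz).dualCoords.near_bound h hp (hl 0) (hl 1) (hl 2) hz hM hμ0 hμ hμM hX
      hx₁ hL hV₁ hsm
  have hall : ‖star (Wt z x₁ 0)‖ ≤ 1300 * (M + 1) ^ 2 * (vhat x₁ + μ) * ‖star (Wt z X 1)‖ ∧
      ‖star (Wt z x₁ 1) - star (Wt z X 1)‖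
        ≤ 1300 * (M + 1) ^ 2 * (vhat x₁ + μ) * ‖star (Wt z X 1)‖ ∧
      ‖star (Wt z x₁ 2)‖ ≤ 16 * ‖star (Wt z X 1)‖ := by
    rcases eq_or_ne z 0 with rfl | hz0
    · have ht : Tendsto (fun t : ℝ => (t : ℂ)) (𝓝[>] 0) (𝓝 0) :=
        (Complex.continuous_ofReal.tendsto' 0 0 (by simp)).mono_left nhdsWithin_le_nhds
      have hc : ∀ x i, Tendsto (fun t : ℝ => star (Wt t x i)) (𝓝[>] 0) (𝓝 (star (Wt 0 x i))) :=
        fun x i => (AnalyticOnNhd.continuousAt_star_coord (hWt.analytic x) hz i).tendsto.comp ht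
      have hev : ∀ᶠ t : ℝ in 𝓝[>] 0, (t : ℂ) ∈ closedRHP ∧ (t : ℂ) ≠ 0 ∧ ‖(t : ℂ)‖ ≤ M := by
        filter_upwards [self_mem_nhdsWithin, Ioo_mem_nhdsGT hM0] with t ht0 ht1
        have ht0' : 0 < t := ht0
        refine ⟨by simpa [closedRHP] using ht0'.le, by exact_mod_cast ht0'.ne', ?_⟩
        rw [Complex.norm_real, Real.norm_eq_abs, abs_of_pos ht0']
        exact ht1.2.le
      refine ⟨?_, ?_, ?_⟩
      · exact le_of_tendsto_of_tendsto (hc x₁ 0).norm ((hc X 1).norm.const_mul _)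
          (hev.mono fun t ht => (hne t ht.1 ht.2.1 ht.2.2).1)
      · exact le_of_tendsto_of_tendsto ((hc x₁ 1).sub (hc X 1)).norm ((hc X 1).norm.const_mul _)
          (hev.mono fun t ht => (hne t ht.1 ht.2.1 ht.2.2).2.1)
      · exact le_of_tendsto_of_tendsto (hc x₁ 2).norm ((hc X 1).norm.const_mul _)
          (hev.mono fun t ht => (hne t ht.1 ht.2.1 ht.2.2).2.2)
    · exact hne z hz hz0 hM
  refine ⟨fun h0 => ?_, hall⟩
  rw [h0, norm_zero, mul_zero, mul_zero, norm_le_zero_iff, norm_le_zero_iff, sub_zero,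
    norm_le_zero_iff] at hall
  simp only [star_eq_zero] at hall
  refine hWt.ne_zero z hz ((hWt.solves z hz).eq_zero h hp (a := x₁) ?_ 0)
  funext i
  fin_cases i
  · exact hall.1
  · exact hall.2.1
  · exact hall.2.2

/-- Every Evans function can be computed from the translate of the profile normalized by the
value `1 / 2` at the origin. -/
theorem IsEvansFunction.exists_normalized {γ vp : ℝ} {D : ℂ → ℂ} (h : SmallEnd γ vp)
    (hD : IsEvansFunction γ vp D) :
    ∃ (vhat : ℝ → ℝ) (W Wt : ℂ → ℝ → Fin 3 → ℂ), IsProfile γ vp vhat ∧ vhat 0 = 1 / 2 ∧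
      IsUnstableMode (matA γ vp vhat) W ∧ IsDualMode (matA γ vp vhat) Wt ∧
      ∀ z ∈ closedRHP, ∀ x, D z = dotProduct (star (Wt z x)) (W z x) := by
  obtain ⟨vhat, W, Wt, hp, hW, hWt, hDz⟩ := hD
  obtain ⟨ξ, hξ⟩ := hp.exists_eq h (w := 1 / 2) (by linarith [h.le_sixteenth]) (by norm_num)
  have hadd : ∀ x : ℝ, HasDerivAt (fun x => x + ξ) 1 x := fun x => (hasDerivAt_id x).add_const ξ
  refine ⟨fun x => vhat (x + ξ), fun z x => W z (x + ξ), fun z x => Wt z (x + ξ), hp.shift ξ,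
    by simpa using hξ, ⟨?_, ?_, ?_, ?_⟩, ⟨?_, ?_, ?_, ?_⟩, ?_⟩
  · intro z hz x
    exact ((hW.solves z hz (x + ξ)).scomp x (hadd x)).congr_deriv (one_smul _ _)
  · intro z hz
    simpa using (hW.modeFamily h hp).ne_zero_at hz (0 + ξ)
  · intro z hz
    exact (hW.decays z hz).comp (tendsto_atBot_add_const_right _ ξ tendsto_id)
  · exact fun x => hW.analytic (x + ξ)
  · intro z hz x
    exact ((hWt.solves z hz (x + ξ)).scomp x (hadd x)).congr_deriv (one_smul _ _)
  · intro z hz h0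
    exact hWt.ne_zero z hz ((hWt.solves z hz).eq_zero h hp h0 0)
  · intro z hz hz0
    exact (hWt.decays z hz hz0).comp (tendsto_atTop_add_const_right _ ξ tendsto_id)
  · exact fun x => hWt.analytic (x + ξ)
  · intro z hz x
    rw [hDz z hz]
    exact dotProduct_star_const (hW.solves z hz) (hWt.solves z hz) 0 (x + ξ)

/-! ### Matching at `x₁` and uniform approximation. -/

/-- A dual vector close to `q (0, 1, bounded)` reads off the second component of the mode; the
merely bounded third entry is harmless because the mode is small there. -/
theorem norm_pairing_sub_le {y w w₀ : Fin 3 → ℂ} {q d : ℂ} {η A B E : ℝ} (hq : q ≠ 0)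
    (hη : 0 ≤ η) (hy₀ : ‖y 0‖ ≤ η * ‖q‖) (hy₁ : ‖y 1 - q‖ ≤ η * ‖q‖) (hy₂ : ‖y 2‖ ≤ 16 * ‖q‖)
    (hw : ‖w - w₀‖ ≤ E) (h₀ : ‖w₀ 0‖ ≤ A) (h₁ : ‖w₀ 1‖ ≤ A) (h₂ : ‖w₀ 2‖ ≤ B)
    (hd : ‖w₀ 1 - d‖ ≤ B) :
    ‖dotProduct y w / q - d‖ ≤ η * (2 * A + 2 * E) + 17 * B + 17 * E := by
  have hqp : 0 < ‖q‖ := norm_pos_iff.2 hq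
  have hwi : ∀ i, ‖w i - w₀ i‖ ≤ E := fun i => (norm_le_pi_norm (w - w₀) i).trans hw
  have hwn : ∀ i C, ‖w₀ i‖ ≤ C → ‖w i‖ ≤ C + E := fun i C hC => by
    have := norm_add_le (w₀ i) (w i - w₀ i)
    rw [add_sub_cancel] at this
    linarith [hwi i]
  have hdiv : ∀ {p : ℂ} {c : ℝ}, ‖p‖ ≤ c * ‖q‖ → ‖p / q‖ ≤ c := fun hp => by
    rw [norm_div, div_le_iff₀ hqp]; exact hp
  have e : dotProduct y w / q - d = y 0 / q * w 0 + (y 1 - q) / q * w 1 + y 2 / q * w 2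
      + (w 1 - w₀ 1) + (w₀ 1 - d) := by
    simp only [dotProduct, Fin.sum_univ_three]; field_simp; ring
  have hA : 0 ≤ A := (norm_nonneg _).trans h₀
  have a0 : ‖y 0 / q * w 0‖ ≤ η * (A + E) := by
    rw [norm_mul]; exact mul_le_mul (hdiv hy₀) (hwn 0 A h₀) (norm_nonneg _) hη
  have a1 : ‖(y 1 - q) / q * w 1‖ ≤ η * (A + E) := by
    rw [norm_mul]; exact mul_le_mul (hdiv hy₁) (hwn 1 A h₁) (norm_nonneg _) hη
  have a2 : ‖y 2 / q * w 2‖ ≤ 16 * (B + E) := by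
    rw [norm_mul]; exact mul_le_mul (hdiv hy₂) (hwn 2 B h₂) (norm_nonneg _) (by norm_num)
  rw [e]
  refine (norm_add_le _ _).trans ?_
  have := norm_add_le (y 0 / q * w 0 + (y 1 - q) / q * w 1 + y 2 / q * w 2) (w 1 - w₀ 1)
  have := norm_add₃_le (a := y 0 / q * w 0) (b := (y 1 - q) / q * w 1) (c := y 2 / q * w 2)
  linarith [hwi 1]

theorem eventually_smallEnd {γ : ℝ} (hγ : 1 ≤ γ) : ∀ᶠ vp : ℝ in 𝓝[>] 0, SmallEnd γ vp := by
  have h1 : Tendsto (fun vp : ℝ => vp * (γ * 2 ^ γ)) (𝓝[>] 0) (𝓝 0) :=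
    ((continuous_id.mul continuous_const).tendsto' 0 0 (by simp)).mono_left nhdsWithin_le_nhds
  filter_upwards [self_mem_nhdsWithin, h1.eventually (ge_mem_nhds (by norm_num : (0 : ℝ) < 1 / 16))]
    with vp h0 h2
  exact ⟨hγ, h0, h2⟩

/-- The rate of approach of the normalized profile to 1 does not depend on `v₊`, so one `x₀` serves
the limiting system and all small `v₊`. -/
theorem exists_nearEnd {γ τ : ℝ} (hτ : 0 < τ) : ∃ x₀ ≤ 0,
    NearEnd limProfile (fun x => 1 - limProfile x) τ x₀ ∧
    ∀ᶠ vp : ℝ in 𝓝[>] 0, ∀ vhat, SmallEnd γ vp → IsProfile γ vp vhat → vhat 0 = 1 / 2 →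
      NearEnd vhat (fun x => gCoeff γ vp (vhat x)) τ x₀ := by
  have hl : Tendsto (fun x : ℝ => Real.exp (x / 4)) atBot (𝓝 0) :=
    Real.tendsto_exp_atBot.comp (tendsto_id.atBot_div_const (by norm_num))
  obtain ⟨x₀, hx₀, hx₀'⟩ := ((hl.eventually (ge_mem_nhds hτ)).and (eventually_le_atBot 0)).exists
  have hmono : ∀ x ≤ x₀, Real.exp (x / 4) ≤ τ := fun x hx =>
    (Real.exp_le_exp.2 (by linarith)).trans hx₀
  refine ⟨x₀, hx₀', fun x hx => ?_, ?_⟩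
  · have h1 := limProfile_pos x
    have h2 := limProfile_lt_one x
    have h3 := one_sub_limProfile_le_exp x
    have h4 : Real.exp x ≤ Real.exp (x / 4) := Real.exp_le_exp.2 (by linarith)
    have h5 := hmono x hx
    refine ⟨h1.le, h2.le, by linarith, ?_⟩
    rw [abs_of_nonneg (by linarith)]; linarith
  · have h1 : Tendsto (fun vp : ℝ => vp * (γ * 2 ^ γ)) (𝓝[>] 0) (𝓝 0) :=
      ((continuous_id.mul continuous_const).tendsto' 0 0 (by simp)).mono_left nhdsWithin_le_nhds
    filter_upwards [h1.eventually (ge_mem_nhds (half_pos hτ))] with vp hvp vhat h hp h0 x hx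
    have hx' : x ≤ 0 := hx.trans hx₀'
    have a1 := hp.one_sub_le h h0 hx'
    have a2 := gCoeff_sub_le_of_rpow_le h
      (Real.one_le_rpow one_le_two (by linarith [h.one_le] : 0 ≤ γ))
      (rpow_neg_le_two_rpow h (hp.half_le h h0 hx'))
    have a3 := (gCoeff_sub_mem h (hp.vp_le h x)).1
    have a4 := hmono x hx
    have a5 := hp.le_one h x
    refine ⟨(hp.pos x).le, a5, by linarith [Real.exp_pos (x / 4)], ?_⟩
    rw [abs_of_nonneg (by linarith)]; linarith

theorem abs_le_sixteen_mul_exp (x : ℝ) : |x| ≤ 16 * Real.exp (|x| / 16) := by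
  linarith [Real.add_one_le_exp (|x| / 16)]

/-- The profile error grows linearly in `|x|`; it is put under the weight `exp (|x| / 16)` tolerated
by the comparison of modes. The coefficient `g` adds one further unit to the 16. -/
theorem IsProfile.coeff_sub_lim_le {γ vp : ℝ} {vhat : ℝ → ℝ} (h : SmallEnd γ vp)
    (hp : IsProfile γ vp vhat) (h0 : vhat 0 = 1 / 2) {x R : ℝ} (hR : 0 ≤ R) (hx : x ≤ R) :
    |vhat x - limProfile x| ≤ 17 * (γ * (2 * Real.exp R) ^ γ) * vp * Real.exp (|x| / 16) ∧
    |gCoeff γ vp (vhat x) - (1 - limProfile x)|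
      ≤ 17 * (γ * (2 * Real.exp R) ^ γ) * vp * Real.exp (|x| / 16) := by
  have hγ := h.one_le
  have hvp := h.pos
  have a1 := hp.abs_sub_limProfile_le h h0 hR hx
  have a2 := abs_le_sixteen_mul_exp x
  have a3 : 1 ≤ Real.exp (|x| / 16) := Real.one_le_exp (by positivity)
  obtain ⟨K, hK⟩ : ∃ K, K = vp * (γ * (2 * Real.exp R) ^ γ) := ⟨_, rfl⟩
  have hK0 : 0 ≤ K := by rw [hK]; positivity
  have hB : (1 : ℝ) ≤ (2 * Real.exp R) ^ γ :=
    Real.one_le_rpow (by linarith [Real.one_le_exp hR]) (by linarith)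
  have a4 := gCoeff_sub_le_of_rpow_le h hB (hp.rpow_neg_le h h0 hR hx)
  have a5 := (gCoeff_sub_mem h (hp.vp_le h x)).1
  rw [← hK] at a1 a4
  have e : 17 * (γ * (2 * Real.exp R) ^ γ) * vp * Real.exp (|x| / 16)
      = 17 * K * Real.exp (|x| / 16) := by rw [hK]; ring
  rw [e]
  have a6 : K * |x| ≤ K * (16 * Real.exp (|x| / 16)) := mul_le_mul_of_nonneg_left a2 hK0
  have a7 : K * 1 ≤ K * Real.exp (|x| / 16) := mul_le_mul_of_nonneg_left a3 hK0
  obtain ⟨b1, b2⟩ := abs_le.1 a1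
  refine ⟨by linarith, abs_le.2 ⟨by linarith, by linarith⟩⟩

/-- Uniform approximation of the limiting Evans function by renormalized Evans functions. -/
theorem exists_uniform_approximation {γ M κ x₀ : ℝ} {W₀ : ℂ → ℝ → Fin 3 → ℂ} {D₀ : ℂ → ℂ}
    (hγ : 1 ≤ γ) (hM0 : 0 < M) (hW₀ : IsUnstableMode matA0 W₀)
    (hD₀ : ∀ z ∈ closedRHP, Tendsto (fun x => W₀ z x 1) atTop (𝓝 (D₀ z)))
    (hκ : 0 < κ) (hκM : κ * (2 + M) ≤ 1 / 200) (hx₀ : x₀ ≤ 0)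
    (hNE₀ : NearEnd limProfile (fun x => 1 - limProfile x) κ x₀)
    (hNE : ∀ᶠ vp : ℝ in 𝓝[>] 0, ∀ vhat, SmallEnd γ vp → IsProfile γ vp vhat → vhat 0 = 1 / 2 →
      NearEnd vhat (fun x => gCoeff γ vp (vhat x)) κ x₀) {ε : ℝ} (hε : 0 < ε) :
    ∀ᶠ vp : ℝ in 𝓝[>] 0, ∀ D, IsEvansFunction γ vp D → ∃ H : ℂ → ℂ,
      ∀ z ∈ closedRHP, ‖z‖ ≤ M → AnalyticAt ℂ H z ∧ (D z = 0 ↔ H z = 0) ∧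
        ‖H z - D₀ z / W₀ z x₀ 0‖ ≤ ε := by
  have hF₀ := hW₀.modeFamily_lim hγ
  obtain ⟨C, x₂, hC0, hx₂, hC⟩ :=
    exists_norm_normalized_sub_limEvans_le hF₀ hNE₀ hκM hκ hκM hM0.le hD₀
  obtain ⟨L, hLe⟩ : ∃ L, L = 1300 * (M + 1) ^ 2 := ⟨_, rfl⟩
  -- choice of the matching point
  have hexp : ∀ c : ℝ, 0 < c → Tendsto (fun x : ℝ => Real.exp (-(c * x))) atTop (𝓝 0) :=
    fun c hc => tendsto_exp_neg_mul hc
  have t1 : Tendsto (fun x : ℝ => L * Real.exp (-(3 / 4 * x)) * (2 * C)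
      + 17 * (C * Real.exp (-(1 / 2 * x)))) atTop (𝓝 0) := by
    have := (((hexp (3 / 4) (by norm_num)).const_mul L).mul_const (2 * C)).add
      (((hexp (1 / 2) (by norm_num)).const_mul C).const_mul 17)
    simpa using this
  have t2 : Tendsto (fun x : ℝ => (L / 2 + 1) * Real.exp (-(1 * x))) atTop (𝓝 0) := by
    simpa using (hexp 1 one_pos).const_mul (L / 2 + 1)
  -- `t1` is the final error with `v₊ = 0`: the dual error `exp (-x₁)` times the growth `exp
  -- (x₁/4)`, plus the tail of the limiting mode. Fixing `x₁` here lets all later constants depend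
  -- on it.
  obtain ⟨x₁, ⟨hx₁a, hx₁b⟩, hx₁c, hx₁d⟩ :=
    (((t1.eventually (gt_mem_nhds hε)).and (t2.eventually (gt_mem_nhds (by norm_num :
      (0 : ℝ) < 1 / 16)))).and ((eventually_ge_atTop x₂).and (eventually_ge_atTop 0))).exists
  obtain ⟨C', hC'0, hC'⟩ := ModeFamily.exists_norm_normalized_sub_le (γ + 1) M κ x₀ x₁
    (by linarith) hM0.le hκ hκM hx₀ (hx₂.trans hx₁c)
  obtain ⟨K, hK⟩ : ∃ K, K = 17 * (γ * (2 * Real.exp x₁) ^ γ) := ⟨_, rfl⟩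
  have hK0 : 0 ≤ K := by rw [hK]; positivity
  have hL0 : 0 < L := by rw [hLe]; positivity
  -- smallness of the parameter
  have c4 : Continuous fun vp : ℝ => vp ^ (1 / 4 : ℝ) :=
    Real.continuous_rpow_const (by norm_num)
  have lim : ∀ {f : ℝ → ℝ}, Continuous f → Tendsto f (𝓝[>] 0) (𝓝 (f 0)) := fun hf =>
    hf.continuousAt.tendsto.mono_left nhdsWithin_le_nhds
  have z4 : (0 : ℝ) ^ (1 / 4 : ℝ) = 0 := Real.zero_rpow (by norm_num)
  have e1 : ∀ᶠ vp : ℝ in 𝓝[>] 0, Real.exp (-x₁) + K * vp * Real.exp (|x₁| / 16) < 1 / 8 := by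
    refine (lim (f := fun vp => Real.exp (-x₁) + K * vp * Real.exp (|x₁| / 16))
      (by fun_prop)).eventually (gt_mem_nhds ?_)
    rw [one_mul] at hx₁b
    simp only [mul_zero, zero_mul, add_zero]
    nlinarith [Real.exp_pos (-x₁)]
  have e2 : ∀ᶠ vp : ℝ in 𝓝[>] 0, L / 2 * (Real.exp (-x₁) + K * vp * Real.exp (|x₁| / 16)
      + vp ^ (1 / 4 : ℝ)) < 1 / 4 := by
    refine (lim (f := fun vp => L / 2 * (Real.exp (-x₁) + K * vp * Real.exp (|x₁| / 16)
      + vp ^ (1 / 4 : ℝ))) (by fun_prop)).eventually (gt_mem_nhds ?_)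
    rw [one_mul] at hx₁b
    simp only [mul_zero, zero_mul, add_zero, z4]
    nlinarith [Real.exp_pos (-x₁)]
  have e3 : ∀ᶠ vp : ℝ in 𝓝[>] 0,
      128 * (1 + M + slowConst γ M) * (vp ^ (1 / 4 : ℝ)) ^ 2 < 1 := by
    refine (lim (f := fun vp => 128 * (1 + M + slowConst γ M) * (vp ^ (1 / 4 : ℝ)) ^ 2)
      (by fun_prop)).eventually (gt_mem_nhds ?_)
    simp
  have e4 : ∀ᶠ vp : ℝ in 𝓝[>] 0, 2 * vp < 1 / 2 * Real.exp (-x₁) := by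
    refine (lim (f := fun vp => 2 * vp) (by fun_prop)).eventually (gt_mem_nhds ?_)
    simp [Real.exp_pos]
  have e5 : ∀ᶠ vp : ℝ in 𝓝[>] 0, L * (Real.exp (-x₁) + K * vp * Real.exp (|x₁| / 16)
      + vp ^ (1 / 4 : ℝ)) * (2 * (C * Real.exp (x₁ / 4)) + 2 * (C' * (K * vp)))
      + 17 * (C * Real.exp (-(x₁ / 2))) + 17 * (C' * (K * vp)) < ε := by
    refine (lim (f := fun vp => L * (Real.exp (-x₁) + K * vp * Real.exp (|x₁| / 16)
      + vp ^ (1 / 4 : ℝ)) * (2 * (C * Real.exp (x₁ / 4)) + 2 * (C' * (K * vp)))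
      + 17 * (C * Real.exp (-(x₁ / 2))) + 17 * (C' * (K * vp)))
      (by fun_prop)).eventually (gt_mem_nhds ?_)
    simp only [mul_zero, zero_mul, add_zero, z4]
    refine lt_of_eq_of_lt ?_ hx₁a
    have : Real.exp (-(3 / 4 * x₁)) = Real.exp (-x₁) * Real.exp (x₁ / 4) := by
      rw [← Real.exp_add]; ring_nf
    rw [this, show -(1 / 2 * x₁) = -(x₁ / 2) by ring]
    ring
  filter_upwards [e1, e2, e3, e4, e5, hNE, eventually_smallEnd hγ, self_mem_nhdsWithin]
    with vp h1 h2 h3 h4 h5 hNEv h hvp D hD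
  have hvp0 : 0 < vp := hvp
  obtain ⟨vhat, W, Wt, hp, h0, hW, hWt, hDz⟩ := hD.exists_normalized h
  obtain ⟨μ, hμe⟩ : ∃ μ, μ = vp ^ (1 / 4 : ℝ) := ⟨_, rfl⟩
  rw [← hμe] at h2 h3 h5
  have hμ0 : 0 < μ := hμe ▸ Real.rpow_pos_of_pos hvp0 _
  have hμ4 : μ ^ 4 = vp := by
    rw [hμe, ← Real.rpow_natCast, ← Real.rpow_mul hvp0.le]; norm_num
  have hclose := fun {x : ℝ} (hx : x ≤ x₁) => hp.coeff_sub_lim_le h h0 hx₁d hx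
  rw [← hK] at hclose
  have hV₁ : vhat x₁ ≤ Real.exp (-x₁) + K * vp * Real.exp (|x₁| / 16) := by
    linarith [(abs_le.1 (hclose le_rfl).1).2, limProfile_le_exp x₁]
  have hV₁8 : vhat x₁ ≤ 1 / 8 := by linarith
  obtain ⟨X, hX₁, hXe, hXL⟩ := hp.exists_eq_two_mul h (x := x₁) (by linarith)
    (by linarith [hp.half_exp_neg_le_of_le h h0 hx₁d le_rfl])
  have hL8 : X - x₁ ≤ 8 / μ := by
    refine hXL.trans (le_of_eq ?_)
    rw [Real.rpow_neg hvp0.le, hμe]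
    exact (div_eq_mul_inv _ _).symm
  have hL : L * (vhat x₁ + μ) ≤ L * (Real.exp (-x₁) + K * vp * Real.exp (|x₁| / 16) + μ) :=
    mul_le_mul_of_nonneg_left (by linarith) hL0.le
  have hdual := fun {z : ℂ} (hz : z ∈ closedRHP) (hM : ‖z‖ ≤ M) =>
    hWt.near_bound h hp hM0 hμ0 hμ4 h3.le hXe hX₁ hL8 hV₁8
      (by rw [show (650 : ℝ) * (M + 1) ^ 2 = L / 2 by rw [hLe]; ring]; linarith) hz hM
  rw [← hLe] at hdual
  have hF := hW.modeFamily h hp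
  have hne : ∀ z ∈ closedRHP, ‖z‖ ≤ M → W z x₀ 0 ≠ 0 := fun z hz hM =>
    hF.u_ne_zero (hNEv vhat h hp h0) hκM hκ hκM hz hM
  -- The pairing is independent of the place, so this is `D` divided by the nonvanishing analytic
  -- factors `W z x₀ 0` and `star (Wt z X 1)`.
  refine ⟨fun z => dotProduct (star (Wt z x₁)) (normalized x₀ (W z) x₁) / star (Wt z X 1),
    fun z hz hM => ?_⟩
  obtain ⟨hq, hb0, hb1, hb2⟩ := hdual hz hM
  have han : ∀ x i, AnalyticAt ℂ (fun z => star (Wt z x i)) z := fun x i =>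
    (ContinuousLinearMap.proj (R := ℂ) (φ := fun _ : Fin 3 => ℂ) i).analyticAt _ |>.comp
      (hWt.analytic x z hz)
  refine ⟨?_, ?_, ?_⟩
  · refine AnalyticAt.div ?_ (han X 1) hq
    have hn := fun i => hF.analyticAt_normalized (hNEv vhat h hp h0) hκM hκ hκM hz hM x₁ i
    have := (((han x₁ 0).mul (hn 0)).add ((han x₁ 1).mul (hn 1))).add ((han x₁ 2).mul (hn 2))
    refine this.congr (Eventually.of_forall fun w => ?_)
    simp [dotProduct, Fin.sum_univ_three]
  · rw [hDz z hz x₁, div_eq_zero_iff, or_iff_left hq, normalized, dotProduct_smul, smul_eq_zero,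
      or_iff_right (inv_ne_zero (hne z hz hM))]
  · have hw := hC' vhat _ limProfile _ W W₀ κ (K * vp) z hF hF₀ (hNEv vhat h hp h0) hNE₀ hκM
      (by positivity) (fun x hx => (hclose hx).1) (fun x hx => (hclose hx).2) hz hM
    obtain ⟨g0, g1, g2, g3⟩ := hC z hz hM x₁ hx₁c
    have hVp := hp.pos x₁
    refine (norm_pairing_sub_le hq (by positivity) hb0 hb1 hb2 hw g0 g1 g2 g3).trans ?_
    refine le_trans ?_ h5.le
    have : 0 ≤ 2 * (C * Real.exp (x₁ / 4)) + 2 * (C' * (K * vp)) := by positivity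
    have := mul_le_mul_of_nonneg_right hL this
    linarith

/-! ### Hurwitz' theorem and conclusion. -/

theorem isPreconnected_halfDisc (M : ℝ) : IsPreconnected {z : ℂ | 0 < z.re ∧ ‖z‖ < M} := by
  have : {z : ℂ | 0 < z.re ∧ ‖z‖ < M} = {z : ℂ | 0 < z.re} ∩ Metric.ball 0 M := by
    ext z; simp
  rw [this]
  exact ((convex_halfSpace_re_gt 0).inter (convex_ball 0 M)).isPreconnected

/-- A qualitative form of Hurwitz' theorem, by the maximum principle. -/
theorem norm_center_ge {H : ℂ → ℂ} {z : ℂ} {r c : ℝ} (hr : 0 < r) (hc : 0 < c)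
    (hH : ∀ w ∈ Metric.closedBall z r, DifferentiableAt ℂ H w)
    (hH0 : ∀ w ∈ Metric.closedBall z r, H w ≠ 0) (hs : ∀ w ∈ Metric.sphere z r, c ≤ ‖H w‖) :
    c ≤ ‖H z‖ := by
  have hd : DiffContOnCl ℂ (fun w => (H w)⁻¹) (Metric.ball z r) := by
    refine DifferentiableOn.diffContOnCl fun w hw => ?_
    rw [closure_ball z hr.ne'] at hw
    exact ((hH w hw).inv (hH0 w hw)).differentiableWithinAt
  have := Complex.norm_le_of_forall_mem_frontier_norm_le Metric.isBounded_ball hd (C := c⁻¹)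
    (fun w hw => by
      rw [frontier_ball z hr.ne'] at hw
      rw [norm_inv]
      exact inv_anti₀ hc (hs w hw)) (subset_closure (Metric.mem_ball_self hr))
  rw [norm_inv] at this
  exact (inv_le_inv₀ (norm_pos_iff.2 (hH0 z (Metric.mem_closedBall_self hr.le))) hc).1 this

/-- A holomorphic limit of nonvanishing functions that is not identically zero. -/
theorem ne_zero_of_approximation {U Ω : Set ℂ} {F : ℂ → ℂ} (hU : IsOpen U)
    (hUc : IsPreconnected U) (hF : DifferentiableOn ℂ F U) (hF0 : ∃ w ∈ U, F w ≠ 0)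
    (hΩ : IsOpen Ω) (hΩU : Ω ⊆ U)
    (happ : ∀ ε > 0, ∃ H : ℂ → ℂ, ∀ z ∈ Ω, DifferentiableAt ℂ H z ∧ H z ≠ 0 ∧ ‖H z - F z‖ ≤ ε)
    {z : ℂ} (hz : z ∈ Ω) : F z ≠ 0 := by
  intro hFz
  have han : AnalyticOnNhd ℂ F U := hF.analyticOnNhd hU
  rcases (han z (hΩU hz)).eventually_eq_zero_or_eventually_ne_zero with h | h
  · obtain ⟨w, hw, hw0⟩ := hF0
    exact hw0 (han.eqOn_zero_of_preconnected_of_eventuallyEq_zero hUc (hΩU hz) h hw)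
  · rw [eventually_nhdsWithin_iff] at h
    obtain ⟨r, hr, hr2⟩ := Metric.nhds_basis_closedBall.eventually_iff.1
      (h.and (hΩ.eventually_mem hz))
    have hsub : Metric.closedBall z r ⊆ Ω := fun w hw => (hr2 hw).2
    have hcont : ContinuousOn (fun w => ‖F w‖) (Metric.sphere z r) := fun w hw =>
      ((han w (hΩU (hsub (Metric.sphere_subset_closedBall hw)))).continuousAt.norm).continuousWithinAt
    obtain ⟨w₀, hw₀, hmin⟩ := (isCompact_sphere z r).exists_isMinOn
      ((NormedSpace.sphere_nonempty (x := z)).2 hr.le) hcont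
    have hw₀F : F w₀ ≠ 0 := (hr2 (Metric.sphere_subset_closedBall hw₀)).1
      (Metric.ne_of_mem_sphere hw₀ hr.ne')
    have hm := norm_pos_iff.2 hw₀F
    -- With error one third of the minimum on the circle, `H` has modulus at least two thirds of it
    -- on the circle but at most one third at the supposed zero of `F`, against the maximum
    -- principle for `1/H`.
    obtain ⟨H, hH⟩ := happ (‖F w₀‖ / 3) (by positivity)
    have hcen := norm_center_ge (H := H) (c := 2 * ‖F w₀‖ / 3) hr (by positivity)
      (fun w hw => (hH w (hsub hw)).1) (fun w hw => (hH w (hsub hw)).2.1) (fun w hw => by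
        have h1 := (hH w (hsub (Metric.sphere_subset_closedBall hw))).2.2
        have h2 : ‖F w₀‖ ≤ ‖F w‖ := hmin hw
        have h3 := norm_sub_norm_le (F w) (H w)
        rw [norm_sub_rev] at h3
        linarith)
    have h4 := (hH z hz).2.2
    rw [hFz, sub_zero] at h4
    linarith

theorem IsLimitingEvansFunction.exists_mode {D₀ : ℂ → ℂ} (h : IsLimitingEvansFunction D₀) :
    ∃ W₀, IsUnstableMode matA0 W₀ ∧
      (∀ z ∈ closedRHP, Tendsto (fun x => W₀ z x 1) atTop (𝓝 (D₀ z))) ∧ D₀ 0 ≠ 0 := by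
  obtain ⟨W, Wt, hW, hWt, hD⟩ := h
  have hl : ∀ z ∈ closedRHP, Tendsto (fun x => W z x 1) atTop (𝓝 (D₀ z)) := fun z hz => by
    rw [hD z hz]
    exact tendsto_limEvans hz (hW.solves z hz) (hWt z hz).1 (hWt z hz).2
  have h0 : (0 : ℂ) ∈ closedRHP := by simp [closedRHP]
  exact ⟨W, hW, hl, limEvans_zero_ne_zero (hW.solves 0 h0) (hW.ne_zero 0 h0) (hW.decays 0 h0)
    (hl 0 h0)⟩

/-- The nonvanishing is known at the boundary point 0, where the identity theorem does not apply;
one-sided continuity moves it into the open half-disc. -/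
theorem exists_halfDisc_ne_zero {F : ℂ → ℂ} {M : ℝ} (hM : 0 < M)
    (hF : ContinuousOn F {z | z ∈ closedRHP ∧ ‖z‖ ≤ M}) (h0 : F 0 ≠ 0) :
    ∃ w ∈ {z : ℂ | 0 < z.re ∧ ‖z‖ < M}, F w ≠ 0 := by
  have ht : Tendsto (fun t : ℝ => (t : ℂ)) (𝓝[>] 0) (𝓝 0) :=
    (Complex.continuous_ofReal.tendsto' 0 0 (by simp)).mono_left nhdsWithin_le_nhds
  have hU : ∀ᶠ t : ℝ in 𝓝[>] 0, (t : ℂ) ∈ {z : ℂ | 0 < z.re ∧ ‖z‖ < M} := by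
    filter_upwards [self_mem_nhdsWithin, Ioo_mem_nhdsGT hM] with t ht0 ht1
    have ht0' : 0 < t := ht0
    refine ⟨by simpa using ht0', ?_⟩
    rw [Complex.norm_real, Real.norm_eq_abs, abs_of_pos ht0']
    exact ht1.2
  have hc : Tendsto (fun t : ℝ => F t) (𝓝[>] 0) (𝓝 (F 0)) := by
    refine (hF 0 ⟨by simp [closedRHP], by simpa using hM.le⟩).tendsto.comp
      (tendsto_nhdsWithin_iff.2 ⟨ht, hU.mono fun t h => ⟨h.1.le, h.2.le⟩⟩)
  obtain ⟨t, h1, h2⟩ := ((hc.eventually_ne h0).and hU).exists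
  exact ⟨t, h2, h1⟩

end IsentropicShock

theorem corollary3p2 (γ : ℝ) (hγ : 1 ≤ γ) (Λ : Set ℂ) (hΛ : IsCompact Λ)
    (hΛre : ∀ z ∈ Λ, 0 ≤ z.re) (D₀ : ℂ → ℂ)
    (hD₀ : IsentropicShock.IsLimitingEvansFunction D₀) :
    ((∀ z ∈ Λ, D₀ z ≠ 0) →
      ∃ δ : ℝ, 0 < δ ∧ ∀ vp : ℝ, 0 < vp → vp < δ →
        ∀ D : ℂ → ℂ, IsentropicShock.IsEvansFunction γ vp D → ∀ z ∈ Λ, D z ≠ 0) ∧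
    ((∀ δ : ℝ, 0 < δ → ∃ vp : ℝ, 0 < vp ∧ vp < δ ∧
        ∃ D : ℂ → ℂ, IsentropicShock.IsEvansFunction γ vp D ∧ ∀ z ∈ interior Λ, D z ≠ 0) →
      ∀ z ∈ interior Λ, D₀ z ≠ 0) := by
  open IsentropicShock in
  obtain ⟨W₀, hW₀, hl, hD00⟩ := hD₀.exists_mode
  obtain ⟨B, hB⟩ := hΛ.isBounded.exists_norm_le
  obtain ⟨M, hMe⟩ : ∃ M, M = |B| + 1 := ⟨_, rfl⟩
  have hM0 : 0 < M := by rw [hMe]; positivity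
  have hΛM : ∀ z ∈ Λ, ‖z‖ < M := fun z hz => by
    rw [hMe]; linarith [hB z hz, le_abs_self B]
  -- One number serves both as cone parameter and as tolerance for the coefficients to the left of
  -- `x₀`.
  obtain ⟨κ, hκe⟩ : ∃ κ, κ = 1 / (200 * (2 + M)) := ⟨_, rfl⟩
  have hκ : 0 < κ := by rw [hκe]; positivity
  have hκM : κ * (2 + M) ≤ 1 / 200 := by rw [hκe]; field_simp; exact le_refl _
  obtain ⟨x₀, hx₀, hNE₀, hNE⟩ := exists_nearEnd (γ := γ) hκ
  have hF₀ := hW₀.modeFamily_lim hγ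
  have happ := fun {ε : ℝ} (hε : 0 < ε) =>
    exists_uniform_approximation hγ hM0 hW₀ hl hκ hκM hx₀ hNE₀ hNE hε
  have hcont := continuousOn_limEvans hF₀ hNE₀ hκM hκ hκM hM0.le hl
  have hne : ∀ z ∈ closedRHP, ‖z‖ ≤ M → W₀ z x₀ 0 ≠ 0 := fun z hz hM =>
    hF₀.u_ne_zero hNE₀ hκM hκ hκM hz hM
  constructor
  · intro hnz
    rcases Λ.eq_empty_or_nonempty with rfl | hΛne
    · exact ⟨1, one_pos, by simp⟩
    obtain ⟨w, hw, hmin⟩ := hΛ.exists_isMinOn hΛne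
      (hcont.mono fun z hz => ⟨hΛre z hz, (hΛM z hz).le⟩).norm
    have hpos : 0 < ‖D₀ w / W₀ w x₀ 0‖ :=
      norm_pos_iff.2 (div_ne_zero (hnz w hw) (hne w (hΛre w hw) (hΛM w hw).le))
    obtain ⟨δ, hδ, hδ'⟩ := mem_nhdsGT_iff_exists_Ioo_subset.1 (happ (half_pos hpos))
    refine ⟨δ, hδ, fun vp h0 h1 D hD z hz hDz => ?_⟩
    obtain ⟨H, hH⟩ := hδ' ⟨h0, h1⟩ D hD
    obtain ⟨-, hiff, hle⟩ := hH z (hΛre z hz) (hΛM z hz).le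
    rw [hiff.1 hDz, zero_sub, norm_neg] at hle
    have : ‖D₀ w / W₀ w x₀ 0‖ ≤ ‖D₀ z / W₀ z x₀ 0‖ := hmin hz
    linarith
  · intro hseq z hz hDz
    -- Interior points of `Λ` avoid the imaginary axis, so they lie where holomorphy of the limit
    -- has been established.
    have hint : interior Λ ⊆ {z : ℂ | 0 < z.re ∧ ‖z‖ < M} := fun w hw => by
      have h1 : w ∈ interior {z : ℂ | 0 ≤ z.re} := interior_mono (fun z hz => hΛre z hz) hw
      rw [Complex.interior_setOfPred_le_re] at h1
      exact ⟨h1, hΛM w (interior_subset hw)⟩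
    refine ne_zero_of_approximation (isOpen_halfDisc M) (isPreconnected_halfDisc M)
      (differentiableOn_limEvans hF₀ hNE₀ hκM hκ hκM hM0.le hl)
      (exists_halfDisc_ne_zero hM0 hcont (div_ne_zero hD00
        (hne 0 (by simp [closedRHP]) (by simpa using hM0.le))))
      isOpen_interior hint (fun ε hε => ?_) hz (by rw [hDz, zero_div])
    obtain ⟨δ, hδ, hδ'⟩ := mem_nhdsGT_iff_exists_Ioo_subset.1 (happ hε)
    obtain ⟨vp, h0, h1, D, hD, hDne⟩ := hseq δ hδ
    obtain ⟨H, hH⟩ := hδ' ⟨h0, h1⟩ D hD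
    refine ⟨H, fun w hw => ?_⟩
    obtain ⟨ha, hiff, hle⟩ := hH w (hint hw).1.le (hint hw).2.le
    exact ⟨ha.differentiableAt, fun h => hDne w hw (hiff.2 h), hle⟩
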